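/- A rooted planar map is a finite connected multigraph (with at least one edge) embedded in the sphere, with one distinguished corner (the root corner), considered up to orientation-preserving homeomorphism; the face incident to the root corner is the root face. For $p\ge 3$, a triangulation of the $p$-gon is a rooted planar map whose root face has degree $p$ and a simple boundary and all of whose other faces have degree $3$. It is of type II if it has no self-loops, and of type III if it has neither self-loops nor multiple edges. Let $\Delta_{\mathrm{II}}(p)$ and $\Delta_{\mathrm{III}}(p)$ be the sets of such triangulations, and let $V(M)$, $E(M)$ be the sets of vertices and edges of $M$. Put $\rho_{\mathrm{II}}=2/27$ and $\rho_{\mathrm{III}}=27/256$. For $i\in\{\mathrm{II},\mathrm{III}\}$, the measure on $\Delta_i(p)$ giving weight $\rho_i^{|V(M)|}$ to each $M$ is finite and nonzero; let $\mathrm{Bol}_i(p)$ be the probability measure obtained by normalizing it. A type II triangulation of the $2$-gon is either the degenerate map made of two parallel edges joining two vertices, or a rooted planar map without self-loops, with more than two vertices, whose root face has degree $2$ and all of whose other faces have degree $3$. For every $p\ge 3$ and $M\in\Delta_{\mathrm{II}}(p)$ there is exactly one type III triangulation $S$ of a polygon such that $M$ is obtained from $S$ by opening each edge of $S$ into a $2$-gon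 and gluing into it some type II triangulation of the $2$-gon along its root face (gluing in the degenerate map leaves the edge unchanged), the root corner of $M$ being the one inherited from $S$. This $S$ is called the simple core of $M$ and is denoted by $\mathrm{S}^\bullet(M)$. Proposition. For $p\ge 3$, let $\mathsf M_p$ be a sample from $\mathrm{Bol}_{\mathrm{II}}(p)$ and let $S_p=\mathrm{S}^\bullet(\mathsf M_p)$. Then $|E(\mathsf M_p)|/|E(S_p)|\to 2$ in probability as $p\to\infty$. Moreover, for every $p\ge 3$, the law of $S_p$ is $\mathrm{Bol}_{\mathrm{III}}(p)$. -/

import Mathlib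

open Filter Topology MeasureTheory
open scoped ENNReal NNReal

/-! ### Rooted planar maps as rotation systems -/

/-- A rooted planar map with set of darts (half-edges, oriented edges) `D`.
Every dart is thought of as leaving its origin vertex. `rot d` is the next dart clockwise around
the origin of `d`, and `flip d` is the other dart of the edge of `d`. The cycles of `rot` are the
vertices, those of `flip` the edges, and those of `rot * flip` the faces (a face is followed
keeping it on the left). The map is connected, and embedded in the sphere by Euler's formula.
Corners correspond to darts: the corner between `rot⁻¹ d` and `d` is encoded by `d`.
`root` encodes the root corner: the root vertex is the origin of `root`, the root face is the
face on the left of `root`, and the root edge is the edge of `rot⁻¹ root`. -/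
structure RootedPlanarMap (D : Type) where
  finite : Finite D
  rot : Equiv.Perm D
  flip : Equiv.Perm D
  root : D
  flip_flip : ∀ d, flip (flip d) = d
  flip_ne : ∀ d, flip d ≠ d
  connected : ∀ d d', ∃ g ∈ Subgroup.closure ({rot, flip} : Set (Equiv.Perm D)), g d = d'
  euler : Nat.card (Quotient (Equiv.Perm.SameCycle.setoid rot))
      + Nat.card (Quotient (Equiv.Perm.SameCycle.setoid (rot * flip)))
    = Nat.card (Quotient (Equiv.Perm.SameCycle.setoid flip)) + 2

namespace RootedPlanarMap

variable {D D' D'' : Type}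

/-- The next dart along the face on the left of a dart. -/
def face (m : RootedPlanarMap D) : Equiv.Perm D := m.rot * m.flip

/-- Number of vertices (the size of the map). -/
noncomputable def numVertices (m : RootedPlanarMap D) : ℕ :=
  Nat.card (Quotient (Equiv.Perm.SameCycle.setoid m.rot))

/-- Number of edges. -/
noncomputable def numEdges (m : RootedPlanarMap D) : ℕ :=
  Nat.card (Quotient (Equiv.Perm.SameCycle.setoid m.flip))

/-- The degree (number of corners) of the face on the left of `d`. -/
noncomputable def faceDegree (m : RootedPlanarMap D) (d : D) : ℕ :=
  Nat.card {d' : D // m.face.SameCycle d d'}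

/-- `d` lies on the root face. -/
def OnRootFace (m : RootedPlanarMap D) (d : D) : Prop := m.face.SameCycle m.root d

/-- Triangulation with boundary of length `p`: the root face has degree `p`, all the other faces
have degree 3. -/
def IsTriangulationWithBoundary (m : RootedPlanarMap D) (p : ℕ) : Prop :=
  m.faceDegree m.root = p ∧ ∀ d, ¬ m.OnRootFace d → m.faceDegree d = 3

/-- The boundary of the root face is simple: it visits no vertex twice. -/
def HasSimpleBoundary (m : RootedPlanarMap D) : Prop :=
  ∀ d d', m.OnRootFace d → m.OnRootFace d' → m.rot.SameCycle d d' → d = d'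

/-- Triangulation of the `p`-gon. -/
def IsPolygonTriangulation (m : RootedPlanarMap D) (p : ℕ) : Prop :=
  m.IsTriangulationWithBoundary p ∧ m.HasSimpleBoundary

/-- No self-loops. -/
def Loopless (m : RootedPlanarMap D) : Prop := ∀ d, ¬ m.rot.SameCycle d (m.flip d)

/-- No multiple edges: a dart is determined by its origin and its endpoint. -/
def NoMultipleEdges (m : RootedPlanarMap D) : Prop :=
  ∀ d d', m.rot.SameCycle d d' → m.rot.SameCycle (m.flip d) (m.flip d') → d = d'

/-- Type II triangulations of the `p`-gon. -/
def IsTypeII (m : RootedPlanarMap D) (p : ℕ) : Prop :=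
  m.IsPolygonTriangulation p ∧ m.Loopless

/-- Type III triangulations of the `p`-gon. -/
def IsTypeIII (m : RootedPlanarMap D) (p : ℕ) : Prop :=
  m.IsPolygonTriangulation p ∧ m.Loopless ∧ m.NoMultipleEdges

/-- Type II triangulations of the 2-gon: loopless, root face of degree 2, other faces of degree 3.
The only such map with two vertices is the one with a single edge; it stands for the degenerate
2-gon, with its two parallel edges already collapsed into one. -/
def IsDigon (m : RootedPlanarMap D) : Prop :=
  m.IsTriangulationWithBoundary 2 ∧ m.Loopless

/-- Root-preserving and orientation-preserving isomorphism of rooted planar maps. -/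
def Iso (m : RootedPlanarMap D) (m' : RootedPlanarMap D') : Prop :=
  ∃ f : D ≃ D', (∀ d, f (m.rot d) = m'.rot (f d)) ∧ (∀ d, f (m.flip d) = m'.flip (f d)) ∧
    f m.root = m'.root

theorem Iso.refl (m : RootedPlanarMap D) : m.Iso m :=
  ⟨Equiv.refl D, fun _ => rfl, fun _ => rfl, rfl⟩

theorem Iso.symm {m : RootedPlanarMap D} {m' : RootedPlanarMap D'} (h : m.Iso m') : m'.Iso m := by
  obtain ⟨f, hr, hf, h0⟩ := h
  refine ⟨f.symm, fun d => ?_, fun d => ?_, ?_⟩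
  · rw [Equiv.symm_apply_eq, hr, Equiv.apply_symm_apply]
  · rw [Equiv.symm_apply_eq, hf, Equiv.apply_symm_apply]
  · rw [Equiv.symm_apply_eq, h0]

theorem Iso.trans {m : RootedPlanarMap D} {m' : RootedPlanarMap D'} {m'' : RootedPlanarMap D''}
    (h : m.Iso m') (h' : m'.Iso m'') : m.Iso m'' := by
  obtain ⟨f, hr, hf, h0⟩ := h
  obtain ⟨g, gr, gf, g0⟩ := h'
  exact ⟨f.trans g, fun d => by simp [hr, gr], fun d => by simp [hf, gf], by simp [h0, g0]⟩

/-- A bijection conjugating two permutations preserves their cycles. -/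
theorem sameCycle_iff_of_conj {s : Equiv.Perm D} {t : Equiv.Perm D'} (f : D ≃ D')
    (h : ∀ d, f (s d) = t (f d)) (x y : D) : s.SameCycle x y ↔ t.SameCycle (f x) (f y) := by
  have ht : t = f.symm.trans (s.trans f) := by
    ext d
    simp [h]
  have hz : ∀ (n : ℤ) (d : D), (t ^ n) (f d) = f ((s ^ n) d) := by
    have hn : ∀ (n : ℕ) (d : D), (t ^ n) (f d) = f ((s ^ n) d) := by
      intro n
      induction n with
      | zero => intro d; rfl
      | succ k ih => intro d; rw [pow_succ, pow_succ, Equiv.Perm.mul_apply, ← h, ih]; rfl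
    intro n d
    cases n with
    | ofNat k => exact hn k d
    | negSucc k =>
      rw [zpow_negSucc, zpow_negSucc, Equiv.Perm.inv_eq_iff_eq, hn]
      simp
  constructor
  · rintro ⟨n, rfl⟩
    exact ⟨n, hz n x⟩
  · rintro ⟨n, hn⟩
    exact ⟨n, f.injective (by rw [← hz, hn])⟩

theorem card_cycles_of_conj {s : Equiv.Perm D} {t : Equiv.Perm D'} (f : D ≃ D')
    (h : ∀ d, f (s d) = t (f d)) :
    Nat.card (Quotient (Equiv.Perm.SameCycle.setoid s))
      = Nat.card (Quotient (Equiv.Perm.SameCycle.setoid t)) :=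
  Nat.card_congr (Quotient.congr f (fun a b => sameCycle_iff_of_conj f h a b))

theorem Iso.numVertices_eq {m : RootedPlanarMap D} {m' : RootedPlanarMap D'} (h : m.Iso m') :
    m.numVertices = m'.numVertices := by
  obtain ⟨f, hr, -, -⟩ := h
  exact card_cycles_of_conj f hr

theorem Iso.numEdges_eq {m : RootedPlanarMap D} {m' : RootedPlanarMap D'} (h : m.Iso m') :
    m.numEdges = m'.numEdges := by
  obtain ⟨f, -, hf, -⟩ := h
  exact card_cycles_of_conj f hf

/-- A decomposition of `M` into a core `S` and type II triangulations of the 2-gon, one for every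
edge of `S`: each edge of `S` is opened into a 2-gon, into which the 2-gon `comp e` is glued along
its root face (nothing happens to the edge if `comp e` is the degenerate 2-gon).

* `orient` contains exactly one dart of every edge of `S`, that is, it orients the edges of `S`;
* `glue`: the darts of `M` are those of all the 2-gons;
* `side d` is the dart of `M` which replaces the dart `d` of `S`: the two darts of an edge of `S`
  become the two darts on the root face of the 2-gon of this edge;
* edges of `M` are those of the 2-gons; the faces of `M` are the non-root faces of the 2-gons
  (`face_glue`) and the faces of `S` (`face_side`); the root is that of `S`. -/
structure CoreDecomposition (M : RootedPlanarMap D) (S : RootedPlanarMap D') where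
  orient : Set D'
  orient_flip : ∀ d, S.flip d ∈ orient ↔ d ∉ orient
  size : orient → ℕ
  comp : ∀ e, RootedPlanarMap (Fin (size e))
  comp_digon : ∀ e, (comp e).IsDigon
  glue : (Σ e : orient, Fin (size e)) ≃ D
  side : D' → D
  side_orient : ∀ e : orient, side e = glue ⟨e, (comp e).root⟩
  side_flip : ∀ e : orient, side (S.flip e) = glue ⟨e, (comp e).face (comp e).root⟩
  flip_glue : ∀ e x, M.flip (glue ⟨e, x⟩) = glue ⟨e, (comp e).flip x⟩
  face_glue : ∀ e x, ¬ (comp e).OnRootFace x → M.face (glue ⟨e, x⟩) = glue ⟨e, (comp e).face x⟩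
  face_side : ∀ d, M.face (side d) = side (S.face d)
  root_side : M.root = side S.root

/-- Rooted planar maps with darts `0, …, n - 1` for some `n`. -/
instance labelledSetoid : Setoid (Σ n : ℕ, RootedPlanarMap (Fin n)) where
  r m m' := m.2.Iso m'.2
  iseqv := ⟨fun m => Iso.refl m.2, Iso.symm, Iso.trans⟩

end RootedPlanarMap

/-- The countable set of rooted planar maps, that is, of isomorphism classes. -/
def PlanarMap : Type := Quotient RootedPlanarMap.labelledSetoid

namespace PlanarMap

/-- The class of a labelled map. -/
def mk {n : ℕ} (m : RootedPlanarMap (Fin n)) : PlanarMap :=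
  Quotient.mk RootedPlanarMap.labelledSetoid ⟨n, m⟩

instance : MeasurableSpace PlanarMap := ⊤

instance : DiscreteMeasurableSpace PlanarMap := ⟨fun _ => trivial⟩

/-- `|V(M)|`, the size of `M`. -/
noncomputable def numVertices : PlanarMap → ℕ :=
  Quotient.lift (fun m => m.2.numVertices) fun _ _ h => RootedPlanarMap.Iso.numVertices_eq h

/-- `|E(M)|`. -/
noncomputable def numEdges : PlanarMap → ℕ :=
  Quotient.lift (fun m => m.2.numEdges) fun _ _ h => RootedPlanarMap.Iso.numEdges_eq h

/-- The set of type II triangulations of the `p`-gon. -/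
def typeII (p : ℕ) : Set PlanarMap :=
  {M | ∃ (n : ℕ) (m : RootedPlanarMap (Fin n)), mk m = M ∧ m.IsTypeII p}

/-- The set of type III triangulations of the `p`-gon. -/
def typeIII (p : ℕ) : Set PlanarMap :=
  {M | ∃ (n : ℕ) (m : RootedPlanarMap (Fin n)), mk m = M ∧ m.IsTypeIII p}

/-- The measure giving weight `ρ ^ |V(M)|` to each `M` in `Δ`, normalized. -/
noncomputable def boltzmann (Δ : Set PlanarMap) (ρ : ℝ≥0) : Measure PlanarMap :=
  let μ : Measure PlanarMap :=
    Measure.sum fun M : Δ => ((ρ ^ numVertices M.1 : ℝ≥0) : ℝ≥0∞) • Measure.dirac M.1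
  (μ Set.univ)⁻¹ • μ

/-- `Bol_II(p)`, with `ρ_II = 2 / 27`. -/
noncomputable def bolII (p : ℕ) : Measure PlanarMap := boltzmann (typeII p) (2 / 27)

/-- `Bol_III(p)`, with `ρ_III = 27 / 256`. -/
noncomputable def bolIII (p : ℕ) : Measure PlanarMap := boltzmann (typeIII p) (27 / 256)

/-- `S` is a type III triangulation of a polygon, and `M` arises from `S` by gluing a type II
triangulation of the 2-gon into every edge of `S`. -/
def IsSimpleCore (M S : PlanarMap) : Prop :=
  (∃ p, 3 ≤ p ∧ S ∈ typeIII p) ∧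
    ∃ (n k : ℕ) (m : RootedPlanarMap (Fin n)) (s : RootedPlanarMap (Fin k)),
      mk m = M ∧ mk s = S ∧ Nonempty (m.CoreDecomposition s)

open Classical in
/-- The simple core of `M` (junk value `M` if there is none). -/
noncomputable def simpleCore (M : PlanarMap) : PlanarMap :=
  if h : ∃ S, IsSimpleCore M S then h.choose else M

end PlanarMap

/-!
The proof rests on the generating function of the type II triangulations of the 2-gon and on the
bijection between triangulations and cores decorated by 2-gons.

*Surgery on maps.* Maps are handled as pairs of permutations of the darts (`CombMap`), without any
condition of genus. Surgeries multiply one of the permutations by transpositions, each of which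
splits or merges two cycles; connectedness and planarity of the results come from Euler's formula
and from the genus inequality `numCycles_add_le`.

*Enumeration.* Unless the map is a single edge, deleting the edge of the root dart of a triangulation
of the `p`-gon gives either a triangulation of the `(p + 1)`-gon or two triangulations of polygons
joined at a vertex. This is Tutte's equation (`PlanarMap.tsum_typeII`, `PlanarMap.genFun_eq`). For the weight
`x = θ * (1 - 2 * θ) ^ 2` per inner vertex, with `θ ≤ 1 / 6`, it has an explicit nonnegative
solution in terms of Catalan numbers, which bounds the generating functions from above by
minimality. As the discriminant of Tutte's quadratic equation is nonnegative, the generating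
function of the 2-gons cannot be smaller than the solution (`PlanarMap.genFun_two`). At `θ = 1 / 6`,
that is `x = 2 / 27`, its value is `9 / 8`; its derivative there is `81 / 16`, and it follows that
the number of edges of a Boltzmann triangulation of the 2-gon has mean 2
(`PlanarMap.hasSum_digon`, `PlanarMap.integral_numEdges`).

*The core.* Gluing 2-gons into the edges of `S` is described by `CombMap.Insertion`: a map `U`, the
disjoint union of the 2-gons, and the position of the darts of `S` on their root faces. Cutting a
map along two parallel edges disconnects it, and a core exists by induction on the size of the piece
that contains the root (`CombMap.IsTri.exists_insertion`). It is unique because in a loopless map no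
edge separates the faces on its two sides (`CombMap.Insertion.side_flip_eq`). Consequently the
triangulations of the `p`-gon with core `S` are in bijection with the families of 2-gons indexed by
the edges of `S` (`PlanarMap.exists_core_equiv`).

*Conclusion.* By Euler's formula `S` has `3 * |V(S)| - p - 3` edges. Given that the core is `S`, the
2-gons are independent Boltzmann triangulations, and summing over them multiplies the weight of `S`
by `(9 / 8) ^ |E(S)|`, so that a vertex of `S` has weight `2 / 27 * (9 / 8) ^ 3 = 27 / 256`
(`PlanarMap.exists_law`). The number of edges of the triangulation is the sum of those of the
2-gons, and as `|E(S)| ≥ p`, the weak law of large numbers gives the limit 2.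
-/

open Equiv Equiv.Perm

/-! ### Cycles of permutations and products with a transposition -/

section Glue

variable {D : Type*}

/-- The equivalence relation obtained from `s` by merging the classes of `x` and `y`. -/
def Setoid.glue (s : Setoid D) (x y : D) : Setoid D where
  r z w := s z w ∨ (s z x ∧ s w y) ∨ (s z y ∧ s w x)
  iseqv := by
    refine ⟨fun z => Or.inl (s.refl' z), ?_, ?_⟩
    · rintro z w (h | ⟨h, h'⟩ | ⟨h, h'⟩)
      exacts [Or.inl (s.symm' h), Or.inr (Or.inr ⟨h', h⟩), Or.inr (Or.inl ⟨h', h⟩)]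
    · rintro z w v (h | ⟨h, h'⟩ | ⟨h, h'⟩) (k | ⟨k, k'⟩ | ⟨k, k'⟩)
      · exact Or.inl (s.trans' h k)
      · exact Or.inr (Or.inl ⟨s.trans' h k, k'⟩)
      · exact Or.inr (Or.inr ⟨s.trans' h k, k'⟩)
      · exact Or.inr (Or.inl ⟨h, s.trans' (s.symm' k) h'⟩)
      · exact Or.inl (s.trans' h (s.trans' (s.trans' (s.symm' k) h') (s.symm' k')))
      · exact Or.inl (s.trans' h (s.symm' k'))
      · exact Or.inr (Or.inr ⟨h, s.trans' (s.symm' k) h'⟩)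
      · exact Or.inl (s.trans' h (s.symm' k'))
      · exact Or.inl (s.trans' h (s.trans' (s.trans' (s.symm' k) h') (s.symm' k')))

theorem Setoid.glue_apply {s : Setoid D} {x y z w : D} :
    s.glue x y z w ↔ s z w ∨ (s z x ∧ s w y) ∨ (s z y ∧ s w x) := Iff.rfl

theorem Setoid.le_glue (s : Setoid D) (x y : D) : s ≤ s.glue x y := fun _ _ h => Or.inl h

theorem Setoid.glue_self (s : Setoid D) (x y : D) : s.glue x y x y :=
  Or.inr (Or.inl ⟨s.refl' x, s.refl' y⟩)

theorem Setoid.glue_le_iff {s t : Setoid D} {x y : D} : s.glue x y ≤ t ↔ s ≤ t ∧ t x y := by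
  refine ⟨fun h => ⟨(s.le_glue x y).trans h, h (s.glue_self x y)⟩, ?_⟩
  rintro ⟨h, hxy⟩ z w (k | ⟨k, k'⟩ | ⟨k, k'⟩)
  · exact h k
  · exact t.trans' (h k) (t.trans' hxy (t.symm' (h k')))
  · exact t.trans' (h k) (t.trans' (t.symm' hxy) (t.symm' (h k')))

theorem Setoid.glue_eq_self {s : Setoid D} {x y : D} (h : s x y) : s.glue x y = s :=
  le_antisymm (Setoid.glue_le_iff.2 ⟨le_rfl, h⟩) (s.le_glue x y)

theorem Setoid.glue_mono {s t : Setoid D} (h : s ≤ t) (x y : D) : s.glue x y ≤ t.glue x y :=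
  Setoid.glue_le_iff.2 ⟨h.trans (t.le_glue x y), t.glue_self x y⟩

open Classical in
theorem Setoid.card_glue [Finite D] {s : Setoid D} {x y : D} (h : ¬ s x y) :
    Nat.card (Quotient (s.glue x y)) + 1 = Nat.card (Quotient s) := by
  have hne : (Quotient.mk s y) ≠ Quotient.mk s x := fun e => h (s.symm' (Quotient.exact e))
  let f : D → {q : Quotient s // q ≠ Quotient.mk s x} := fun z =>
    if hz : s z x then ⟨Quotient.mk s y, hne⟩
    else ⟨Quotient.mk s z, fun e => hz (Quotient.exact e)⟩
  have hf : Function.Surjective f := by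
    rintro ⟨q, hq⟩
    induction q using Quotient.inductionOn with
    | h z =>
      refine ⟨z, ?_⟩
      have hz : ¬ s z x := fun e => hq (Quotient.sound e)
      simp only [f, hz, dif_neg, not_false_eq_true]
  have hker : s.glue x y = Setoid.ker f := by
    ext z w
    rw [Setoid.ker_def, Setoid.glue_apply]
    have hq : ∀ a b : D, Quotient.mk s a = Quotient.mk s b ↔ s a b :=
      fun a b => ⟨fun e => Quotient.exact e, fun e => Quotient.sound e⟩
    by_cases hz : s z x <;> by_cases hw : s w x
    · have : s z w := s.trans' hz (s.symm' hw)
      simp [f, hz, hw, this]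
    · have h1 : ¬ s z w := fun e => hw (s.trans' (s.symm' e) hz)
      simp [f, hz, hw, h1, hq, s.comm' (x := y) (y := w)]
    · have h1 : ¬ s z w := fun e => hz (s.trans' e hw)
      simp [f, hz, hw, h1, hq]
    · simp [f, hz, hw, hq]
  rw [hker, Nat.card_congr (Setoid.quotientKerEquivOfSurjective f hf),
    ← Finite.card_option, Nat.card_congr (Equiv.optionSubtypeNe _)]

theorem Setoid.card_le_card_glue_add_one [Finite D] (s : Setoid D) (x y : D) :
    Nat.card (Quotient s) ≤ Nat.card (Quotient (s.glue x y)) + 1 := by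
  by_cases h : s x y
  · rw [Setoid.glue_eq_self h]; omega
  · rw [Setoid.card_glue h]

end Glue

namespace Equiv.Perm

variable {D : Type*}

/-- The number of cycles of a permutation, fixed points included. -/
noncomputable def numCycles (π : Perm D) : ℕ := Nat.card (Quotient (SameCycle.setoid π))

theorem setoid_apply {π : Perm D} {x y : D} : SameCycle.setoid π x y ↔ π.SameCycle x y := Iff.rfl

theorem sameCycle_apply_self (π : Perm D) (x : D) : π.SameCycle x (π x) := ⟨1, rfl⟩

/-- On a finite set, a subset stable under `π` is a union of cycles. This is the usual way below of
following a cycle. -/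
theorem SameCycle.mem_of_mapsTo [Finite D] {π : Perm D} {A : Set D} (hA : ∀ z ∈ A, π z ∈ A)
    {x y : D} (h : π.SameCycle x y) (hx : x ∈ A) : y ∈ A := by
  obtain ⟨n, rfl⟩ := h.exists_nat_pow_eq
  clear h
  induction n with
  | zero => simpa using hx
  | succ n ih => rw [pow_succ', mul_apply]; exact hA _ ih

theorem setoid_le_iff [Finite D] {π : Perm D} {s : Setoid D} :
    SameCycle.setoid π ≤ s ↔ ∀ x, s x (π x) := by
  refine ⟨fun h x => h (sameCycle_apply_self π x), fun h x y hxy => ?_⟩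
  exact SameCycle.mem_of_mapsTo (A := {z | s x z}) (fun z hz => s.trans' hz (h z)) hxy (s.refl' x)

theorem setoid_inv (π : Perm D) : SameCycle.setoid π⁻¹ = SameCycle.setoid π := by
  ext x y
  exact sameCycle_inv

theorem numCycles_inv (π : Perm D) : numCycles π⁻¹ = numCycles π := by
  rw [numCycles, setoid_inv, numCycles]

theorem setoid_one : SameCycle.setoid (1 : Perm D) = ⊥ := by
  ext x y
  exact sameCycle_one

section Swap

variable [DecidableEq D] [Finite D] {π : Perm D} {x y : D}

/-- The first time at which the cycle of `x` visits `{x, y}` again. -/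
theorem exists_first_return (π : Perm D) (x y : D) : ∃ n : ℕ, 0 < n ∧
    ((π ^ n) x = x ∨ (π ^ n) x = y) ∧ ∀ i, 0 < i → i < n → (π ^ i) x ≠ x ∧ (π ^ i) x ≠ y := by
  classical
  have hex : ∃ n : ℕ, 0 < n ∧ ((π ^ n) x = x ∨ (π ^ n) x = y) :=
    ⟨orderOf π, orderOf_pos π, Or.inl (by rw [pow_orderOf_eq_one]; rfl)⟩
  refine ⟨Nat.find hex, (Nat.find_spec hex).1, (Nat.find_spec hex).2, fun i hi hn => ?_⟩
  have := Nat.find_min hex hn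
  push Not at this
  exact this hi

theorem sameCycle_swap_mul_of_not (h : ¬ π.SameCycle x y) : (swap x y * π).SameCycle x y := by
  obtain ⟨n, hn, hx | hy, hlt⟩ := exists_first_return π x y
  · have key : ∀ i, i < n → (swap x y * π).SameCycle x ((π ^ i) x) := by
      intro i
      induction i with
      | zero => intro _; exact SameCycle.refl _ _
      | succ i ih =>
        intro hi
        refine (ih (by omega)).trans ?_
        have h1 := hlt (i + 1) (by omega) hi
        have h2 : (swap x y * π) ((π ^ i) x) = (π ^ (i + 1)) x := by
          rw [mul_apply, ← mul_apply π, ← pow_succ', swap_apply_of_ne_of_ne h1.1 h1.2]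
        rw [← h2]
        exact sameCycle_apply_self _ _
    refine (key (n - 1) (by omega)).trans ?_
    have h2 : (swap x y * π) ((π ^ (n - 1)) x) = y := by
      rw [mul_apply, ← mul_apply π, ← pow_succ', Nat.sub_add_cancel hn, hx, swap_apply_left]
    nth_rewrite 2 [← h2]
    exact sameCycle_apply_self _ _
  · exact absurd ⟨(n : ℤ), by simpa using hy⟩ h

theorem not_sameCycle_swap_mul (h : π.SameCycle x y) (hxy : x ≠ y) :
    ¬ (swap x y * π).SameCycle x y := by
  obtain ⟨n, hn, hxy', hlt⟩ := exists_first_return π x y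
  set A : Set D := {z | ∃ i < n, (π ^ i) x = z} with hA
  have hxA : x ∈ A := ⟨0, hn, rfl⟩
  have hyA : y ∉ A := by
    rintro ⟨i, hi, hiy⟩
    rcases Nat.eq_zero_or_pos i with rfl | hi0
    · exact hxy hiy
    · exact (hlt i hi0 hi).2 hiy
  have hstep : ∀ i < n, π ((π ^ i) x) = (π ^ (i + 1)) x := fun i _ => by
    rw [pow_succ', mul_apply]
  rcases hxy' with hx | hy
  · refine absurd (h.mem_of_mapsTo (A := A) ?_ hxA) hyA
    rintro z ⟨i, hi, rfl⟩
    rw [hstep i hi]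
    rcases Nat.lt_or_ge (i + 1) n with h' | h'
    · exact ⟨i + 1, h', rfl⟩
    · have : i + 1 = n := by omega
      rw [this, hx]; exact hxA
  · intro h'
    refine absurd (h'.mem_of_mapsTo (A := A) ?_ hxA) hyA
    rintro z ⟨i, hi, rfl⟩
    rw [mul_apply, hstep i hi]
    rcases Nat.lt_or_ge (i + 1) n with h' | h'
    · have h1 := hlt (i + 1) (by omega) h'
      rw [swap_apply_of_ne_of_ne h1.1 h1.2]
      exact ⟨i + 1, h', rfl⟩
    · have : i + 1 = n := by omega
      rw [this, hy, swap_apply_right]; exact hxA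

/-- Multiplying by a transposition of elements of distinct cycles merges these cycles. -/
theorem setoid_swap_mul (h : ¬ π.SameCycle x y) :
    SameCycle.setoid (swap x y * π) = (SameCycle.setoid π).glue x y := by
  refine le_antisymm (setoid_le_iff.2 fun z => ?_) (Setoid.glue_le_iff.2 ⟨setoid_le_iff.2
    fun z => ?_, sameCycle_swap_mul_of_not h⟩)
  · rw [mul_apply]
    have hz := sameCycle_apply_self π z
    by_cases h1 : π z = x
    · rw [h1, swap_apply_left]
      exact Or.inr (Or.inl ⟨h1 ▸ hz, SameCycle.refl _ _⟩)
    by_cases h2 : π z = y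
    · rw [h2, swap_apply_right]
      exact Or.inr (Or.inr ⟨h2 ▸ hz, SameCycle.refl _ _⟩)
    rw [swap_apply_of_ne_of_ne h1 h2]
    exact Or.inl hz
  · have hz : (swap x y * π).SameCycle z (swap x y (π z)) := sameCycle_apply_self (swap x y * π) z
    have hxy := sameCycle_swap_mul_of_not h
    by_cases h1 : π z = x
    · rw [h1, swap_apply_left] at hz
      rw [h1]
      exact hz.trans hxy.symm
    by_cases h2 : π z = y
    · rw [h2, swap_apply_right] at hz
      rw [h2]
      exact hz.trans hxy
    rwa [swap_apply_of_ne_of_ne h1 h2] at hz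

/-- Multiplying by a transposition of two elements of one cycle splits this cycle. -/
theorem setoid_eq_glue_swap_mul (h : π.SameCycle x y) (hxy : x ≠ y) :
    SameCycle.setoid π = (SameCycle.setoid (swap x y * π)).glue x y := by
  rw [← setoid_swap_mul (not_sameCycle_swap_mul h hxy), swap_mul_self_mul]

theorem numCycles_swap_mul_of_not (h : ¬ π.SameCycle x y) :
    numCycles (swap x y * π) + 1 = numCycles π := by
  rw [numCycles, setoid_swap_mul h, numCycles, Setoid.card_glue h]

theorem numCycles_swap_mul (h : π.SameCycle x y) (hxy : x ≠ y) :
    numCycles (swap x y * π) = numCycles π + 1 := by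
  rw [← numCycles_swap_mul_of_not (not_sameCycle_swap_mul h hxy), swap_mul_self_mul]

theorem setoid_mul_swap (h : ¬ π.SameCycle x y) :
    SameCycle.setoid (π * swap x y) = (SameCycle.setoid π).glue x y := by
  rw [← setoid_inv, mul_inv_rev, swap_inv, setoid_swap_mul (by rwa [sameCycle_inv]), setoid_inv]

theorem setoid_eq_glue_mul_swap (h : π.SameCycle x y) (hxy : x ≠ y) :
    SameCycle.setoid π = (SameCycle.setoid (π * swap x y)).glue x y := by
  rw [← setoid_inv (π * swap x y), mul_inv_rev, swap_inv,
    ← setoid_eq_glue_swap_mul (sameCycle_inv.2 h) hxy, setoid_inv]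

theorem numCycles_mul_swap_of_not (h : ¬ π.SameCycle x y) :
    numCycles (π * swap x y) + 1 = numCycles π := by
  rw [numCycles, setoid_mul_swap h, numCycles, Setoid.card_glue h]

theorem numCycles_mul_swap (h : π.SameCycle x y) (hxy : x ≠ y) :
    numCycles (π * swap x y) = numCycles π + 1 := by
  rw [← numCycles_inv, mul_inv_rev, swap_inv, numCycles_swap_mul (sameCycle_inv.2 h) hxy,
    numCycles_inv]

end Swap

theorem numCycles_one : numCycles (1 : Perm D) = Nat.card D := by
  rw [numCycles, setoid_one]
  exact Nat.card_congr Setoid.quotientBotEquiv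

/-- The genus inequality: a pair of permutations acts on every one of its orbits with nonnegative
genus. -/
theorem numCycles_add_le [Finite D] (σ α : Perm D) :
    numCycles σ + numCycles α + numCycles (σ * α)
      ≤ Nat.card D + 2 * Nat.card (Quotient (SameCycle.setoid σ ⊔ SameCycle.setoid α)) := by
  classical
  induction hn : Set.ncard {x | α x ≠ x} using Nat.strong_induction_on generalizing α with
  | _ n ih =>
  by_cases h1 : α = 1
  · subst h1
    rw [mul_one, numCycles_one, setoid_one, sup_bot_eq, ← numCycles]
    omega
  obtain ⟨x, hx⟩ : ∃ x, α x ≠ x := by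
    by_contra! h
    exact h1 (Equiv.ext h)
  obtain ⟨y, hy⟩ : ∃ y, α y = x := ⟨α⁻¹ x, by simp⟩
  have hxy : x ≠ y := by rintro rfl; exact hx hy
  -- `β` agrees with `α` except that `x` is taken out of its cycle
  set β := α * swap x y with hβ
  have hα : α = β * swap x y := by rw [hβ, mul_swap_mul_self]
  have hβx : β x = x := by rw [hβ, mul_apply, swap_apply_left, hy]
  have hlt : Set.ncard {z | β z ≠ z} < n := by
    rw [← hn]
    refine Set.ncard_lt_ncard ⟨fun z hz => ?_, fun h => ?_⟩ (Set.toFinite _)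
    · rcases eq_or_ne z x with rfl | h2
      · exact hx
      rcases eq_or_ne z y with rfl | h3
      · rw [Set.mem_ofPred_eq, hy]; exact hxy
      · rw [Set.mem_ofPred_eq, hβ, mul_apply, swap_apply_of_ne_of_ne h2 h3] at hz
        exact hz
    · exact h hx hβx
  have IH := ih _ hlt β rfl
  have hns : ¬ β.SameCycle x y := fun h => hxy (h.eq_of_left hβx)
  have hcα : numCycles α + 1 = numCycles β := by
    rw [hα]; exact numCycles_mul_swap_of_not hns
  have hJ : SameCycle.setoid σ ⊔ SameCycle.setoid α
      = (SameCycle.setoid σ ⊔ SameCycle.setoid β).glue x y := by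
    rw [hα, setoid_mul_swap hns]
    refine le_antisymm (sup_le (le_sup_left.trans (Setoid.le_glue _ _ _))
      (Setoid.glue_mono le_sup_right _ _)) (Setoid.glue_le_iff.2 ⟨sup_le le_sup_left
        ((Setoid.le_glue _ x y).trans le_sup_right), ?_⟩)
    exact (le_sup_right : _ ≤ SameCycle.setoid σ ⊔ _) (Setoid.glue_self _ x y)
  have hσα : σ * α = σ * β * swap x y := by rw [mul_assoc, ← hα]
  rw [hJ, hσα]
  by_cases hs : (σ * β).SameCycle x y
  · have hJ' : (SameCycle.setoid σ ⊔ SameCycle.setoid β) x y := by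
      have hle : SameCycle.setoid (σ * β) ≤ SameCycle.setoid σ ⊔ SameCycle.setoid β := by
        refine setoid_le_iff.2 fun z => Setoid.trans' _ (y := β z) ?_ ?_
        · exact (le_sup_right : _ ≤ SameCycle.setoid σ ⊔ _) (sameCycle_apply_self β z)
        · exact (le_sup_left : _ ≤ _ ⊔ SameCycle.setoid β) (sameCycle_apply_self σ (β z))
      exact hle hs
    rw [Setoid.glue_eq_self hJ', numCycles_mul_swap hs hxy]
    omega
  · have h2 := numCycles_mul_swap_of_not hs
    have h3 := Setoid.card_le_card_glue_add_one (SameCycle.setoid σ ⊔ SameCycle.setoid β) x y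
    omega

/-! ### Cycles under embeddings, disjoint unions and restrictions -/

variable {D' : Type*}

/-- A map which is injective and equivariant on the cycle of `x` maps this cycle onto a cycle. -/
theorem sameCycle_image_iff [Finite D] [Finite D'] {π : Perm D} {π' : Perm D'} (g : D → D')
    {x : D} (hg : ∀ y, π.SameCycle x y → π' (g y) = g (π y)) (z : D') :
    π'.SameCycle (g x) z ↔ ∃ y, π.SameCycle x y ∧ g y = z := by
  constructor
  · intro h
    refine h.mem_of_mapsTo (A := {z | ∃ y, π.SameCycle x y ∧ g y = z}) ?_
      ⟨x, SameCycle.refl _ _, rfl⟩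
    rintro _ ⟨y, hy, rfl⟩
    exact ⟨π y, hy.trans (sameCycle_apply_self π y), (hg y hy).symm⟩
  · rintro ⟨y, hy, rfl⟩
    refine (hy.mem_of_mapsTo (A := {y | π.SameCycle x y ∧ π'.SameCycle (g x) (g y)}) ?_
      ⟨SameCycle.refl _ _, SameCycle.refl _ _⟩).2
    rintro y ⟨hy, hy'⟩
    exact ⟨hy.trans (sameCycle_apply_self π y), hy'.trans (hg y hy ▸ sameCycle_apply_self π' (g y))⟩

theorem sameCycle_map_iff [Finite D] [Finite D'] {π : Perm D} {π' : Perm D'} {g : D → D'}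
    (hinj : Function.Injective g) {x y : D} (hg : ∀ y, π.SameCycle x y → π' (g y) = g (π y)) :
    π'.SameCycle (g x) (g y) ↔ π.SameCycle x y := by
  rw [sameCycle_image_iff g hg]
  constructor
  · rintro ⟨w, hw, h⟩
    exact hinj h ▸ hw
  · exact fun h => ⟨y, h, rfl⟩

theorem card_sameCycle_map [Finite D] [Finite D'] {π : Perm D} {π' : Perm D'} {g : D → D'}
    (hinj : Function.Injective g) {x : D} (hg : ∀ y, π.SameCycle x y → π' (g y) = g (π y)) :
    Nat.card {z // π'.SameCycle (g x) z} = Nat.card {y // π.SameCycle x y} := by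
  refine (Nat.card_congr (Equiv.ofBijective
    (fun y : {y // π.SameCycle x y} => (⟨g y.1, (sameCycle_image_iff g hg _).2 ⟨y.1, y.2, rfl⟩⟩ :
      {z // π'.SameCycle (g x) z})) ⟨?_, ?_⟩)).symm
  · intro a b h
    exact Subtype.ext (hinj (Subtype.ext_iff.1 h))
  · rintro ⟨z, hz⟩
    obtain ⟨y, hy, rfl⟩ := (sameCycle_image_iff g hg _).1 hz
    exact ⟨⟨y, hy⟩, rfl⟩

theorem numCycles_congr {π : Perm D} {π' : Perm D'} (f : D ≃ D') (h : ∀ d, f (π d) = π' (f d)) :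
    numCycles π = numCycles π' := by
  have hc : ∀ x y, π.SameCycle x y ↔ π'.SameCycle (f x) (f y) := by
    have : π' = f.permCongr π := by
      ext d; simp [permCongr_apply, h]
    intro x y
    rw [this]
    constructor
    · rintro ⟨n, rfl⟩
      refine ⟨n, ?_⟩
      have : (f.permCongr π) ^ n = f.permCongr (π ^ n) := (map_zpow f.permCongrHom π n).symm
      rw [this]; simp
    · rintro ⟨n, hn⟩
      refine ⟨n, ?_⟩
      have : (f.permCongr π) ^ n = f.permCongr (π ^ n) := (map_zpow f.permCongrHom π n).symm
      rw [this] at hn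
      simpa using hn
  exact Nat.card_congr (Quotient.congr f hc)

section Sum

variable [Finite D] [Finite D'] {π : Perm D} {π' : Perm D'}

theorem sameCycle_sumCongr_inl {x y : D} :
    (sumCongr π π').SameCycle (Sum.inl x) (Sum.inl y) ↔ π.SameCycle x y :=
  sameCycle_map_iff Sum.inl_injective fun _ _ => rfl

theorem sameCycle_sumCongr_inr {x y : D'} :
    (sumCongr π π').SameCycle (Sum.inr x) (Sum.inr y) ↔ π'.SameCycle x y :=
  sameCycle_map_iff Sum.inr_injective fun _ _ => rfl

theorem not_sameCycle_sumCongr_inl_inr {x : D} {y : D'} :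
    ¬ (sumCongr π π').SameCycle (Sum.inl x) (Sum.inr y) := by
  intro h
  obtain ⟨w, -, hw⟩ := (sameCycle_image_iff (π := π) (π' := sumCongr π π') Sum.inl
    (fun _ _ => rfl) _).1 h
  cases hw

theorem not_sameCycle_sumCongr_inr_inl {x : D} {y : D'} :
    ¬ (sumCongr π π').SameCycle (Sum.inr y) (Sum.inl x) :=
  fun h => not_sameCycle_sumCongr_inl_inr h.symm

end Sum

theorem numCycles_sumCongr [Finite D] [Finite D'] (π : Perm D) (π' : Perm D') :
    numCycles (sumCongr π π') = numCycles π + numCycles π' := by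
  rw [numCycles, numCycles, numCycles, ← Nat.card_sum]
  let f : D ⊕ D' → Quotient (SameCycle.setoid π) ⊕ Quotient (SameCycle.setoid π') :=
    Sum.map (Quotient.mk _) (Quotient.mk _)
  have hf : Function.Surjective f :=
    Sum.map_surjective.2 ⟨Quotient.mk_surjective, Quotient.mk_surjective⟩
  have hker : SameCycle.setoid (sumCongr π π') = Setoid.ker f := by
    ext z w
    rw [Setoid.ker_def, setoid_apply]
    rcases z with z | z <;> rcases w with w | w
    · rw [sameCycle_sumCongr_inl]
      simp only [f, Sum.map_inl, Sum.inl.injEq]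
      exact ⟨fun h => Quotient.sound h, fun h => Quotient.exact h⟩
    · simp [f, not_sameCycle_sumCongr_inl_inr]
    · rw [sameCycle_comm]; simp [f, not_sameCycle_sumCongr_inl_inr]
    · rw [sameCycle_sumCongr_inr]
      simp only [f, Sum.map_inr, Sum.inr.injEq]
      exact ⟨fun h => Quotient.sound h, fun h => Quotient.exact h⟩
  rw [hker]
  exact Nat.card_congr (Setoid.quotientKerEquivOfSurjective f hf)

theorem numCycles_subtypePerm_add [Finite D] (π : Perm D) (A : Set D)
    (h : ∀ x, π x ∈ A ↔ x ∈ A) (h' : ∀ x, π x ∈ Aᶜ ↔ x ∈ Aᶜ) :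
    numCycles (π.subtypePerm h) + numCycles (π.subtypePerm h') = numCycles π := by
  classical
  rw [← numCycles_sumCongr]
  refine numCycles_congr (Equiv.Set.sumCompl A) ?_
  rintro (d | d) <;> simp

/-- The number of elements is the sum over the cycles of their lengths. -/
theorem card_eq_sum_card_cycles [Finite D] (π : Perm D)
    [Fintype (Quotient (SameCycle.setoid π))] :
    Nat.card D = ∑ q : Quotient (SameCycle.setoid π),
      Nat.card {y // π.SameCycle q.out y} := by
  rw [Nat.card_congr (Equiv.sigmaFiberEquiv (Quotient.mk (SameCycle.setoid π))).symm,
    Nat.card_sigma]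
  refine Finset.sum_congr rfl fun q _ => Nat.card_congr (Equiv.subtypeEquivRight fun y => ?_)
  conv_lhs => rw [← q.out_eq]
  rw [eq_comm]
  exact Quotient.eq

theorem card_eq_two_mul_numCycles [Finite D] {π : Perm D} (h2 : ∀ d, π (π d) = d)
    (h1 : ∀ d, π d ≠ d) : Nat.card D = 2 * numCycles π := by
  classical
  have := Fintype.ofFinite (Quotient (SameCycle.setoid π))
  rw [card_eq_sum_card_cycles π, numCycles, Nat.card_eq_fintype_card,
    Finset.sum_congr rfl (g := fun _ => 2), Finset.sum_const, Finset.card_univ, smul_eq_mul,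
    mul_comm]
  intro q _
  have hs : {y | π.SameCycle q.out y} = {q.out, π q.out} := by
    ext y
    constructor
    · intro h
      refine SameCycle.mem_of_mapsTo (A := {q.out, π q.out}) ?_ h (by simp)
      rintro z (rfl | rfl)
      · simp
      · rw [h2]; simp
    · rintro (rfl | rfl)
      · exact SameCycle.refl _ _
      · exact sameCycle_apply_self _ _
  have := Set.ncard_pair (h1 q.out).symm
  rw [← hs] at this
  exact this

end Equiv.Perm

/-! ### Combinatorial maps of arbitrary genus -/

/-- A combinatorial map, possibly disconnected and of any genus, given by its face permutation and
its edge involution. As for `RootedPlanarMap`, the rotation around the vertices is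
`face * flip`. The surgeries on planar maps are products of `face` or `flip` with transpositions,
and their intermediate stages are combinatorial maps. -/
structure CombMap (D : Type) where
  face : Perm D
  flip : Perm D
  flip_flip : ∀ d, flip (flip d) = d
  flip_ne : ∀ d, flip d ≠ d

namespace CombMap

variable {D D' D'' : Type}

/-- The next dart around the origin of a dart. -/
def rot (N : CombMap D) : Perm D := N.face * N.flip

theorem rot_apply (N : CombMap D) (d : D) : N.rot d = N.face (N.flip d) := rfl

theorem rot_flip (N : CombMap D) (d : D) : N.rot (N.flip d) = N.face d := by
  rw [rot_apply, N.flip_flip]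

/-- The endpoint of a dart is the origin of the next dart along its face. -/
theorem sameCycle_rot_flip_face (N : CombMap D) (d : D) :
    N.rot.SameCycle (N.flip d) (N.face d) := by
  rw [← rot_flip]; exact sameCycle_apply_self _ _

/-- Two darts are related when they belong to the same connected component. -/
def reach (N : CombMap D) : Setoid D := SameCycle.setoid N.face ⊔ SameCycle.setoid N.flip

theorem reach_face (N : CombMap D) (d : D) : N.reach d (N.face d) :=
  (le_sup_left : _ ≤ N.reach) (sameCycle_apply_self N.face d)

theorem reach_flip (N : CombMap D) (d : D) : N.reach d (N.flip d) :=
  (le_sup_right : _ ≤ N.reach) (sameCycle_apply_self N.flip d)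

theorem reach_le_iff [Finite D] {N : CombMap D} {s : Setoid D} :
    N.reach ≤ s ↔ (∀ x, s x (N.face x)) ∧ ∀ x, s x (N.flip x) := by
  rw [reach, sup_le_iff, setoid_le_iff, setoid_le_iff]

/-- `A` is a union of connected components. -/
def IsClosed (N : CombMap D) (A : Set D) : Prop :=
  (∀ x, N.face x ∈ A ↔ x ∈ A) ∧ ∀ x, N.flip x ∈ A ↔ x ∈ A

theorem IsClosed.compl {N : CombMap D} {A : Set D} (h : N.IsClosed A) : N.IsClosed Aᶜ :=
  ⟨fun x => not_congr (h.1 x), fun x => not_congr (h.2 x)⟩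

theorem isClosed_reach (N : CombMap D) (x : D) : N.IsClosed {y | N.reach x y} :=
  ⟨fun y => ⟨fun h => N.reach.trans' h (N.reach.symm' (N.reach_face y)),
    fun h => N.reach.trans' h (N.reach_face y)⟩,
   fun y => ⟨fun h => N.reach.trans' h (N.reach.symm' (N.reach_flip y)),
    fun h => N.reach.trans' h (N.reach_flip y)⟩⟩

theorem IsClosed.mem_of_reach [Finite D] {N : CombMap D} {A : Set D} (h : N.IsClosed A) {x y : D}
    (hxy : N.reach x y) (hx : x ∈ A) : y ∈ A := by
  have : N.reach ≤ Setoid.ker (· ∈ A) :=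
    reach_le_iff.2 ⟨fun z => propext (h.1 z).symm, fun z => propext (h.2 z).symm⟩
  exact (show (x ∈ A) = (y ∈ A) from this hxy) ▸ hx

theorem isClosed_of_mapsTo [Finite D] {N : CombMap D} {A : Set D} (hf : ∀ z ∈ A, N.face z ∈ A)
    (ha : ∀ z ∈ A, N.flip z ∈ A) : N.IsClosed A :=
  ⟨fun x => ⟨fun h => SameCycle.mem_of_mapsTo hf (sameCycle_apply_self N.face x).symm h, hf x⟩,
    fun x => ⟨fun h => N.flip_flip x ▸ ha _ h, ha x⟩⟩

theorem mem_of_reach [Finite D] {N : CombMap D} {A : Set D} (hf : ∀ z ∈ A, N.face z ∈ A)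
    (ha : ∀ z ∈ A, N.flip z ∈ A) {x y : D} (hxy : N.reach x y) (hx : x ∈ A) : y ∈ A :=
  (isClosed_of_mapsTo hf ha).mem_of_reach hxy hx

theorem rot_reach (N : CombMap D) (d : D) : N.reach d (N.rot d) :=
  N.reach.trans' (N.reach_flip d) (N.reach_face _)

theorem reach_of_sameCycle_rot [Finite D] {N : CombMap D} {x y : D} (h : N.rot.SameCycle x y) :
    N.reach x y :=
  (setoid_le_iff (s := N.reach)).2 N.rot_reach h

/-- Every two darts are related by the face permutation and the edge involution. -/
def Connected (N : CombMap D) : Prop := ∀ x y, N.reach x y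

/-- Connected and of genus zero. -/
structure IsPlanar (N : CombMap D) : Prop where
  connected : N.Connected
  euler : numCycles N.rot + numCycles N.face = numCycles N.flip + 2

theorem card_eq [Finite D] (N : CombMap D) : Nat.card D = 2 * numCycles N.flip :=
  card_eq_two_mul_numCycles N.flip_flip N.flip_ne

theorem euler_le [Finite D] (N : CombMap D) :
    numCycles N.rot + numCycles N.face ≤ numCycles N.flip + 2 * Nat.card (Quotient N.reach) := by
  have h := numCycles_add_le N.face N.flip
  rw [N.card_eq] at h
  change numCycles N.face + numCycles N.flip + numCycles N.rot
    ≤ 2 * numCycles N.flip + 2 * Nat.card (Quotient N.reach) at h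
  omega

theorem card_quotient_reach_of_connected [Nonempty D] {N : CombMap D} (h : N.Connected) :
    Nat.card (Quotient N.reach) = 1 := by
  have : Subsingleton (Quotient N.reach) :=
    (Quotient.subsingleton_iff).2 (Setoid.eq_top_iff.2 h)
  have : Nonempty (Quotient N.reach) := ⟨Quotient.mk _ (Classical.arbitrary D)⟩
  exact Nat.card_unique

/-- No dart has the same origin as its reverse. -/
def Loopless (N : CombMap D) : Prop := ∀ d, ¬ N.rot.SameCycle d (N.flip d)

/-- In a map, no edge which is not a loop separates the faces on its two sides: turn around one of
the endpoints of the edge. -/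
theorem mem_of_flip_mem [Finite D] {N : CombMap D} {X : Set D} {a : D}
    (ha : ¬ N.rot.SameCycle a (N.flip a)) (hf : ∀ z ∈ X, N.face z ∈ X)
    (hX : ∀ z ∈ X, z ≠ a → z ≠ N.flip a → N.flip z ∈ X) (h : N.flip a ∈ X) : a ∈ X := by
  by_contra hn
  have h1 : N.rot.SameCycle (N.rot a) a := (sameCycle_apply_self N.rot a).symm
  refine hn (SameCycle.mem_of_mapsTo (A := {z | N.rot.SameCycle a z ∧ z ∈ X}) ?_ h1
    ⟨h1.symm, hf _ h⟩).2
  rintro z ⟨hz, hzX⟩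
  refine ⟨hz.trans (sameCycle_apply_self _ _), hf _ (hX z hzX ?_ ?_)⟩
  · rintro rfl; exact hn hzX
  · rintro rfl; exact ha hz

/-! ### Isomorphisms -/

/-- Isomorphism of rooted combinatorial maps. -/
def Iso (N : CombMap D) (x : D) (N' : CombMap D') (x' : D') : Prop :=
  ∃ f : D ≃ D', (∀ d, f (N.face d) = N'.face (f d)) ∧ (∀ d, f (N.flip d) = N'.flip (f d)) ∧
    f x = x'

section Iso

variable {N : CombMap D} {x : D} {N' : CombMap D'} {x' : D'} {N'' : CombMap D''} {x'' : D''}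

theorem Iso.refl (N : CombMap D) (x : D) : N.Iso x N x :=
  ⟨Equiv.refl D, fun _ => rfl, fun _ => rfl, rfl⟩

theorem Iso.symm (h : N.Iso x N' x') : N'.Iso x' N x := by
  obtain ⟨f, hr, hf, h0⟩ := h
  refine ⟨f.symm, fun d => ?_, fun d => ?_, ?_⟩
  · rw [Equiv.symm_apply_eq, hr, Equiv.apply_symm_apply]
  · rw [Equiv.symm_apply_eq, hf, Equiv.apply_symm_apply]
  · rw [Equiv.symm_apply_eq, h0]

theorem Iso.trans (h : N.Iso x N' x') (h' : N'.Iso x' N'' x'') : N.Iso x N'' x'' := by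
  obtain ⟨f, hr, hf, h0⟩ := h
  obtain ⟨g, gr, gf, g0⟩ := h'
  exact ⟨f.trans g, fun d => by simp [hr, gr], fun d => by simp [hf, gf], by simp [h0, g0]⟩

/-- Connected rooted maps are isomorphic as soon as some bi-unique relation between their darts
relates the roots and is compatible with the permutations. -/
theorem Iso.of_rel [Finite D] [Finite D'] (hN : N.Connected) (hN' : N'.Connected)
    (R : D → D' → Prop) (h0 : R x x') (hf : ∀ a b, R a b → R (N.face a) (N'.face b))
    (ha : ∀ a b, R a b → R (N.flip a) (N'.flip b)) (hr : ∀ a b c, R a b → R a c → b = c)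
    (hl : ∀ a b c, R a c → R b c → a = b) : N.Iso x N' x' := by
  have h1 : ∀ a, ∃ b, R a b := fun a =>
    mem_of_reach (A := {a | ∃ b, R a b}) (fun z ⟨b, hb⟩ => ⟨_, hf _ _ hb⟩)
      (fun z ⟨b, hb⟩ => ⟨_, ha _ _ hb⟩) (hN x a) ⟨x', h0⟩
  have h2 : ∀ b, ∃ a, R a b := fun b =>
    mem_of_reach (A := {b | ∃ a, R a b}) (fun z ⟨b, hb⟩ => ⟨_, hf _ _ hb⟩)
      (fun z ⟨b, hb⟩ => ⟨_, ha _ _ hb⟩) (hN' x' b) ⟨x, h0⟩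
  choose g hg using h1
  refine ⟨Equiv.ofBijective g ⟨fun a b h => ?_, fun b => ?_⟩, fun d => ?_, fun d => ?_, ?_⟩
  · exact hl a b _ (hg a) (h ▸ hg b)
  · obtain ⟨a, hab⟩ := h2 b
    exact ⟨a, hr _ _ _ (hg a) hab⟩
  · exact hr _ _ _ (hg _) (hf _ _ (hg d))
  · exact hr _ _ _ (hg _) (ha _ _ (hg d))
  · exact hr _ _ _ (hg _) h0

end Iso

/-- The map `N` with its darts renamed. -/
def relabel (N : CombMap D) (e : D ≃ D') : CombMap D' where
  face := e.permCongr N.face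
  flip := e.permCongr N.flip
  flip_flip d := by simp [permCongr_apply, N.flip_flip]
  flip_ne d h := N.flip_ne (e.symm d) (by simpa [permCongr_apply, ← Equiv.eq_symm_apply] using h)

theorem iso_relabel (N : CombMap D) (e : D ≃ D') (x : D) : N.Iso x (N.relabel e) (e x) :=
  ⟨e, fun d => by simp [relabel, permCongr_apply], fun d => by simp [relabel, permCongr_apply], rfl⟩

/-! ### Triangulations -/

/-- Loopless planar map with root face of degree `p` and all other faces of degree 3. -/
structure IsTri (N : CombMap D) (r : D) (p : ℕ) : Prop where
  planar : N.IsPlanar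
  root_deg : Nat.card {d // N.face.SameCycle r d} = p
  other_deg : ∀ x, ¬ N.face.SameCycle r x → Nat.card {d // N.face.SameCycle x d} = 3
  loopless : N.Loopless

/-- The boundary of the face of `r` is simple. -/
def SimpleBoundary (N : CombMap D) (r : D) : Prop :=
  ∀ d d', N.face.SameCycle r d → N.face.SameCycle r d' → N.rot.SameCycle d d' → d = d'

/-- A dart is determined by its origin and its endpoint. -/
def NoMultipleEdges (N : CombMap D) : Prop :=
  ∀ d d', N.rot.SameCycle d d' → N.rot.SameCycle (N.flip d) (N.flip d') → d = d'

section Invariance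

variable [Finite D] [Finite D'] {N : CombMap D} {x : D} {N' : CombMap D'} {x' : D'}

omit [Finite D'] in
theorem Connected.of_map {f : D ≃ D'} (hf : ∀ d, f (N.face d) = N'.face (f d))
    (ha : ∀ d, f (N.flip d) = N'.flip (f d)) (h : N.Connected) : N'.Connected := by
  have : N.reach ≤ N'.reach.comap f := reach_le_iff.2
    ⟨fun z => by rw [Setoid.comap_rel, hf]; exact N'.reach_face _,
      fun z => by rw [Setoid.comap_rel, ha]; exact N'.reach_flip _⟩
  intro a b
  have h2 : N'.reach (f (f.symm a)) (f (f.symm b)) := this (h (f.symm a) (f.symm b))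
  simpa using h2

omit [Finite D] [Finite D'] in
theorem Iso.numCycles_eq (h : N.Iso x N' x') : numCycles N.rot = numCycles N'.rot ∧
    numCycles N.face = numCycles N'.face ∧ numCycles N.flip = numCycles N'.flip := by
  obtain ⟨f, hf, ha, -⟩ := h
  exact ⟨numCycles_congr f fun d => by simp [rot_apply, hf, ha], numCycles_congr f hf,
    numCycles_congr f ha⟩

omit [Finite D'] in
theorem Iso.isPlanar (h : N.Iso x N' x') (hN : N.IsPlanar) : N'.IsPlanar := by
  obtain ⟨h1, h2, h3⟩ := h.numCycles_eq
  obtain ⟨f, hf, ha, -⟩ := h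
  exact ⟨hN.connected.of_map hf ha, by rw [← h1, ← h2, ← h3, hN.euler]⟩

theorem Iso.isTri (h : N.Iso x N' x') {p : ℕ} (hN : N.IsTri x p) : N'.IsTri x' p := by
  have hp := h.isPlanar hN.planar
  obtain ⟨f, hf, ha, rfl⟩ := h
  have hc : ∀ a b, N'.face.SameCycle (f a) (f b) ↔ N.face.SameCycle a b := fun a b =>
    sameCycle_map_iff f.injective fun _ _ => (hf _).symm
  have hcard : ∀ a, Nat.card {z // N'.face.SameCycle (f a) z} =
      Nat.card {y // N.face.SameCycle a y} := fun a =>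
    card_sameCycle_map f.injective fun _ _ => (hf _).symm
  refine ⟨hp, (hcard x).trans hN.root_deg, fun y hy => ?_, fun y hy => ?_⟩
  · obtain ⟨y, rfl⟩ := f.surjective y
    rw [hcard]
    exact hN.other_deg y fun h => hy ((hc _ _).2 h)
  · obtain ⟨y, rfl⟩ := f.surjective y
    rw [← ha, sameCycle_map_iff (π := N.rot) f.injective
      fun z _ => by simp [rot_apply, hf, ha]] at hy
    exact hN.loopless y hy

theorem Iso.simpleBoundary (h : N.Iso x N' x') (hN : N.SimpleBoundary x) :
    N'.SimpleBoundary x' := by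
  obtain ⟨f, hf, ha, rfl⟩ := h
  have hc : ∀ a b, N'.face.SameCycle (f a) (f b) ↔ N.face.SameCycle a b := fun a b =>
    sameCycle_map_iff f.injective fun _ _ => (hf _).symm
  intro d d' h1 h2 h3
  obtain ⟨d, rfl⟩ := f.surjective d
  obtain ⟨d', rfl⟩ := f.surjective d'
  rw [hc] at h1 h2
  rw [sameCycle_map_iff (π := N.rot) f.injective fun z _ => by simp [rot_apply, hf, ha]] at h3
  rw [hN d d' h1 h2 h3]

theorem Iso.noMultipleEdges (h : N.Iso x N' x') (hN : N.NoMultipleEdges) :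
    N'.NoMultipleEdges := by
  obtain ⟨f, hf, ha, rfl⟩ := h
  intro d d' h1 h2
  obtain ⟨d, rfl⟩ := f.surjective d
  obtain ⟨d', rfl⟩ := f.surjective d'
  rw [← ha, ← ha] at h2
  rw [sameCycle_map_iff (π := N.rot) f.injective fun z _ => by simp [rot_apply, hf, ha]] at h1 h2
  rw [hN d d' h1 h2]

end Invariance

/-! ### Restriction to a union of components -/

/-- The restriction of a map to a union of connected components. -/
def restrict (N : CombMap D) (A : Set D) (h : N.IsClosed A) : CombMap A where
  face := N.face.subtypePerm h.1
  flip := N.flip.subtypePerm h.2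
  flip_flip d := Subtype.ext (N.flip_flip d)
  flip_ne d hd := N.flip_ne d (Subtype.ext_iff.1 hd)

section Restrict

variable {N : CombMap D} {A : Set D} (h : N.IsClosed A)

theorem restrict_rot_sameCycle [Finite D] {a b : A} :
    (N.restrict A h).rot.SameCycle a b ↔ N.rot.SameCycle a b :=
  (sameCycle_map_iff (g := ((↑) : A → D)) Subtype.val_injective fun _ _ => rfl).symm

theorem restrict_face_sameCycle [Finite D] {a b : A} :
    (N.restrict A h).face.SameCycle a b ↔ N.face.SameCycle a b :=
  (sameCycle_map_iff (g := ((↑) : A → D)) Subtype.val_injective fun _ _ => rfl).symm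

theorem restrict_face_card [Finite D] (a : A) :
    Nat.card {b // (N.restrict A h).face.SameCycle a b} = Nat.card {b // N.face.SameCycle a b} :=
  (card_sameCycle_map (g := ((↑) : A → D)) Subtype.val_injective fun _ _ => rfl).symm

theorem restrict_numCycles_add [Finite D] :
    numCycles (N.restrict A h).rot + numCycles (N.restrict Aᶜ h.compl).rot = numCycles N.rot ∧
    numCycles (N.restrict A h).face + numCycles (N.restrict Aᶜ h.compl).face = numCycles N.face ∧
    numCycles (N.restrict A h).flip + numCycles (N.restrict Aᶜ h.compl).flip
      = numCycles N.flip := by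
  have hr : ∀ x, N.rot x ∈ A ↔ x ∈ A := fun x => (h.1 _).trans (h.2 _)
  exact ⟨numCycles_subtypePerm_add N.rot A hr fun x => not_congr (hr x),
    numCycles_subtypePerm_add N.face A h.1 h.compl.1,
    numCycles_subtypePerm_add N.flip A h.2 h.compl.2⟩

theorem restrict_reach [Finite D] {a b : A} : (N.restrict A h).reach a b ↔ N.reach a b := by
  constructor
  · have : (N.restrict A h).reach ≤ N.reach.comap ((↑) : A → D) := reach_le_iff.2
      ⟨fun z => N.reach_face _, fun z => N.reach_flip _⟩
    exact fun h => this h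
  · intro hab
    refine (mem_of_reach (A := {z | ∃ hz : z ∈ A, (N.restrict A h).reach a ⟨z, hz⟩})
      (N := N) ?_ ?_ hab ⟨a.2, Setoid.refl' _ _⟩).2
    · rintro z ⟨hz, h'⟩
      exact ⟨(h.1 z).2 hz, Setoid.trans' _ h' ((N.restrict A h).reach_face ⟨z, hz⟩)⟩
    · rintro z ⟨hz, h'⟩
      exact ⟨(h.2 z).2 hz, Setoid.trans' _ h' ((N.restrict A h).reach_flip ⟨z, hz⟩)⟩

end Restrict

/-- A map with Euler characteristic 4 and at most two components has exactly two components, which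
are both planar. -/
theorem planar_components [Finite D] {N : CombMap D} {x y : D}
    (hxy : ∀ z, N.reach x z ∨ N.reach y z)
    (he : numCycles N.rot + numCycles N.face = numCycles N.flip + 4) :
    ¬ N.reach x y ∧ (N.restrict {z | N.reach x z} (N.isClosed_reach x)).IsPlanar ∧
      (N.restrict {z | N.reach x z}ᶜ (N.isClosed_reach x).compl).IsPlanar := by
  have hle := N.euler_le
  have hn : ¬ N.reach x y := by
    intro h
    have : N.Connected := by
      have hx : ∀ z, N.reach x z := fun z => (hxy z).elim id fun h' => N.reach.trans' h h'
      exact fun a b => N.reach.trans' (N.reach.symm' (hx a)) (hx b)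
    have : Nonempty D := ⟨x⟩
    rw [card_quotient_reach_of_connected ‹N.Connected›] at hle
    omega
  have hA' := N.isClosed_reach x
  have c1 : (N.restrict {z | N.reach x z} hA').Connected := fun a b =>
    (restrict_reach hA').2 (N.reach.trans' (N.reach.symm' a.2) b.2)
  have c2 : (N.restrict {z | N.reach x z}ᶜ hA'.compl).Connected := fun a b =>
    (restrict_reach hA'.compl).2 (N.reach.trans' (N.reach.symm' ((hxy a).resolve_left a.2))
      ((hxy b).resolve_left b.2))
  have : Nonempty {z | N.reach x z} := ⟨⟨x, N.reach.refl' x⟩⟩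
  have : Nonempty ({z | N.reach x z}ᶜ : Set D) := ⟨⟨y, hn⟩⟩
  have e1 := (N.restrict {z | N.reach x z} hA').euler_le
  have e2 := (N.restrict {z | N.reach x z}ᶜ hA'.compl).euler_le
  rw [card_quotient_reach_of_connected c1] at e1
  rw [card_quotient_reach_of_connected c2] at e2
  obtain ⟨h1, h2, h3⟩ := restrict_numCycles_add hA'
  exact ⟨hn, ⟨c1, by omega⟩, ⟨c2, by omega⟩⟩

/-! ### Isomorphism classes -/

/-- The map with a single edge. -/
def edgeMap : CombMap Bool where
  face := Equiv.boolNot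
  flip := Equiv.boolNot
  flip_flip := by decide
  flip_ne := by decide

theorem edgeMap_rot : edgeMap.rot = 1 := by
  ext d; cases d <;> rfl

theorem edgeMap_sameCycle_face (a b : Bool) : edgeMap.face.SameCycle a b := by
  cases a <;> cases b
  exacts [SameCycle.refl _ _, ⟨1, rfl⟩, ⟨1, rfl⟩, SameCycle.refl _ _]

theorem edgeMap_numCycles : numCycles edgeMap.rot = 2 ∧ numCycles edgeMap.face = 1 ∧
    numCycles edgeMap.flip = 1 := by
  have h2 := edgeMap.card_eq
  have h3 : numCycles edgeMap.face = numCycles edgeMap.flip := rfl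
  rw [edgeMap_rot, numCycles_one]
  rw [Nat.card_eq_fintype_card, Fintype.card_bool] at *
  omega

theorem edgeMap_isTri (b : Bool) : edgeMap.IsTri b 2 := by
  obtain ⟨h1, h2, h3⟩ := edgeMap_numCycles
  refine ⟨⟨fun x y => (le_sup_left : _ ≤ edgeMap.reach) (edgeMap_sameCycle_face x y), by omega⟩,
    ?_, fun x hx => absurd (edgeMap_sameCycle_face _ _) hx, fun d hd => ?_⟩
  · rw [Nat.card_congr (Equiv.subtypeUnivEquiv (edgeMap_sameCycle_face b))]
    simp
  · rw [edgeMap_rot, sameCycle_one] at hd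
    exact edgeMap.flip_ne d hd.symm

theorem edgeMap_simpleBoundary (b : Bool) : edgeMap.SimpleBoundary b := by
  intro d d' _ _ h
  rwa [edgeMap_rot, sameCycle_one] at h

/-- A connected combinatorial map of genus zero, with a root, as a rooted planar map. -/
def toRooted [Finite D] (N : CombMap D) (x : D) (h : N.IsPlanar) : RootedPlanarMap D where
  finite := inferInstance
  rot := N.rot
  flip := N.flip
  root := x
  flip_flip := N.flip_flip
  flip_ne := N.flip_ne
  connected d d' := by
    refine mem_of_reach (N := N) (A := {y | ∃ g ∈ Subgroup.closure {N.rot, N.flip}, g d = y}) ?_ ?_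
      (h.connected d d') ⟨1, one_mem _, rfl⟩
    · rintro _ ⟨g, hg, rfl⟩
      refine ⟨N.rot * N.flip * g, mul_mem (mul_mem (Subgroup.subset_closure (by simp))
        (Subgroup.subset_closure (by simp))) hg, ?_⟩
      simp [rot_flip]
    · rintro _ ⟨g, hg, rfl⟩
      exact ⟨N.flip * g, mul_mem (Subgroup.subset_closure (by simp)) hg, rfl⟩
  euler := by
    have : N.rot * N.flip = N.face := by ext d; simp [rot_flip]
    rw [this]
    exact h.euler

end CombMap

namespace RootedPlanarMap

variable {D D' : Type}

/-- The combinatorial map underlying a rooted planar map. -/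
def comb (m : RootedPlanarMap D) : CombMap D where
  face := m.face
  flip := m.flip
  flip_flip := m.flip_flip
  flip_ne := m.flip_ne

theorem comb_rot (m : RootedPlanarMap D) : m.comb.rot = m.rot := by
  ext d
  simp [comb, CombMap.rot, face, m.flip_flip]

theorem comb_isPlanar (m : RootedPlanarMap D) : m.comb.IsPlanar := by
  have := m.finite
  refine ⟨fun x y => ?_, ?_⟩
  · obtain ⟨g, hg, rfl⟩ := m.connected x y
    induction hg using Subgroup.closure_induction generalizing x with
    | mem g hg =>
      rcases hg with rfl | rfl
      · rw [← comb_rot]; exact m.comb.rot_reach x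
      · exact m.comb.reach_flip x
    | one => exact Setoid.refl' _ _
    | mul g h _ _ ihg ihh => exact Setoid.trans' _ (ihh x) (ihg (h x))
    | inv g _ ih =>
      have := ih (g⁻¹ x)
      exact Setoid.symm' _ (by simpa using this)
  · rw [comb_rot]
    exact m.euler

theorem comb_toRooted [Finite D] (N : CombMap D) (x : D) (h : N.IsPlanar) :
    (N.toRooted x h).comb = N := by
  have : (N.toRooted x h).face = N.face := by
    ext d
    exact N.rot_flip d
  cases N
  simp only [comb, CombMap.mk.injEq]
  exact ⟨this, rfl⟩

theorem iso_iff_comb (m : RootedPlanarMap D) (m' : RootedPlanarMap D') :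
    m.Iso m' ↔ m.comb.Iso m.root m'.comb m'.root := by
  constructor
  · rintro ⟨f, hr, ha, h0⟩
    exact ⟨f, fun d => by simp [comb, face, hr, ha], ha, h0⟩
  · rintro ⟨f, hf, ha, h0⟩
    refine ⟨f, fun d => ?_, ha, h0⟩
    have := hf (m.flip d)
    simpa [comb, face, m.flip_flip, show m'.flip (f d) = f (m.flip d) from (ha d).symm,
      show m'.flip (f (m.flip d)) = f d by
        rw [← show _ = m'.flip _ from ha _]; simp [comb, m.flip_flip]]
      using this

theorem isTypeII_iff_comb (m : RootedPlanarMap D) (p : ℕ) :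
    m.IsTypeII p ↔ m.comb.IsTri m.root p ∧ m.comb.SimpleBoundary m.root := by
  constructor
  · rintro ⟨⟨⟨h1, h2⟩, h3⟩, h4⟩
    refine ⟨⟨m.comb_isPlanar, h1, h2, ?_⟩, ?_⟩
    · intro d; rw [comb_rot]; exact h4 d
    · intro d d'; rw [comb_rot]; exact h3 d d'
  · rintro ⟨⟨_, h1, h2, h4⟩, h3⟩
    refine ⟨⟨⟨h1, h2⟩, ?_⟩, ?_⟩
    · intro d d'; rw [← comb_rot]; exact h3 d d'
    · intro d; rw [← comb_rot]; exact h4 d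

theorem isTypeIII_iff_comb (m : RootedPlanarMap D) (p : ℕ) :
    m.IsTypeIII p ↔ (m.comb.IsTri m.root p ∧ m.comb.SimpleBoundary m.root) ∧
      m.comb.NoMultipleEdges := by
  rw [← isTypeII_iff_comb, IsTypeIII, IsTypeII, and_assoc]
  unfold NoMultipleEdges CombMap.NoMultipleEdges
  rw [comb_rot]
  rfl

theorem isDigon_iff_comb (m : RootedPlanarMap D) :
    m.IsDigon ↔ m.comb.IsTri m.root 2 := by
  constructor
  · rintro ⟨⟨h1, h2⟩, h4⟩
    exact ⟨m.comb_isPlanar, h1, h2, fun d => by rw [comb_rot]; exact h4 d⟩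
  · rintro ⟨_, h1, h2, h4⟩
    exact ⟨⟨h1, h2⟩, fun d => by rw [← comb_rot]; exact h4 d⟩

end RootedPlanarMap

namespace CombMap

variable {D D' : Type}

open Classical in
/-- The isomorphism class of a rooted combinatorial map (the class of the map with a single edge if
the map is not planar). -/
noncomputable def cls [Finite D] (N : CombMap D) (x : D) : PlanarMap :=
  if h : N.IsPlanar then
    PlanarMap.mk ((N.relabel (Finite.equivFin D)).toRooted (Finite.equivFin D x)
      ((N.iso_relabel (Finite.equivFin D) x).isPlanar h))
  else
    PlanarMap.mk ((edgeMap.relabel (Finite.equivFin Bool)).toRooted (Finite.equivFin Bool true)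
      ((edgeMap.iso_relabel (Finite.equivFin Bool) true).isPlanar (edgeMap_isTri true).planar))

theorem mk_eq_mk_iff {n k : ℕ} {m : RootedPlanarMap (Fin n)} {m' : RootedPlanarMap (Fin k)} :
    PlanarMap.mk m = PlanarMap.mk m' ↔ m.comb.Iso m.root m'.comb m'.root := by
  rw [← RootedPlanarMap.iso_iff_comb]
  exact ⟨fun h => Quotient.exact h, fun h => Quotient.sound h⟩

/-- Representatives of `N.cls x` are the labelled maps isomorphic to `N` rooted at `x`. -/
theorem mk_eq_cls_iff [Finite D] {n : ℕ} {m : RootedPlanarMap (Fin n)} {N : CombMap D} {x : D}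
    (h : N.IsPlanar) : PlanarMap.mk m = N.cls x ↔ m.comb.Iso m.root N x := by
  rw [cls, dif_pos h, mk_eq_mk_iff, RootedPlanarMap.comb_toRooted]
  exact ⟨fun h' => h'.trans (iso_relabel _ _ _).symm, fun h' => h'.trans (iso_relabel _ _ _)⟩

theorem cls_comb {n : ℕ} (m : RootedPlanarMap (Fin n)) : m.comb.cls m.root = PlanarMap.mk m :=
  ((mk_eq_cls_iff m.comb_isPlanar).2 (Iso.refl _ _)).symm

theorem exists_rep (c : PlanarMap) :
    ∃ (n : ℕ) (m : RootedPlanarMap (Fin n)), PlanarMap.mk m = c := by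
  induction c using Quotient.inductionOn with
  | h m => exact ⟨m.1, m.2, rfl⟩

theorem cls_eq_cls_iff [Finite D] [Finite D'] {N : CombMap D} {x : D} {N' : CombMap D'} {x' : D'}
    (h : N.IsPlanar) (h' : N'.IsPlanar) : N.cls x = N'.cls x' ↔ N.Iso x N' x' := by
  obtain ⟨n, m, hm⟩ := exists_rep (N.cls x)
  have h1 := (mk_eq_cls_iff h).1 hm
  rw [← hm, mk_eq_cls_iff h']
  exact ⟨fun h2 => h1.symm.trans h2, fun h2 => h1.trans h2⟩

theorem Iso.cls_eq [Finite D] [Finite D'] {N : CombMap D} {x : D} {N' : CombMap D'} {x' : D'}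
    (h : N.Iso x N' x') : N.cls x = N'.cls x' := by
  by_cases hN : N.IsPlanar
  · exact (cls_eq_cls_iff hN (h.isPlanar hN)).2 h
  · rw [cls, cls, dif_neg hN, dif_neg fun h' => hN (h.symm.isPlanar h')]

theorem cls_mem_typeII [Finite D] {N : CombMap D} {x : D} (h : N.IsPlanar) {p : ℕ} :
    N.cls x ∈ PlanarMap.typeII p ↔ N.IsTri x p ∧ N.SimpleBoundary x := by
  constructor
  · rintro ⟨n, m, hm, hII⟩
    have hi := (mk_eq_cls_iff h).1 hm
    rw [RootedPlanarMap.isTypeII_iff_comb] at hII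
    exact ⟨hi.isTri hII.1, hi.simpleBoundary hII.2⟩
  · rintro ⟨h1, h2⟩
    obtain ⟨n, m, hm⟩ := exists_rep (N.cls x)
    have hi := (mk_eq_cls_iff h).1 hm
    exact ⟨n, m, hm, (m.isTypeII_iff_comb p).2 ⟨hi.symm.isTri h1, hi.symm.simpleBoundary h2⟩⟩

theorem cls_mem_typeIII [Finite D] {N : CombMap D} {x : D} (h : N.IsPlanar) {p : ℕ} :
    N.cls x ∈ PlanarMap.typeIII p ↔ (N.IsTri x p ∧ N.SimpleBoundary x) ∧ N.NoMultipleEdges := by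
  constructor
  · rintro ⟨n, m, hm, hII⟩
    have hi := (mk_eq_cls_iff h).1 hm
    rw [RootedPlanarMap.isTypeIII_iff_comb] at hII
    exact ⟨⟨hi.isTri hII.1.1, hi.simpleBoundary hII.1.2⟩, hi.noMultipleEdges hII.2⟩
  · rintro ⟨⟨h1, h2⟩, h3⟩
    obtain ⟨n, m, hm⟩ := exists_rep (N.cls x)
    have hi := (mk_eq_cls_iff h).1 hm
    exact ⟨n, m, hm, (m.isTypeIII_iff_comb p).2 ⟨⟨hi.symm.isTri h1, hi.symm.simpleBoundary h2⟩,
      hi.symm.noMultipleEdges h3⟩⟩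

theorem numVertices_cls [Finite D] {N : CombMap D} {x : D} (h : N.IsPlanar) :
    (N.cls x).numVertices = numCycles N.rot := by
  obtain ⟨n, m, hm⟩ := exists_rep (N.cls x)
  have hi := (mk_eq_cls_iff h).1 hm
  rw [← hm, ← hi.numCycles_eq.1, RootedPlanarMap.comb_rot]
  rfl

theorem numEdges_cls [Finite D] {N : CombMap D} {x : D} (h : N.IsPlanar) :
    (N.cls x).numEdges = numCycles N.flip := by
  obtain ⟨n, m, hm⟩ := exists_rep (N.cls x)
  have hi := (mk_eq_cls_iff h).1 hm
  rw [← hm, ← hi.numCycles_eq.2.2]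
  rfl

theorem exists_eq_cls (c : PlanarMap) : ∃ (n : ℕ) (N : CombMap (Fin n)) (x : Fin n),
    N.IsPlanar ∧ c = N.cls x := by
  obtain ⟨n, m, rfl⟩ := exists_rep c
  exact ⟨n, m.comb, m.root, m.comb_isPlanar, (cls_comb m).symm⟩

end CombMap

/-! ### Joining two triangulations at a boundary vertex -/

namespace CombMap

variable {D D' D₁ D₂ D₁' D₂' : Type}

/-- The map `N` with its face permutation replaced. -/
def withFace (N : CombMap D) (φ : Perm D) : CombMap D where
  face := φ
  flip := N.flip
  flip_flip := N.flip_flip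
  flip_ne := N.flip_ne

theorem withFace_rot (N : CombMap D) (σ : Perm D) : (N.withFace (σ * N.face)).rot = σ * N.rot :=
  mul_assoc _ _ _

/-- The disjoint union of two maps. -/
def sum (N₁ : CombMap D₁) (N₂ : CombMap D₂) : CombMap (D₁ ⊕ D₂) where
  face := Perm.sumCongr N₁.face N₂.face
  flip := Perm.sumCongr N₁.flip N₂.flip
  flip_flip := by rintro (d | d) <;> simp [flip_flip]
  flip_ne := by rintro (d | d) <;> simp [flip_ne]

theorem sum_rot (N₁ : CombMap D₁) (N₂ : CombMap D₂) :
    (N₁.sum N₂).rot = Perm.sumCongr N₁.rot N₂.rot := by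
  ext (d | d) <;> rfl

theorem IsPlanar.face_ne {N : CombMap D} (h : N.Loopless) (d : D) : N.face d ≠ d := by
  intro hd
  have := (N.sameCycle_rot_flip_face d).symm
  rw [hd] at this
  exact h d this

theorem IsTri.two_le [Finite D] {N : CombMap D} {r : D} {p : ℕ} (h : N.IsTri r p) : 2 ≤ p := by
  rw [← h.root_deg]
  have : Nontrivial {d // N.face.SameCycle r d} :=
    ⟨⟨r, SameCycle.refl _ _⟩, ⟨N.face r, sameCycle_apply_self _ _⟩,
      fun e => IsPlanar.face_ne h.loopless r (Subtype.ext_iff.1 e).symm⟩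
  exact Finite.one_lt_card

/-- The boundary of the face of `r` is simple, except that it may come back to the origin of
`N.face r`. -/
def AlmostSimpleBoundary (N : CombMap D) (r : D) : Prop :=
  ∀ d d', N.face.SameCycle r d → N.face.SameCycle r d' → d ≠ N.face r → d' ≠ N.face r →
    N.rot.SameCycle d d' → d = d'

theorem SimpleBoundary.almost {N : CombMap D} {r : D} (h : N.SimpleBoundary r) :
    N.AlmostSimpleBoundary r := fun d d' h1 h2 _ _ h3 => h d d' h1 h2 h3

theorem Iso.almostSimpleBoundary [Finite D] [Finite D'] {N : CombMap D} {x : D} {N' : CombMap D'}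
    {x' : D'} (h : N.Iso x N' x') (hN : N.AlmostSimpleBoundary x) :
    N'.AlmostSimpleBoundary x' := by
  obtain ⟨f, hf, ha, rfl⟩ := h
  have hc : ∀ a b, N'.face.SameCycle (f a) (f b) ↔ N.face.SameCycle a b := fun a b =>
    sameCycle_map_iff f.injective fun _ _ => (hf _).symm
  intro d d' h1 h2 h3 h4 h5
  obtain ⟨d, rfl⟩ := f.surjective d
  obtain ⟨d', rfl⟩ := f.surjective d'
  rw [hc] at h1 h2
  rw [← hf, f.injective.ne_iff] at h3 h4
  rw [sameCycle_map_iff (π := N.rot) f.injective fun z _ => by simp [rot_apply, hf, ha]] at h5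
  rw [hN d d' h1 h2 h3 h4 h5]

theorem card_sameCycle_eq {π : Perm D} {x y : D} (h : π.SameCycle x y) :
    Nat.card {z // π.SameCycle x z} = Nat.card {z // π.SameCycle y z} :=
  Nat.card_congr (Equiv.subtypeEquivRight fun _ => ⟨fun k => h.symm.trans k, fun k => h.trans k⟩)

open Classical in
/-- The map obtained from `N₁` and `N₂` by identifying the endpoint of `r₁` with the origin of `r₂`
in such a way that the faces of `r₁` and `r₂` become one face, in which `r₁` is followed
by `r₂`. -/
noncomputable def join (N₁ : CombMap D₁) (r₁ : D₁) (N₂ : CombMap D₂) (r₂ : D₂) :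
    CombMap (D₁ ⊕ D₂) :=
  (N₁.sum N₂).withFace (swap (Sum.inl (N₁.face r₁)) (Sum.inr r₂) * (N₁.sum N₂).face)

section Join

variable [Finite D₁] [Finite D₂] [Finite D₁'] [Finite D₂']
  {N₁ : CombMap D₁} {r₁ : D₁} {N₂ : CombMap D₂} {r₂ : D₂}
  {N₁' : CombMap D₁'} {r₁' : D₁'} {N₂' : CombMap D₂'} {r₂' : D₂'}

open Classical in
theorem join_setoid_face : SameCycle.setoid (N₁.join r₁ N₂ r₂).face =
    (SameCycle.setoid (Perm.sumCongr N₁.face N₂.face)).glue (Sum.inl (N₁.face r₁)) (Sum.inr r₂) :=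
  setoid_swap_mul not_sameCycle_sumCongr_inl_inr

open Classical in
theorem join_setoid_rot : SameCycle.setoid (N₁.join r₁ N₂ r₂).rot =
    (SameCycle.setoid (Perm.sumCongr N₁.rot N₂.rot)).glue (Sum.inl (N₁.face r₁)) (Sum.inr r₂) := by
  rw [join, withFace_rot, sum_rot]
  exact setoid_swap_mul not_sameCycle_sumCongr_inl_inr

omit [Finite D₁] [Finite D₂] in
theorem join_face_apply [DecidableEq D] {f : D₁ ⊕ D₂ → D} (hf : Function.Injective f)
    (z : D₁ ⊕ D₂) : f ((N₁.join r₁ N₂ r₂).face z) =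
      swap (f (Sum.inl (N₁.face r₁))) (f (Sum.inr r₂)) (f ((N₁.sum N₂).face z)) := by
  classical
  simp only [CombMap.join, withFace, mul_apply]
  rw [hf.map_swap]

omit [Finite D₁] [Finite D₂] in
theorem join_face_root : (N₁.join r₁ N₂ r₂).face (Sum.inl r₁) = Sum.inr r₂ := by
  simp [join, withFace, sum]

theorem join_face_inl {d : D₁} : (N₁.join r₁ N₂ r₂).face.SameCycle (Sum.inl r₁) (Sum.inl d) ↔
    N₁.face.SameCycle r₁ d := by
  rw [← setoid_apply, join_setoid_face, Setoid.glue_apply]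
  simp [setoid_apply, sameCycle_sumCongr_inl, not_sameCycle_sumCongr_inl_inr]

theorem join_face_inr {d : D₂} : (N₁.join r₁ N₂ r₂).face.SameCycle (Sum.inl r₁) (Sum.inr d) ↔
    N₂.face.SameCycle r₂ d := by
  rw [← setoid_apply, join_setoid_face, Setoid.glue_apply]
  simp [setoid_apply, sameCycle_sumCongr_inl, sameCycle_sumCongr_inr,
    not_sameCycle_sumCongr_inl_inr, sameCycle_comm (x := r₂), SameCycle.refl]

theorem join_rot_inl_inl {d d' : D₁} :
    (N₁.join r₁ N₂ r₂).rot.SameCycle (Sum.inl d) (Sum.inl d') ↔ N₁.rot.SameCycle d d' := by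
  rw [← setoid_apply, join_setoid_rot, Setoid.glue_apply]
  simp [setoid_apply, sameCycle_sumCongr_inl, not_sameCycle_sumCongr_inl_inr]

theorem join_rot_inr_inr {d d' : D₂} :
    (N₁.join r₁ N₂ r₂).rot.SameCycle (Sum.inr d) (Sum.inr d') ↔ N₂.rot.SameCycle d d' := by
  rw [← setoid_apply, join_setoid_rot, Setoid.glue_apply]
  simp [setoid_apply, sameCycle_sumCongr_inr, not_sameCycle_sumCongr_inr_inl]

theorem join_rot_inl_inr {d : D₁} {d' : D₂} :
    (N₁.join r₁ N₂ r₂).rot.SameCycle (Sum.inl d) (Sum.inr d') ↔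
      N₁.rot.SameCycle d (N₁.face r₁) ∧ N₂.rot.SameCycle d' r₂ := by
  rw [← setoid_apply, join_setoid_rot, Setoid.glue_apply]
  simp [setoid_apply, sameCycle_sumCongr_inr, sameCycle_sumCongr_inl,
    not_sameCycle_sumCongr_inl_inr]

theorem join_loopless_iff : (N₁.join r₁ N₂ r₂).Loopless ↔ N₁.Loopless ∧ N₂.Loopless := by
  constructor
  · exact fun h => ⟨fun d hd => h (Sum.inl d) (join_rot_inl_inl.2 hd),
      fun d hd => h (Sum.inr d) (join_rot_inr_inr.2 hd)⟩
  · rintro ⟨h1, h2⟩ (d | d) hd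
    · exact h1 d (join_rot_inl_inl.1 hd)
    · exact h2 d (join_rot_inr_inr.1 hd)

open Classical in
theorem join_numCycles :
    numCycles (N₁.join r₁ N₂ r₂).rot + 1 = numCycles N₁.rot + numCycles N₂.rot ∧
    numCycles (N₁.join r₁ N₂ r₂).face + 1 = numCycles N₁.face + numCycles N₂.face ∧
    numCycles (N₁.join r₁ N₂ r₂).flip = numCycles N₁.flip + numCycles N₂.flip := by
  refine ⟨?_, ?_, numCycles_sumCongr _ _⟩
  · rw [join, withFace_rot, sum_rot, numCycles_swap_mul_of_not not_sameCycle_sumCongr_inl_inr,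
      numCycles_sumCongr]
  · exact (numCycles_swap_mul_of_not not_sameCycle_sumCongr_inl_inr).trans (numCycles_sumCongr _ _)

theorem join_connected (h₁ : N₁.Connected) (h₂ : N₂.Connected) :
    (N₁.join r₁ N₂ r₂).Connected := by
  have hle : (N₁.sum N₂).reach ≤ (N₁.join r₁ N₂ r₂).reach := by
    refine sup_le (le_trans ?_ le_sup_left) le_sup_right
    rw [join_setoid_face]
    exact Setoid.le_glue _ _ _
  have h1 : ∀ a b, (N₁.join r₁ N₂ r₂).reach (Sum.inl a) (Sum.inl b) := fun a b =>
    (show N₁.reach ≤ (N₁.join r₁ N₂ r₂).reach.comap Sum.inl from reach_le_iff.2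
      ⟨fun x => hle ((N₁.sum N₂).reach_face (Sum.inl x)),
       fun x => hle ((N₁.sum N₂).reach_flip (Sum.inl x))⟩) (h₁ a b)
  have h2 : ∀ a b, (N₁.join r₁ N₂ r₂).reach (Sum.inr a) (Sum.inr b) := fun a b =>
    (show N₂.reach ≤ (N₁.join r₁ N₂ r₂).reach.comap Sum.inr from reach_le_iff.2
      ⟨fun x => hle ((N₁.sum N₂).reach_face (Sum.inr x)),
       fun x => hle ((N₁.sum N₂).reach_flip (Sum.inr x))⟩) (h₂ a b)
  have h12 : (N₁.join r₁ N₂ r₂).reach (Sum.inl r₁) (Sum.inr r₂) := by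
    have := (N₁.join r₁ N₂ r₂).reach_face (Sum.inl r₁)
    rwa [join_face_root] at this
  have h3 : ∀ a b, (N₁.join r₁ N₂ r₂).reach (Sum.inl a) (Sum.inr b) := fun a b =>
    Setoid.trans' _ (h1 a r₁) (Setoid.trans' _ h12 (h2 r₂ b))
  rintro (a | a) (b | b)
  exacts [h1 a b, h3 a b, Setoid.symm' _ (h3 b a), h2 a b]

theorem join_root_deg : Nat.card {d // (N₁.join r₁ N₂ r₂).face.SameCycle (Sum.inl r₁) d} =
    Nat.card {d // N₁.face.SameCycle r₁ d} + Nat.card {d // N₂.face.SameCycle r₂ d} := by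
  rw [Nat.card_congr Equiv.subtypeSum, Nat.card_sum,
    Nat.card_congr (Equiv.subtypeEquivRight fun d => join_face_inl),
    Nat.card_congr (Equiv.subtypeEquivRight fun d => join_face_inr)]

theorem join_deg_inl {d : D₁} (hd : ¬ N₁.face.SameCycle r₁ d) :
    Nat.card {z // (N₁.join r₁ N₂ r₂).face.SameCycle (Sum.inl d) z} =
      Nat.card {z // N₁.face.SameCycle d z} := by
  refine card_sameCycle_map (g := Sum.inl) Sum.inl_injective fun y hy => ?_
  have hne : N₁.face y ≠ N₁.face r₁ := fun e => hd (N₁.face.injective e ▸ hy.symm)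
  simp [join, withFace, sum, swap_apply_of_ne_of_ne, hne]

theorem join_deg_inr {d : D₂} (hd : ¬ N₂.face.SameCycle r₂ d) :
    Nat.card {z // (N₁.join r₁ N₂ r₂).face.SameCycle (Sum.inr d) z} =
      Nat.card {z // N₂.face.SameCycle d z} := by
  refine card_sameCycle_map (g := Sum.inr) Sum.inr_injective fun y hy => ?_
  have hne : N₂.face y ≠ r₂ := fun e => hd (e ▸ hy.trans (sameCycle_apply_self _ _)).symm
  simp [join, withFace, sum, swap_apply_of_ne_of_ne, hne]

theorem IsTri.join {p₁ p₂ : ℕ} (h₁ : N₁.IsTri r₁ p₁) (h₂ : N₂.IsTri r₂ p₂) :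
    (N₁.join r₁ N₂ r₂).IsTri (Sum.inl r₁) (p₁ + p₂) := by
  obtain ⟨e1, e2, e3⟩ := join_numCycles (N₁ := N₁) (r₁ := r₁) (N₂ := N₂) (r₂ := r₂)
  have e4 := h₁.planar.euler
  have e5 := h₂.planar.euler
  refine ⟨⟨join_connected h₁.planar.connected h₂.planar.connected, by omega⟩, ?_, ?_,
    join_loopless_iff.2 ⟨h₁.loopless, h₂.loopless⟩⟩
  · rw [join_root_deg, h₁.root_deg, h₂.root_deg]
  · rintro (d | d) hd
    · rw [join_face_inl] at hd
      rw [join_deg_inl hd, h₁.other_deg d hd]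
    · rw [join_face_inr] at hd
      rw [join_deg_inr hd, h₂.other_deg d hd]

theorem SimpleBoundary.join (h₁ : N₁.SimpleBoundary r₁) (h₂ : N₂.SimpleBoundary r₂) :
    (N₁.join r₁ N₂ r₂).AlmostSimpleBoundary (Sum.inl r₁) := by
  rintro (d | d) (d' | d') hd hd' hn hn' h <;> rw [join_face_root] at hn hn' <;>
    simp only [join_face_inl, join_face_inr] at hd hd'
  · rw [h₁ d d' hd hd' (join_rot_inl_inl.1 h)]
  · exact absurd (congrArg Sum.inr (h₂ d' r₂ hd' (SameCycle.refl _ _) (join_rot_inl_inr.1 h).2)) hn'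
  · exact absurd (congrArg Sum.inr (h₂ d r₂ hd (SameCycle.refl _ _)
      (join_rot_inl_inr.1 h.symm).2)) hn
  · rw [h₂ d d' hd hd' (join_rot_inr_inr.1 h)]

theorem join_not_simpleBoundary : ¬ (N₁.join r₁ N₂ r₂).SimpleBoundary (Sum.inl r₁) := by
  intro h
  have := h (Sum.inl (N₁.face r₁)) (Sum.inr r₂) (join_face_inl.2 (sameCycle_apply_self _ _))
    (join_face_inr.2 (SameCycle.refl _ _))
    (join_rot_inl_inr.2 ⟨SameCycle.refl _ _, SameCycle.refl _ _⟩)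
  cases this

/-- The boundary of the join meets the common vertex twice, at the dart excluded in
`AlmostSimpleBoundary` and at the root of `N₂`; hence the boundaries of both parts are simple. -/
theorem isTri_of_join {q : ℕ} (h₁ : N₁.IsPlanar) (h₂ : N₂.IsPlanar)
    (h : (N₁.join r₁ N₂ r₂).IsTri (Sum.inl r₁) q)
    (hs : (N₁.join r₁ N₂ r₂).AlmostSimpleBoundary (Sum.inl r₁)) :
    ∃ p₁ p₂, p₁ + p₂ = q ∧ (N₁.IsTri r₁ p₁ ∧ N₁.SimpleBoundary r₁) ∧
      N₂.IsTri r₂ p₂ ∧ N₂.SimpleBoundary r₂ := by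
  obtain ⟨l₁, l₂⟩ := join_loopless_iff.1 h.loopless
  refine ⟨_, _, join_root_deg.symm.trans h.root_deg, ⟨⟨h₁, rfl, fun d hd => ?_, l₁⟩, ?_⟩,
    ⟨h₂, rfl, fun d hd => ?_, l₂⟩, ?_⟩
  · rw [← join_deg_inl (N₂ := N₂) (r₂ := r₂) hd]
    exact h.other_deg _ fun k => hd (join_face_inl.1 k)
  · intro d d' hd hd' k
    have := hs (Sum.inl d) (Sum.inl d') (join_face_inl.2 hd) (join_face_inl.2 hd')
      (by simp [join_face_root]) (by simp [join_face_root]) (join_rot_inl_inl.2 k)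
    exact Sum.inl_injective this
  · rw [← join_deg_inr (N₁ := N₁) (r₁ := r₁) hd]
    exact h.other_deg _ fun k => hd (join_face_inr.1 k)
  · -- a dart other than `r₂` with the same origin as `r₂` would meet the end of `r₁` a second time
    have key : ∀ d, N₂.face.SameCycle r₂ d → N₂.rot.SameCycle d r₂ → d = r₂ := by
      intro d hd hr
      by_contra hne
      have := hs (Sum.inl (N₁.face r₁)) (Sum.inr d) (join_face_inl.2 (sameCycle_apply_self _ _))
        (join_face_inr.2 hd) (by simp [join_face_root]) (by simpa [join_face_root] using hne)
        (join_rot_inl_inr.2 ⟨SameCycle.refl _ _, hr⟩)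
      cases this
    intro d d' hd hd' k
    by_cases e : d = r₂
    · subst e; exact (key d' hd' k.symm).symm
    by_cases e' : d' = r₂
    · subst e'; exact key d hd k
    have := hs (Sum.inr d) (Sum.inr d') (join_face_inr.2 hd) (join_face_inr.2 hd')
      (by simpa [join_face_root] using e) (by simpa [join_face_root] using e')
      (join_rot_inr_inr.2 k)
    exact Sum.inr_injective this

omit [Finite D₁] [Finite D₂] [Finite D₁'] [Finite D₂'] in
theorem Iso.join (h₁ : N₁.Iso r₁ N₁' r₁') (h₂ : N₂.Iso r₂ N₂' r₂') :
    (N₁.join r₁ N₂ r₂).Iso (Sum.inl r₁) (N₁'.join r₁' N₂' r₂') (Sum.inl r₁') := by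
  classical
  obtain ⟨f, hf, ha, rfl⟩ := h₁
  obtain ⟨g, gf, ga, rfl⟩ := h₂
  refine ⟨Equiv.sumCongr f g, fun d => ?_, ?_, rfl⟩
  · rw [join_face_apply (Equiv.sumCongr f g).injective]
    conv_rhs => rw [← id_eq ((N₁'.join _ N₂' _).face _), join_face_apply Function.injective_id]
    rcases d with d | d <;> simp [sum, hf, gf]
  · rintro (d | d) <;> simp [CombMap.join, withFace, sum, ha, ga]

/-- The two parts of a join can be recovered: the common vertex is the only one which the boundary
visits twice. -/
theorem Iso.of_join (h₁ : N₁.Connected) (h₂ : N₂.Connected) (h₁' : N₁'.Connected)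
    (h₂' : N₂'.Connected) (hs : (N₁'.join r₁' N₂' r₂').AlmostSimpleBoundary (Sum.inl r₁'))
    (h : (N₁.join r₁ N₂ r₂).Iso (Sum.inl r₁) (N₁'.join r₁' N₂' r₂') (Sum.inl r₁')) :
    N₁.Iso r₁ N₁' r₁' ∧ N₂.Iso r₂ N₂' r₂' := by
  classical
  obtain ⟨f, hf, ha, h0⟩ := h
  have hc : ∀ a b, (N₁'.join r₁' N₂' r₂').face.SameCycle (f a) (f b) ↔
      (N₁.join r₁ N₂ r₂).face.SameCycle a b := fun a b =>
    sameCycle_map_iff f.injective fun _ _ => (hf _).symm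
  have h2 : f (Sum.inr r₂) = Sum.inr r₂' := by
    rw [← join_face_root (N₁ := N₁) (r₁ := r₁), hf, h0, join_face_root]
  have h1 : f (Sum.inl (N₁.face r₁)) = Sum.inl (N₁'.face r₁') := by
    refine hs _ _ ?_ (join_face_inl.2 (sameCycle_apply_self _ _)) ?_ (by simp [join_face_root]) ?_
    · rw [← h0, hc]
      exact join_face_inl.2 (sameCycle_apply_self _ _)
    · rw [join_face_root, ← h2]
      exact fun e => by cases f.injective e
    · have e1 : (N₁.join r₁ N₂ r₂).rot.SameCycle (Sum.inl (N₁.face r₁)) (Sum.inr r₂) :=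
        join_rot_inl_inr.2 ⟨SameCycle.refl _ _, SameCycle.refl _ _⟩
      have e2 := (sameCycle_map_iff (π' := (N₁'.join r₁' N₂' r₂').rot) f.injective
        fun z _ => by simp [rot_apply, hf, ha]).2 e1
      rw [h2] at e2
      exact e2.trans (join_rot_inl_inr.2 ⟨SameCycle.refl _ _, SameCycle.refl _ _⟩).symm
  have hsum : ∀ z, f ((N₁.sum N₂).face z) = (N₁'.sum N₂').face (f z) := by
    intro z
    have := hf z
    rw [join_face_apply f.injective, ← id_eq ((N₁'.join _ N₂' _).face _),
      join_face_apply Function.injective_id, h1, h2] at this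
    exact (swap _ _).injective this
  have hsum' : ∀ z, f ((N₁.sum N₂).flip z) = (N₁'.sum N₂').flip (f z) := ha
  constructor
  · refine Iso.of_rel h₁ h₁' (fun a b => f (Sum.inl a) = Sum.inl b) h0 ?_ ?_ ?_ ?_
    · intro a b hab
      have := hsum (Sum.inl a)
      rw [hab] at this
      exact this
    · intro a b hab
      have := hsum' (Sum.inl a)
      rw [hab] at this
      exact this
    · intro a b c hb hc'
      exact Sum.inl_injective (hb.symm.trans hc')
    · intro a b c hb hc'
      exact Sum.inl_injective (f.injective (hb.trans hc'.symm))
  · refine Iso.of_rel h₂ h₂' (fun a b => f (Sum.inr a) = Sum.inr b) h2 ?_ ?_ ?_ ?_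
    · intro a b hab
      have := hsum (Sum.inr a)
      rw [hab] at this
      exact this
    · intro a b hab
      have := hsum' (Sum.inr a)
      rw [hab] at this
      exact this
    · intro a b c hb hc'
      exact Sum.inr_injective (hb.symm.trans hc')
    · intro a b c hb hc'
      exact Sum.inr_injective (f.injective (hb.trans hc'.symm))

end Join

/-- If the boundary of a planar map comes back to the origin of `N.face r` then the map is a
join: by the genus inequality, splitting this vertex disconnects the map. -/
theorem exists_iso_join [Finite D] {N : CombMap D} (hN : N.IsPlanar) {r d : D}
    (hd : N.face.SameCycle r d) (hne : d ≠ N.face r) (hr : N.rot.SameCycle d (N.face r)) :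
    ∃ (A : Set D) (N₁ : CombMap A) (r₁ : A) (N₂ : CombMap (Aᶜ : Set D)) (r₂ : (Aᶜ : Set D)),
      N₁.IsPlanar ∧ N₂.IsPlanar ∧ (N₁.join r₁ N₂ r₂).Iso (Sum.inl r₁) N r := by
  classical
  set N₀ := N.withFace (swap d (N.face r) * N.face) with hN₀
  have hdr : N.face.SameCycle d (N.face r) := hd.symm.trans (sameCycle_apply_self _ _)
  have hface : N.face = swap d (N.face r) * N₀.face := (swap_mul_self_mul _ _ _).symm
  have h0 : N₀.face r = d := by simp [hN₀, withFace]
  have hle : N.reach ≤ N₀.reach.glue d (N.face r) := by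
    refine sup_le ?_ (le_trans le_sup_right (Setoid.le_glue _ _ _))
    rw [setoid_eq_glue_swap_mul hdr hne]
    exact Setoid.glue_mono le_sup_left _ _
  obtain ⟨hnr, hp1, hp2⟩ := planar_components (N := N₀) (x := d) (y := N.face r) (fun z => by
      rcases hle (hN.connected d z) with h | ⟨-, h⟩ | ⟨-, h⟩
      exacts [Or.inl h, Or.inr (N₀.reach.symm' h), Or.inl (N₀.reach.symm' h)]) (by
    rw [hN₀, withFace_rot, numCycles_swap_mul hr hne]
    change _ + numCycles (swap d (N.face r) * N.face) = numCycles N.flip + 4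
    rw [numCycles_swap_mul hdr hne]
    have := hN.euler
    omega)
  have hrA : r ∈ {z | N₀.reach d z} := N₀.reach.symm' (h0 ▸ N₀.reach_face r)
  refine ⟨_, _, ⟨r, hrA⟩, _, ⟨N.face r, hnr⟩, hp1, hp2, Equiv.Set.sumCompl _, fun z => ?_, ?_, rfl⟩
  · have e1 : (((N₀.restrict _ (N₀.isClosed_reach d)).face ⟨r, hrA⟩ :) : D) = d := h0
    have e2 : ∀ w, N.face w = swap d (N.face r) (N₀.face w) := fun w => DFunLike.congr_fun hface w
    rw [join_face_apply (Equiv.Set.sumCompl _).injective, Equiv.Set.sumCompl_apply_inl, e1,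
      Equiv.Set.sumCompl_apply_inr]
    refine Eq.trans ?_ (e2 _).symm
    rcases z with z | z <;> rfl
  · rintro (z | z) <;> rfl

end CombMap

/-! ### Adding an edge that cuts a triangle off the root face -/

namespace CombMap

variable {D D' : Type}

open Classical in
/-- The map obtained from `N` by adding, inside the face of `r`, an edge `inr false` from the origin
of `r` to the origin of `N.face (N.face r)`. The reverse edge `inr true` forms a triangle with `r`
and `N.face r`; the face of `inr false` consists of the other darts of the face of `r`. -/
noncomputable def addEdge (N : CombMap D) (r : D) : CombMap (D ⊕ Bool) :=
  (N.sum edgeMap).withFace (swap (Sum.inr false) (Sum.inl r) *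
    (swap (Sum.inr true) (Sum.inl (N.face (N.face r))) * (N.sum edgeMap).face))

theorem addEdge_face_apply {E : Type} [DecidableEq E] {N : CombMap D} {r : D} {f : D ⊕ Bool → E}
    (hf : Function.Injective f) (z : D ⊕ Bool) : f ((N.addEdge r).face z) =
      swap (f (Sum.inr false)) (f (Sum.inl r)) (swap (f (Sum.inr true))
        (f (Sum.inl (N.face (N.face r)))) (f ((N.sum edgeMap).face z))) := by
  classical
  simp only [addEdge, withFace, mul_apply]
  rw [hf.map_swap, hf.map_swap]

theorem addEdge_face_apply' [DecidableEq D] {N : CombMap D} {r : D} (z : D ⊕ Bool) :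
    (N.addEdge r).face z = swap (Sum.inr false) (Sum.inl r) (swap (Sum.inr true)
        (Sum.inl (N.face (N.face r))) ((N.sum edgeMap).face z)) :=
  addEdge_face_apply Function.injective_id z

section AddEdge

variable [Finite D] [Finite D'] {N : CombMap D} {r : D} {N' : CombMap D'} {r' : D'}

open Classical in
theorem addEdge_setoid_rot_aux :
    SameCycle.setoid (swap (Sum.inr true) (Sum.inl (N.face (N.face r))) * (N.sum edgeMap).rot) =
      (SameCycle.setoid (Perm.sumCongr N.rot 1)).glue (Sum.inr true)
        (Sum.inl (N.face (N.face r))) := by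
  rw [sum_rot, edgeMap_rot]
  exact setoid_swap_mul not_sameCycle_sumCongr_inr_inl

open Classical in
theorem addEdge_not_sameCycle_aux : ¬ (swap (Sum.inr true) (Sum.inl (N.face (N.face r))) *
    (N.sum edgeMap).rot).SameCycle (Sum.inr false) (Sum.inl r) := by
  rw [← setoid_apply, addEdge_setoid_rot_aux, Setoid.glue_apply]
  simp [setoid_apply, sameCycle_sumCongr_inr, not_sameCycle_sumCongr_inr_inl]

open Classical in
theorem addEdge_setoid_rot : SameCycle.setoid (N.addEdge r).rot =
    ((SameCycle.setoid (Perm.sumCongr N.rot 1)).glue (Sum.inr true)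
        (Sum.inl (N.face (N.face r)))).glue (Sum.inr false) (Sum.inl r) := by
  rw [addEdge, ← mul_assoc, withFace_rot, mul_assoc, ← addEdge_setoid_rot_aux]
  exact setoid_swap_mul addEdge_not_sameCycle_aux

theorem addEdge_rot_inl_inl {d d' : D} :
    (N.addEdge r).rot.SameCycle (Sum.inl d) (Sum.inl d') ↔ N.rot.SameCycle d d' := by
  rw [← setoid_apply, addEdge_setoid_rot]
  simp [Setoid.glue_apply, setoid_apply, sameCycle_sumCongr_inr, sameCycle_sumCongr_inl,
    not_sameCycle_sumCongr_inr_inl, not_sameCycle_sumCongr_inl_inr]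

theorem addEdge_rot_false_inl {d : D} :
    (N.addEdge r).rot.SameCycle (Sum.inr false) (Sum.inl d) ↔ N.rot.SameCycle r d := by
  rw [← setoid_apply, addEdge_setoid_rot]
  simp [Setoid.glue_apply, setoid_apply, sameCycle_sumCongr_inr, sameCycle_sumCongr_inl,
    not_sameCycle_sumCongr_inr_inl, not_sameCycle_sumCongr_inl_inr, sameCycle_comm (x := r)]

theorem addEdge_rot_false_true :
    (N.addEdge r).rot.SameCycle (Sum.inr false) (Sum.inr true) ↔
      N.rot.SameCycle r (N.face (N.face r)) := by
  rw [← setoid_apply, addEdge_setoid_rot]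
  simp [Setoid.glue_apply, setoid_apply, sameCycle_sumCongr_inr, sameCycle_sumCongr_inl,
    not_sameCycle_sumCongr_inr_inl, not_sameCycle_sumCongr_inl_inr, sameCycle_comm (x := r)]

theorem addEdge_loopless_iff : (N.addEdge r).Loopless ↔
    N.Loopless ∧ ¬ N.rot.SameCycle r (N.face (N.face r)) := by
  constructor
  · exact fun h => ⟨fun d hd => h (Sum.inl d) (addEdge_rot_inl_inl.2 hd),
      fun k => h (Sum.inr false) (addEdge_rot_false_true.2 k)⟩
  · rintro ⟨h1, h2⟩ (d | (_ | _)) hd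
    · exact h1 d (addEdge_rot_inl_inl.1 hd)
    · exact h2 (addEdge_rot_false_true.1 hd)
    · exact h2 (addEdge_rot_false_true.1 hd.symm)

open Classical in
theorem addEdge_setoid_face_aux :
    SameCycle.setoid (swap (Sum.inr true) (Sum.inl (N.face (N.face r))) * (N.sum edgeMap).face) =
      (SameCycle.setoid (Perm.sumCongr N.face edgeMap.face)).glue (Sum.inr true)
        (Sum.inl (N.face (N.face r))) :=
  setoid_swap_mul not_sameCycle_sumCongr_inr_inl

open Classical in
theorem addEdge_sameCycle_face_aux : (swap (Sum.inr true) (Sum.inl (N.face (N.face r))) *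
    (N.sum edgeMap).face).SameCycle (Sum.inr false) (Sum.inl r) := by
  rw [← setoid_apply, addEdge_setoid_face_aux]
  simp [Setoid.glue_apply, setoid_apply, sameCycle_sumCongr_inr, sameCycle_sumCongr_inl,
    edgeMap_sameCycle_face, SameCycle.refl]

/-- The face of `r`, enlarged by the new edge on both sides, is split into the triangle and the new
root face. -/
theorem addEdge_setoid_face :
    ((SameCycle.setoid (Perm.sumCongr N.face edgeMap.face)).glue (Sum.inr true)
        (Sum.inl (N.face (N.face r)))) =
      (SameCycle.setoid (N.addEdge r).face).glue (Sum.inr false) (Sum.inl r) := by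
  classical
  rw [← addEdge_setoid_face_aux]
  exact setoid_eq_glue_swap_mul addEdge_sameCycle_face_aux (by simp)

theorem addEdge_not_sameCycle_face :
    ¬ (N.addEdge r).face.SameCycle (Sum.inr false) (Sum.inl r) := by
  classical
  exact not_sameCycle_swap_mul addEdge_sameCycle_face_aux (by simp)

theorem addEdge_numCycles :
    numCycles (N.addEdge r).rot = numCycles N.rot ∧
    numCycles (N.addEdge r).face = numCycles N.face + 1 ∧
    numCycles (N.addEdge r).flip = numCycles N.flip + 1 := by
  classical
  obtain ⟨h1, h2, h3⟩ := edgeMap_numCycles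
  refine ⟨?_, ?_, ?_⟩
  · have e1 := numCycles_swap_mul_of_not (addEdge_not_sameCycle_aux (N := N) (r := r))
    have e2 : numCycles (swap (Sum.inr true) (Sum.inl (N.face (N.face r))) *
        (N.sum edgeMap).rot) + 1 = numCycles (N.sum edgeMap).rot :=
      numCycles_swap_mul_of_not (by rw [sum_rot]; exact not_sameCycle_sumCongr_inr_inl)
    rw [sum_rot, numCycles_sumCongr, h1] at e2
    rw [addEdge, ← mul_assoc, withFace_rot, mul_assoc]
    rw [sum_rot] at e1
    rw [sum_rot]
    omega
  · have e1 := numCycles_swap_mul (addEdge_sameCycle_face_aux (N := N) (r := r)) (by simp)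
    have e2 : numCycles (swap (Sum.inr true) (Sum.inl (N.face (N.face r))) *
        (N.sum edgeMap).face) + 1 = numCycles N.face + numCycles edgeMap.face :=
      (numCycles_swap_mul_of_not not_sameCycle_sumCongr_inr_inl).trans (numCycles_sumCongr _ _)
    rw [h2] at e2
    rw [← e2, ← e1]
    rfl
  · rw [← h3]
    exact numCycles_sumCongr _ _

omit [Finite D] in
theorem addEdge_face_true : (N.addEdge r).face (Sum.inr true) = Sum.inl r := by
  classical
  rw [addEdge_face_apply']
  simp [sum, edgeMap, swap_apply_of_ne_of_ne]

omit [Finite D] in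
theorem addEdge_face_inl (d : D) (h1 : d ≠ N.face r) (h2 : N.face d ≠ r) :
    (N.addEdge r).face (Sum.inl d) = Sum.inl (N.face d) := by
  classical
  rw [addEdge_face_apply']
  simp [sum, edgeMap, swap_apply_of_ne_of_ne, h1, h2]

omit [Finite D] in
theorem addEdge_face_face : (N.addEdge r).face (Sum.inl (N.face r)) = Sum.inr true := by
  classical
  rw [addEdge_face_apply']
  simp [sum, edgeMap, swap_apply_of_ne_of_ne]

omit [Finite D] in
theorem addEdge_face_false (h : r ≠ N.face (N.face r)) :
    (N.addEdge r).face (Sum.inr false) = Sum.inl (N.face (N.face r)) := by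
  classical
  rw [addEdge_face_apply']
  simp [sum, edgeMap, swap_apply_of_ne_of_ne, h.symm]

theorem addEdge_sameCycle_true (hl : N.Loopless) (z : D ⊕ Bool) :
    (N.addEdge r).face.SameCycle (Sum.inr true) z ↔
      z = Sum.inr true ∨ z = Sum.inl r ∨ z = Sum.inl (N.face r) := by
  have hr : (N.addEdge r).face (Sum.inl r) = Sum.inl (N.face r) :=
    addEdge_face_inl r (IsPlanar.face_ne hl r).symm (IsPlanar.face_ne hl r)
  constructor
  · intro h
    refine h.mem_of_mapsTo (A := {z | z = Sum.inr true ∨ z = Sum.inl r ∨ z = Sum.inl (N.face r)})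
      ?_ (Or.inl rfl)
    rintro _ (rfl | rfl | rfl)
    · rw [addEdge_face_true]; exact Or.inr (Or.inl rfl)
    · rw [hr]; exact Or.inr (Or.inr rfl)
    · rw [addEdge_face_face]; exact Or.inl rfl
  · have h1 : (N.addEdge r).face.SameCycle (Sum.inr true) (Sum.inl r) := by
      rw [← addEdge_face_true (N := N)]; exact sameCycle_apply_self _ _
    have h2 : (N.addEdge r).face.SameCycle (Sum.inr true) (Sum.inl (N.face r)) := by
      rw [← hr]; exact h1.trans (sameCycle_apply_self _ _)
    rintro (rfl | rfl | rfl)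
    exacts [SameCycle.refl _ _, h1, h2]

theorem addEdge_deg_true (hl : N.Loopless) :
    Nat.card {z // (N.addEdge r).face.SameCycle (Sum.inr true) z} = 3 := by
  rw [Nat.card_congr (Equiv.subtypeEquivRight (addEdge_sameCycle_true hl))]
  change Set.ncard {Sum.inr true, Sum.inl r, Sum.inl (N.face r)} = 3
  have := (IsPlanar.face_ne hl r).symm
  rw [Set.ncard_eq_three]
  exact ⟨_, _, _, by simp, by simp, by simpa using this, rfl⟩

theorem addEdge_false_iff (z : D ⊕ Bool) :
    (N.addEdge r).face.SameCycle (Sum.inr false) z ↔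
      ((SameCycle.setoid (Perm.sumCongr N.face edgeMap.face)).glue (Sum.inr true)
        (Sum.inl (N.face (N.face r)))) (Sum.inr false) z ∧
      ¬ (N.addEdge r).face.SameCycle (Sum.inr true) z := by
  have h1 : (N.addEdge r).face.SameCycle (Sum.inr true) (Sum.inl r) := by
    rw [← addEdge_face_true (N := N)]; exact sameCycle_apply_self _ _
  rw [addEdge_setoid_face, Setoid.glue_apply]
  constructor
  · exact fun h => ⟨Or.inl h, fun k => addEdge_not_sameCycle_face (h.trans (k.symm.trans h1))⟩
  · rintro ⟨h | ⟨-, h⟩ | ⟨h, -⟩, h'⟩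
    · exact h
    · exact absurd (h1.trans (SameCycle.symm h)) h'
    · exact absurd h addEdge_not_sameCycle_face

theorem addEdge_false_inl (hl : N.Loopless) (d : D) :
    (N.addEdge r).face.SameCycle (Sum.inr false) (Sum.inl d) ↔
      N.face.SameCycle r d ∧ d ≠ r ∧ d ≠ N.face r := by
  rw [addEdge_false_iff, addEdge_sameCycle_true hl]
  simp [Setoid.glue_apply, setoid_apply, sameCycle_sumCongr_inr, sameCycle_sumCongr_inl,
    not_sameCycle_sumCongr_inr_inl, edgeMap_sameCycle_face, sameCycle_comm (x := r)]

theorem addEdge_false_true : ¬ (N.addEdge r).face.SameCycle (Sum.inr false) (Sum.inr true) := by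
  rw [addEdge_false_iff]
  exact fun h => h.2 (SameCycle.refl _ _)

theorem addEdge_root_deg (hl : N.Loopless) :
    Nat.card {z // (N.addEdge r).face.SameCycle (Sum.inr false) z} + 1 =
      Nat.card {d // N.face.SameCycle r d} := by
  have h1 :
      Nat.card {b : Bool // (N.addEdge r).face.SameCycle (Sum.inr false) (Sum.inr b)} = 1 := by
    rw [Nat.card_eq_one_iff_unique]
    refine ⟨⟨?_⟩, ⟨false, SameCycle.refl _ _⟩⟩
    rintro ⟨_ | _, h⟩ ⟨_ | _, h'⟩
    · rfl
    · exact absurd h' addEdge_false_true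
    · exact absurd h addEdge_false_true
    · rfl
  have h2 : Set.ncard ({d | N.face.SameCycle r d} \ {r, N.face r}) + 2 =
      Nat.card {d // N.face.SameCycle r d} := by
    rw [← Set.ncard_pair (IsPlanar.face_ne hl r).symm]
    refine Set.ncard_sdiff_add_ncard_of_subset ?_ (Set.toFinite _)
    rintro _ (rfl | rfl)
    exacts [SameCycle.refl _ _, sameCycle_apply_self _ _]
  rw [Nat.card_congr Equiv.subtypeSum, Nat.card_sum, h1, ← h2, add_assoc]
  congr 1
  refine Nat.card_congr (Equiv.subtypeEquivRight fun d => ?_)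
  rw [addEdge_false_inl hl]
  simp

theorem addEdge_deg_inl {d : D} (hd : ¬ N.face.SameCycle r d) :
    Nat.card {z // (N.addEdge r).face.SameCycle (Sum.inl d) z} =
      Nat.card {z // N.face.SameCycle d z} := by
  refine card_sameCycle_map (g := Sum.inl) Sum.inl_injective fun y hy => ?_
  refine addEdge_face_inl y ?_ ?_
  · rintro rfl
    exact hd (hy.trans (sameCycle_apply_self _ _).symm).symm
  · rintro rfl
    exact hd (hy.trans (sameCycle_apply_self _ _)).symm

theorem addEdge_connected (h : N.Connected) : (N.addEdge r).Connected := by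
  set E := N.addEdge r
  have ht : E.reach (Sum.inr true) (Sum.inl r) := by
    have := E.reach_face (Sum.inr true)
    rwa [addEdge_face_true] at this
  have hft : E.reach (Sum.inr true) (Sum.inr false) := E.reach_flip (Sum.inr true)
  have hface : ∀ x, E.reach (Sum.inl x) (Sum.inl (N.face x)) := by
    intro x
    by_cases h1 : x = N.face r
    · subst h1
      have h2 := E.reach_face (Sum.inl (N.face r))
      rw [addEdge_face_face] at h2
      by_cases h3 : r = N.face (N.face r)
      · rw [← h3]; exact E.reach.trans' h2 ht
      · have h4 := E.reach_face (Sum.inr false)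
        rw [addEdge_face_false h3] at h4
        exact E.reach.trans' h2 (E.reach.trans' hft h4)
    by_cases h2 : N.face x = r
    · have h3 : E.reach (Sum.inl x) (Sum.inr false) := by
        have h3 := E.reach_face (Sum.inl x)
        have : E.face (Sum.inl x) = Sum.inr false := by
          classical
          rw [addEdge_face_apply']
          simp [sum, h2]
          rw [swap_apply_of_ne_of_ne (a := Sum.inr true) (by simp) (by
            intro e
            apply h1
            apply N.face.injective
            rw [h2]; exact Sum.inl_injective e)]
          simp
        rwa [this] at h3
      rw [h2]
      exact E.reach.trans' h3 (E.reach.trans' (E.reach.symm' hft) ht)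
    · have := E.reach_face (Sum.inl x)
      rwa [addEdge_face_inl x h1 h2] at this
  have hle : ∀ a b, E.reach (Sum.inl a) (Sum.inl b) := fun a b =>
    (show N.reach ≤ E.reach.comap Sum.inl from
      reach_le_iff.2 ⟨hface, fun x => E.reach_flip (Sum.inl x)⟩) (h a b)
  have hr : ∀ z, E.reach (Sum.inl r) z := by
    rintro (z | (_ | _))
    exacts [hle r z, E.reach.trans' (E.reach.symm' ht) hft, E.reach.symm' ht]
  exact fun a b => E.reach.trans' (E.reach.symm' (hr a)) (hr b)

theorem connected_of_addEdge (h : (N.addEdge r).Connected) : N.Connected := by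
  have hr : ∀ z, N.reach r z := by
    intro z
    classical
    set T : Set (D ⊕ Bool) := {w | Sum.elim (fun d => N.reach r d) (fun _ => True) w} with hT
    have hinl : ∀ d, N.reach r d → Sum.inl d ∈ T := fun d h => h
    have hinr : ∀ b, Sum.inr b ∈ T := fun b => trivial
    have hs : ∀ w ∈ T, ∀ a ∈ T, ∀ b ∈ T, swap a b w ∈ T := by
      intro w hw a ha b hb
      rw [swap_apply_def]
      split_ifs <;> assumption
    have hb : Sum.inl z ∈ T := by
      refine mem_of_reach ?_ ?_ (h (Sum.inr true) (Sum.inl z)) (hinr true)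
      · intro w hw
        rw [addEdge_face_apply']
        refine hs _ (hs _ ?_ _ (hinr _) _ (hinl _ ?_)) _ (hinr _) _ (hinl _ (N.reach.refl' r))
        · rcases w with w | w
          · exact hinl _ (N.reach.trans' hw (N.reach_face w))
          · exact hinr _
        · exact N.reach.trans' (N.reach_face r) (N.reach_face _)
      · rintro (w | w) hw
        · exact hinl _ (N.reach.trans' hw (N.reach_flip w))
        · exact hinr _
    exact hb
  exact fun a b => N.reach.trans' (N.reach.symm' (hr a)) (hr b)

/-- Cutting a triangle off the root face turns the triangulations of the `(p + 1)`-gon, including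
those whose boundary meets the origin of `N.face r` twice, into triangulations of the `p`-gon. -/
theorem addEdge_isTri_iff {p : ℕ} (hp : 2 ≤ p) :
    ((N.addEdge r).IsTri (Sum.inr false) p ∧ (N.addEdge r).SimpleBoundary (Sum.inr false)) ↔
      N.IsTri r (p + 1) ∧ N.AlmostSimpleBoundary r := by
  obtain ⟨c1, c2, c3⟩ := addEdge_numCycles (N := N) (r := r)
  constructor
  · rintro ⟨h, hs⟩
    obtain ⟨hl, hrr⟩ := addEdge_loopless_iff.1 h.loopless
    have he := h.planar.euler
    refine ⟨⟨⟨connected_of_addEdge h.planar.connected, by omega⟩, ?_, fun d hd => ?_, hl⟩, ?_⟩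
    · rw [← addEdge_root_deg hl, h.root_deg]
    · rw [← addEdge_deg_inl hd]
      exact h.other_deg _ fun k => hd ((addEdge_false_inl hl d).1 k).1
    · -- the new edge starts at the origin of `r`, and replaces `r` on the boundary
      have key : ∀ d, N.face.SameCycle r d → d ≠ N.face r → N.rot.SameCycle r d → d = r := by
        intro d hd hn hr
        by_contra hne
        have := hs (Sum.inr false) (Sum.inl d) (SameCycle.refl _ _)
          ((addEdge_false_inl hl d).2 ⟨hd, hne, hn⟩) (addEdge_rot_false_inl.2 hr)
        cases this
      intro d d' hd hd' hn hn' hr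
      by_cases e : d = r
      · subst e; exact (key d' hd' hn' hr).symm
      by_cases e' : d' = r
      · subst e'; exact key d hd hn hr.symm
      exact Sum.inl_injective (hs (Sum.inl d) (Sum.inl d') ((addEdge_false_inl hl d).2 ⟨hd, e, hn⟩)
        ((addEdge_false_inl hl d').2 ⟨hd', e', hn'⟩) (addEdge_rot_inl_inl.2 hr))
  · rintro ⟨h, hs⟩
    have hl := h.loopless
    have he := h.planar.euler
    have hne : r ≠ N.face (N.face r) := by
      intro e
      have hsub : {d | N.face.SameCycle r d} ⊆ {r, N.face r} := by
        intro d hd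
        refine SameCycle.mem_of_mapsTo (A := {r, N.face r}) ?_ hd (by simp)
        rintro _ (rfl | rfl)
        · simp
        · rw [← e]; simp
      have h1 := Set.ncard_le_ncard hsub (Set.toFinite _)
      have h2 : Set.ncard {d | N.face.SameCycle r d} = p + 1 := h.root_deg
      have h3 := Set.ncard_insert_le r {N.face r}
      rw [Set.ncard_singleton] at h3
      omega
    have hrr : ¬ N.rot.SameCycle r (N.face (N.face r)) := by
      intro k
      refine hne (hs _ _ (SameCycle.refl _ _) ((sameCycle_apply_self _ _).trans
        (sameCycle_apply_self _ _)) (IsPlanar.face_ne hl r).symm (IsPlanar.face_ne hl _) k)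
    have hdeg := addEdge_root_deg hl (r := r)
    rw [h.root_deg] at hdeg
    refine ⟨⟨⟨addEdge_connected h.planar.connected, by omega⟩, by omega, ?_,
      addEdge_loopless_iff.2 ⟨hl, hrr⟩⟩, ?_⟩
    · have htri : ∀ z, (N.addEdge r).face.SameCycle (Sum.inr true) z →
          Nat.card {w // (N.addEdge r).face.SameCycle z w} = 3 := fun z hz => by
        rw [← card_sameCycle_eq hz, addEdge_deg_true hl]
      rintro (d | (_ | _)) hd
      · by_cases h1 : N.face.SameCycle r d
        · apply htri
          rw [addEdge_sameCycle_true hl]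
          by_contra! h2
          exact hd ((addEdge_false_inl hl d).2 ⟨h1, fun e => h2.2.1 (e ▸ rfl),
            fun e => h2.2.2 (e ▸ rfl)⟩)
        · rw [addEdge_deg_inl h1, h.other_deg d h1]
      · exact absurd (SameCycle.refl _ _) hd
      · exact addEdge_deg_true hl
    · rintro (d | (_ | _)) (d' | (_ | _)) hd hd' k
      · rw [addEdge_false_inl hl] at hd hd'
        rw [hs d d' hd.1 hd'.1 hd.2.2 hd'.2.2 (addEdge_rot_inl_inl.1 k)]
      · rw [addEdge_false_inl hl] at hd
        exact absurd (hs r d (SameCycle.refl _ _) hd.1 (IsPlanar.face_ne hl r).symm hd.2.2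
          (addEdge_rot_false_inl.1 k.symm)).symm hd.2.1
      · exact absurd hd' addEdge_false_true
      · rw [addEdge_false_inl hl] at hd'
        exact absurd (hs r d' (SameCycle.refl _ _) hd'.1 (IsPlanar.face_ne hl r).symm hd'.2.2
          (addEdge_rot_false_inl.1 k)).symm hd'.2.1
      · rfl
      · exact absurd hd' addEdge_false_true
      · exact absurd hd addEdge_false_true
      · exact absurd hd addEdge_false_true
      · rfl

omit [Finite D] [Finite D'] in
theorem Iso.addEdge (h : N.Iso r N' r') :
    (N.addEdge r).Iso (Sum.inr false) (N'.addEdge r') (Sum.inr false) := by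
  classical
  obtain ⟨f, hf, ha, rfl⟩ := h
  refine ⟨Equiv.sumCongr f (Equiv.refl Bool), fun d => ?_, ?_, rfl⟩
  · rw [addEdge_face_apply (Equiv.sumCongr f (Equiv.refl Bool)).injective, addEdge_face_apply']
    rcases d with d | d <;> simp [sum, hf]
  · rintro (d | d) <;> simp [CombMap.addEdge, withFace, sum, ha]

/-- The map can be recovered from the result of adding an edge, by deleting it. -/
theorem Iso.of_addEdge (h₁ : N.Connected) (h₁' : N'.Connected) (hn : r ≠ N.face (N.face r))
    (hn' : r' ≠ N'.face (N'.face r'))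
    (h : (N.addEdge r).Iso (Sum.inr false) (N'.addEdge r') (Sum.inr false)) :
    N.Iso r N' r' := by
  classical
  obtain ⟨f, hf, ha, h0⟩ := h
  have ht : f (Sum.inr true) = Sum.inr true := by
    have := ha (Sum.inr false)
    rw [h0] at this
    exact this
  have hr : f (Sum.inl r) = Sum.inl r' := by
    rw [← addEdge_face_true (N := N), hf, ht, addEdge_face_true]
  have hy : f (Sum.inl (N.face (N.face r))) = Sum.inl (N'.face (N'.face r')) := by
    rw [← addEdge_face_false hn, hf, h0, addEdge_face_false hn']
  have hsum : ∀ z, f ((N.sum edgeMap).face z) = (N'.sum edgeMap).face (f z) := by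
    intro z
    have := hf z
    rw [addEdge_face_apply f.injective, addEdge_face_apply', h0, ht, hr, hy] at this
    exact (swap _ _).injective ((swap _ _).injective this)
  refine Iso.of_rel h₁ h₁' (fun a b => f (Sum.inl a) = Sum.inl b) hr ?_ ?_ ?_ ?_
  · intro a b hab
    have := hsum (Sum.inl a)
    rw [hab] at this
    exact this
  · intro a b hab
    have := ha (Sum.inl a)
    rw [hab] at this
    exact this
  · intro a b c hb hc'
    exact Sum.inl_injective (hb.symm.trans hc')
  · intro a b c hb hc'
    exact Sum.inl_injective (f.injective (hb.trans hc'.symm))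

end AddEdge

theorem face_face_face_of_card_eq_three [Finite D] {π : Perm D} {t : D}
    (h : Nat.card {d // π.SameCycle t d} = 3) : π (π (π t)) = t ∧ π (π t) ≠ t := by
  have h3 : Set.ncard {d | π.SameCycle t d} = 3 := h
  have h2 : π (π t) ≠ t := by
    intro e
    have hsub : {d | π.SameCycle t d} ⊆ {t, π t} := by
      intro d hd
      refine SameCycle.mem_of_mapsTo (A := {t, π t}) ?_ hd (by simp)
      rintro _ (rfl | rfl)
      · simp
      · rw [e]; simp
    have h1 := Set.ncard_le_ncard hsub (Set.toFinite _)
    have h4 := Set.ncard_insert_le t {π t}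
    rw [Set.ncard_singleton] at h4
    omega
  have h1 : π t ≠ t := fun e => h2 (by rw [e, e])
  refine ⟨?_, h2⟩
  have hc : Set.ncard {t, π t, π (π t)} = 3 :=
    Set.ncard_eq_three.2 ⟨_, _, _, h1.symm, h2.symm, fun e => h1 (π.injective e).symm, rfl⟩
  have hsub : ({t, π t, π (π t)} : Set D) ⊆ {d | π.SameCycle t d} := by
    rintro _ (rfl | rfl | rfl)
    exacts [SameCycle.refl _ _, sameCycle_apply_self _ _,
      (sameCycle_apply_self _ _).trans (sameCycle_apply_self _ _)]
  have heq := Set.eq_of_subset_of_ncard_le hsub (by omega) (Set.toFinite _)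
  have hmem : π (π (π t)) ∈ ({t, π t, π (π t)} : Set D) := by
    rw [heq]
    exact (sameCycle_apply_self π _).trans
      ((sameCycle_apply_self π _).trans (sameCycle_apply_self π _))
  rcases hmem with e | e | e
  · exact e
  · exact absurd (π.injective e) h2
  · exact absurd (π.injective (π.injective e)) h1

/-- If both sides of the edge of the root dart are on the root face of a polygon, the map is a
single edge. -/
theorem iso_edgeMap [Finite D] {N : CombMap D} {r : D} {p : ℕ} (h : N.IsTri r p)
    (hs : N.SimpleBoundary r) (hr : N.face.SameCycle r (N.flip r)) : edgeMap.Iso true N r := by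
  have h1 : N.flip r = N.face r :=
    hs _ _ hr (sameCycle_apply_self _ _) (N.sameCycle_rot_flip_face r)
  have h2 : r = N.face (N.flip r) := by
    refine hs _ _ (SameCycle.refl _ _) (hr.trans (sameCycle_apply_self _ _)) ?_
    have := N.sameCycle_rot_flip_face (N.flip r)
    rwa [N.flip_flip] at this
  refine Iso.of_rel (edgeMap_isTri true).planar.connected h.planar.connected
    (fun b d => d = cond b r (N.flip r)) rfl ?_ ?_ ?_ ?_
  · rintro (_ | _) _ rfl
    exacts [h2.symm, h1.symm]
  · rintro (_ | _) _ rfl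
    exacts [N.flip_flip r, rfl]
  · rintro _ _ _ rfl rfl; rfl
  · rintro (_ | _) (_ | _) c h h'
    exacts [rfl, absurd (h.symm.trans h') (N.flip_ne r), absurd (h'.symm.trans h) (N.flip_ne r),
      rfl]

/-- If the edge of the root dart separates the root face from a triangle, it can be deleted. -/
theorem exists_iso_addEdge [Finite D] {N : CombMap D} {r : D} (hl : N.Loopless)
    (hr : ¬ N.face.SameCycle r (N.flip r))
    (h3 : Nat.card {d // N.face.SameCycle (N.flip r) d} = 3) :
    ∃ (A : Set D) (N' : CombMap A) (r' : A), (N'.addEdge r').Iso (Sum.inr false) N r := by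
  classical
  obtain ⟨t, ht⟩ : ∃ t, t = N.flip r := ⟨_, rfl⟩
  rw [← ht] at hr h3
  have hrt : r ≠ t := by rintro rfl; exact hr (SameCycle.refl _ _)
  obtain ⟨t3, t2⟩ := face_face_face_of_card_eq_three h3
  have hfr : N.face r ≠ r := IsPlanar.face_ne hl r
  have hft : N.face t ≠ t := IsPlanar.face_ne hl t
  have hrft : N.face r ≠ N.face t := fun e => hrt (N.face.injective e)
  have hcross : ∀ a b, N.face.SameCycle r a → N.face.SameCycle t b → a ≠ b := by
    rintro a _ h1 h2 rfl
    exact hr (h1.trans h2.symm)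
  have c1 := sameCycle_apply_self N.face r
  have k1 := sameCycle_apply_self N.face t
  have k2 := k1.trans (sameCycle_apply_self N.face (N.face t))
  set φ₀ := swap t (N.face r) * (swap r (N.face t) * N.face) with hφ₀
  have hface : N.face = swap r (N.face t) * (swap t (N.face r) * φ₀) := by
    rw [hφ₀, swap_mul_self_mul, swap_mul_self_mul]
  have e1 : φ₀ r = t := by
    simp only [hφ₀, mul_apply]
    rw [swap_apply_of_ne_of_ne hfr hrft, swap_apply_right]
  have e2 : φ₀ t = r := by
    simp only [hφ₀, mul_apply]
    rw [swap_apply_right, swap_apply_of_ne_of_ne hrt hfr.symm]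
  have e3 : φ₀ (N.face t) = N.face (N.face t) := by
    simp only [hφ₀, mul_apply]
    rw [swap_apply_of_ne_of_ne (hcross r _ (SameCycle.refl _ _) k2).symm
      (fun e => hft (N.face.injective e)), swap_apply_of_ne_of_ne t2 (hcross _ _ c1 k2).symm]
  have e4 : φ₀ (N.face (N.face t)) = N.face r := by
    simp only [hφ₀, mul_apply]
    rw [t3, swap_apply_of_ne_of_ne hrt.symm hft.symm, swap_apply_left]
  have hcl : (N.withFace φ₀).IsClosed {r, t} := by
    refine isClosed_of_mapsTo ?_ ?_
    · rintro _ (rfl | rfl)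
      · exact Or.inr e1
      · exact Or.inl e2
    · rintro _ (rfl | rfl)
      · exact Or.inr ht.symm
      · refine Or.inl ?_
        rw [ht]
        exact N.flip_flip _
  have hA : N.face t ∈ ({r, t} : Set D)ᶜ := by
    rintro (h | h)
    · exact (hcross r _ (SameCycle.refl _ _) k1) h.symm
    · exact hft h
  let g : (({r, t} : Set D)ᶜ : Set D) ⊕ Bool → D := Sum.elim (↑) fun b => cond b t r
  have hg : Function.Bijective g := by
    constructor
    · rintro (⟨a, ha⟩ | (_ | _)) (⟨b, hb⟩ | (_ | _)) hab
      · simpa [g] using hab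
      · exact absurd (Or.inl hab) ha
      · exact absurd (Or.inr hab) ha
      · exact absurd (Or.inl hab.symm) hb
      · rfl
      · exact absurd hab hrt
      · exact absurd (Or.inr hab.symm) hb
      · exact absurd hab.symm hrt
      · rfl
    · intro d
      by_cases h1 : d = r
      · exact ⟨Sum.inr false, h1.symm⟩
      by_cases h2 : d = t
      · exact ⟨Sum.inr true, h2.symm⟩
      exact ⟨Sum.inl ⟨d, by rintro (h | h); exacts [h1 h, h2 h]⟩, rfl⟩
  refine ⟨_, (N.withFace φ₀).restrict _ hcl.compl, ⟨N.face t, hA⟩, Equiv.ofBijective g hg,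
    fun z => ?_, ?_, rfl⟩
  · rw [addEdge_face_apply (Equiv.ofBijective g hg).injective]
    have hN : ∀ w, N.face w = swap r (N.face t) (swap t (N.face r) (φ₀ w)) :=
      fun w => DFunLike.congr_fun hface w
    have e5 : g (Sum.inl (((N.withFace φ₀).restrict _ hcl.compl).face
        (((N.withFace φ₀).restrict _ hcl.compl).face ⟨N.face t, hA⟩))) = N.face r := by
      change φ₀ (φ₀ (N.face t)) = _
      rw [e3, e4]
    simp only [Equiv.ofBijective_apply]
    rw [e5]
    refine Eq.trans ?_ (hN _).symm
    rcases z with z | (_ | _)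
    · rfl
    · change swap r (N.face t) (swap t (N.face r) t) = _
      rw [show g (Sum.inr false) = r from rfl, e1]
    · change swap r (N.face t) (swap t (N.face r) r) = _
      rw [show g (Sum.inr true) = t from rfl, e2]
  · rintro (z | (_ | _))
    · rfl
    · exact ht
    · exact (N.flip_flip r).symm.trans (congrArg _ ht.symm)

end CombMap

/-! ### Tutte's equation -/

namespace PlanarMap

open CombMap

/-- The class of the map with a single edge. -/
noncomputable def edge : PlanarMap := edgeMap.cls true

/-- Type II triangulations of the `p`-gon, except that the boundary may visit the endpoint of the
root dart twice. -/
def almostTypeII (p : ℕ) : Set PlanarMap :=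
  {c | ∃ (n : ℕ) (N : CombMap (Fin n)) (x : Fin n),
    c = N.cls x ∧ N.IsTri x p ∧ N.AlmostSimpleBoundary x}

theorem cls_mem_almostTypeII {D : Type} [Finite D] {N : CombMap D} {x : D} (h : N.IsPlanar)
    {p : ℕ} :
    N.cls x ∈ almostTypeII p ↔ N.IsTri x p ∧ N.AlmostSimpleBoundary x := by
  constructor
  · rintro ⟨n, m, y, hm, h1, h2⟩
    have hi := (cls_eq_cls_iff h h1.planar).1 hm
    exact ⟨hi.symm.isTri h1, hi.symm.almostSimpleBoundary h2⟩
  · rintro ⟨h1, h2⟩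
    obtain ⟨n, m, y, hm, hc⟩ := exists_eq_cls (N.cls x)
    have hi := (cls_eq_cls_iff h hm).1 hc
    exact ⟨n, m, y, hc, hi.isTri h1, hi.almostSimpleBoundary h2⟩

theorem typeII_subset_almostTypeII (p : ℕ) : typeII p ⊆ almostTypeII p := by
  intro c hc
  obtain ⟨n, N, x, hN, rfl⟩ := exists_eq_cls c
  rw [cls_mem_typeII hN] at hc
  exact (cls_mem_almostTypeII hN).2 ⟨hc.1, hc.2.almost⟩

theorem typeII_disjoint {c : PlanarMap} {p q : ℕ} (hp : c ∈ typeII p) (hq : c ∈ typeII q) :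
    p = q := by
  obtain ⟨n, N, x, hN, rfl⟩ := exists_eq_cls c
  rw [cls_mem_typeII hN] at hp hq
  exact hp.1.root_deg.symm.trans hq.1.root_deg

theorem two_le_of_mem_typeII {c : PlanarMap} {p : ℕ} (hp : c ∈ typeII p) : 2 ≤ p := by
  obtain ⟨n, N, x, hN, rfl⟩ := exists_eq_cls c
  rw [cls_mem_typeII hN] at hp
  exact hp.1.two_le

theorem edge_mem_typeII_iff {p : ℕ} : edge ∈ typeII p ↔ p = 2 := by
  have h2 : edge ∈ typeII 2 := (cls_mem_typeII (edgeMap_isTri true).planar).2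
    ⟨edgeMap_isTri true, edgeMap_simpleBoundary true⟩
  exact ⟨fun h => typeII_disjoint h h2, fun h => h ▸ h2⟩

/-- `CombMap.addEdge` on isomorphism classes. -/
noncomputable def addEdge (c : PlanarMap) : PlanarMap :=
  ((exists_eq_cls c).choose_spec.choose.addEdge
    (exists_eq_cls c).choose_spec.choose_spec.choose).cls (Sum.inr false)

/-- `CombMap.join` on isomorphism classes. -/
noncomputable def join (c c' : PlanarMap) : PlanarMap :=
  ((exists_eq_cls c).choose_spec.choose.join (exists_eq_cls c).choose_spec.choose_spec.choose
    (exists_eq_cls c').choose_spec.choose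
    (exists_eq_cls c').choose_spec.choose_spec.choose).cls
      (Sum.inl (exists_eq_cls c).choose_spec.choose_spec.choose)

section

variable {D D' : Type} [Finite D] [Finite D'] {N : CombMap D} {x : D} {N' : CombMap D'} {x' : D'}

theorem addEdge_cls (h : N.IsPlanar) :
    addEdge (N.cls x) = (N.addEdge x).cls (Sum.inr false) := by
  have hs := (exists_eq_cls (N.cls x)).choose_spec.choose_spec.choose_spec
  exact (((cls_eq_cls_iff h hs.1).1 hs.2).symm.addEdge).cls_eq

theorem join_cls (h : N.IsPlanar) (h' : N'.IsPlanar) :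
    join (N.cls x) (N'.cls x') = (N.join x N' x').cls (Sum.inl x) := by
  have hs := (exists_eq_cls (N.cls x)).choose_spec.choose_spec.choose_spec
  have hs' := (exists_eq_cls (N'.cls x')).choose_spec.choose_spec.choose_spec
  exact (((cls_eq_cls_iff h hs.1).1 hs.2).symm.join ((cls_eq_cls_iff h' hs'.1).1 hs'.2).symm).cls_eq

end

/-- Deleting the edge of the root dart is a bijection from the triangulations of the `p`-gon other
than the single edge to `almostTypeII (p + 1)`. -/
theorem addEdge_bijOn {p : ℕ} (hp : 2 ≤ p) :
    Set.BijOn addEdge (almostTypeII (p + 1)) (typeII p \ {edge}) := by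
  refine ⟨?_, ?_, ?_⟩
  · rintro _ ⟨n, N, x, rfl, h, hs⟩
    obtain ⟨h1, h2⟩ := (addEdge_isTri_iff hp).2 ⟨h, hs⟩
    rw [addEdge_cls h.planar]
    refine ⟨(cls_mem_typeII h1.planar).2 ⟨h1, h2⟩, fun he => ?_⟩
    obtain ⟨f, hf, ha, h0⟩ := (cls_eq_cls_iff h1.planar (edgeMap_isTri true).planar).1 he
    refine addEdge_false_true (N := N) (r := x) ((sameCycle_map_iff f.injective
      fun _ _ => (hf _).symm).1 (edgeMap_sameCycle_face _ _))
  · rintro _ ⟨n, N, x, rfl, h, hs⟩ _ ⟨n', N', x', rfl, h', hs'⟩ he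
    obtain ⟨h1, h2⟩ := (addEdge_isTri_iff hp).2 ⟨h, hs⟩
    obtain ⟨h1', h2'⟩ := (addEdge_isTri_iff hp).2 ⟨h', hs'⟩
    rw [addEdge_cls h.planar, addEdge_cls h'.planar, cls_eq_cls_iff h1.planar h1'.planar] at he
    have hne := (addEdge_loopless_iff.1 h1.loopless).2
    have hne' := (addEdge_loopless_iff.1 h1'.loopless).2
    exact (Iso.of_addEdge h.planar.connected h'.planar.connected
      (fun e => hne (e ▸ SameCycle.refl _ _)) (fun e => hne' (e ▸ SameCycle.refl _ _)) he).cls_eq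
  · rintro c ⟨hc, hne⟩
    obtain ⟨n, N, x, hN, rfl⟩ := exists_eq_cls c
    rw [cls_mem_typeII hN] at hc
    by_cases hr : N.face.SameCycle x (N.flip x)
    · exact absurd (iso_edgeMap hc.1 hc.2 hr).cls_eq.symm hne
    · obtain ⟨A, N', x', hi⟩ := exists_iso_addEdge hc.1.loopless hr (hc.1.other_deg _ hr)
      obtain ⟨h1, h2⟩ := (addEdge_isTri_iff hp).1 ⟨hi.symm.isTri hc.1, hi.symm.simpleBoundary hc.2⟩
      refine ⟨N'.cls x', (cls_mem_almostTypeII h1.planar).2 ⟨h1, h2⟩, ?_⟩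
      rw [addEdge_cls h1.planar]
      exact hi.cls_eq

theorem join_mem {p q : ℕ} {c c' : PlanarMap} (hc : c ∈ typeII p) (hc' : c' ∈ typeII q) :
    join c c' ∈ almostTypeII (p + q) \ typeII (p + q) := by
  obtain ⟨n, N, x, hN, rfl⟩ := exists_eq_cls c
  obtain ⟨n', N', x', hN', rfl⟩ := exists_eq_cls c'
  rw [cls_mem_typeII hN] at hc
  rw [cls_mem_typeII hN'] at hc'
  have h := hc.1.join hc'.1
  rw [join_cls hN hN']
  exact ⟨(cls_mem_almostTypeII h.planar).2 ⟨h, hc.2.join hc'.2⟩,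
    fun k => join_not_simpleBoundary ((cls_mem_typeII h.planar).1 k).2⟩

theorem join_injective {p q p' q' : ℕ} {c d c' d' : PlanarMap} (hc : c ∈ typeII p)
    (hd : d ∈ typeII q) (hc' : c' ∈ typeII p') (hd' : d' ∈ typeII q')
    (h : join c d = join c' d') : c = c' ∧ d = d' := by
  obtain ⟨_, N, x, hN, rfl⟩ := exists_eq_cls c
  obtain ⟨_, K, y, hK, rfl⟩ := exists_eq_cls d
  obtain ⟨_, N', x', hN', rfl⟩ := exists_eq_cls c'
  obtain ⟨_, K', y', hK', rfl⟩ := exists_eq_cls d'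
  rw [cls_mem_typeII hN] at hc
  rw [cls_mem_typeII hK] at hd
  rw [cls_mem_typeII hN'] at hc'
  rw [cls_mem_typeII hK'] at hd'
  rw [join_cls hN hK, join_cls hN' hK', cls_eq_cls_iff (hc.1.join hd.1).planar
    (hc'.1.join hd'.1).planar] at h
  obtain ⟨h1, h2⟩ := Iso.of_join hN.connected hK.connected hN'.connected hK'.connected
    (hc'.2.join hd'.2) h
  exact ⟨h1.cls_eq, h2.cls_eq⟩

/-- An element of `almostTypeII q` whose boundary is not simple is a join. -/
theorem exists_join {q : ℕ} {c : PlanarMap} (hc : c ∈ almostTypeII q) (hc' : c ∉ typeII q) :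
    ∃ p₁ p₂, p₁ + p₂ = q ∧ ∃ c₁ ∈ typeII p₁, ∃ c₂ ∈ typeII p₂, join c₁ c₂ = c := by
  obtain ⟨n, N, x, rfl, h, hs⟩ := hc
  rw [cls_mem_typeII h.planar] at hc'
  have hns : ¬ N.SimpleBoundary x := fun k => hc' ⟨h, k⟩
  obtain ⟨d, hd, hne, hr⟩ : ∃ d, N.face.SameCycle x d ∧ d ≠ N.face x ∧
      N.rot.SameCycle d (N.face x) := by
    by_contra! hcon
    refine hns fun d d' hd hd' hr => ?_
    by_cases e : d = N.face x
    · by_contra hne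
      exact hcon d' hd' (fun e' => hne (e.trans e'.symm)) (e ▸ hr.symm)
    by_cases e' : d' = N.face x
    · exact absurd (e' ▸ hr) (hcon d hd e)
    exact hs d d' hd hd' e e' hr
  obtain ⟨A, N₁, r₁, N₂, r₂, h₁, h₂, hi⟩ := exists_iso_join h.planar hd hne hr
  obtain ⟨p₁, p₂, hp, ⟨t₁, s₁⟩, t₂, s₂⟩ := isTri_of_join h₁ h₂ (hi.symm.isTri h)
    (hi.symm.almostSimpleBoundary hs)
  refine ⟨p₁, p₂, hp, _, (cls_mem_typeII h₁).2 ⟨t₁, s₁⟩, _, (cls_mem_typeII h₂).2 ⟨t₂, s₂⟩, ?_⟩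
  rw [join_cls h₁ h₂]
  exact hi.cls_eq

/-- Deletion of the edge of the root dart, as an identity of sums over triangulations of
polygons. -/
theorem tsum_typeII (g : PlanarMap → ℝ≥0∞) {p : ℕ} (hp : 2 ≤ p) :
    ∑' c : typeII p, g c = (if p = 2 then g edge else 0) + ∑' c : typeII (p + 1), g (addEdge c) +
      ∑ ij ∈ Finset.HasAntidiagonal.antidiagonal (p + 1), ∑' (c : typeII ij.1) (c' : typeII ij.2),
        g (addEdge (join c c')) := by
  classical
  have h1 : ∑' c : typeII p, g c =
      (if p = 2 then g edge else 0) + ∑' c : (typeII p \ {edge} : Set PlanarMap), g c := by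
    split_ifs with h
    · have he : edge ∈ typeII p := edge_mem_typeII_iff.2 h
      rw [← tsum_singleton edge g, ← ENNReal.summable.tsum_union_disjoint
        (Set.disjoint_sdiff_right) ENNReal.summable]
      exact tsum_congr_set_coe g (Set.union_sdiff_cancel (Set.singleton_subset_iff.2 he)).symm
    · rw [zero_add, Set.sdiff_singleton_eq_self fun k => h (edge_mem_typeII_iff.1 k)]
  have h2 : ∑' c : (typeII p \ {edge} : Set PlanarMap), g c =
      ∑' c : almostTypeII (p + 1), g (addEdge c) :=
    ((addEdge_bijOn hp).equiv.tsum_eq (fun c => g c)).symm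
  have h3 : ∑' c : almostTypeII (p + 1), g (addEdge c) = ∑' c : typeII (p + 1), g (addEdge c) +
      ∑' c : (almostTypeII (p + 1) \ typeII (p + 1) : Set PlanarMap), g (addEdge c) := by
    rw [← ENNReal.summable.tsum_union_disjoint (f := fun c => g (addEdge c))
        (Set.disjoint_sdiff_right) ENNReal.summable]
    exact tsum_congr_set_coe (fun c => g (addEdge c))
      (Set.union_sdiff_cancel (typeII_subset_almostTypeII _)).symm
  let F : (Σ ij : Finset.HasAntidiagonal.antidiagonal (p + 1), typeII ij.1.1 × typeII ij.1.2) →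
      (almostTypeII (p + 1) \ typeII (p + 1) : Set PlanarMap) := fun t =>
    ⟨join t.2.1 t.2.2, by
      have := join_mem t.2.1.2 t.2.2.2
      rwa [Finset.HasAntidiagonal.mem_antidiagonal.1 t.1.2] at this⟩
  have hF : Function.Bijective F := by
    constructor
    · rintro ⟨⟨⟨i, j⟩, hij⟩, ⟨c, hc⟩, ⟨d, hd⟩⟩ ⟨⟨⟨i', j'⟩, hij'⟩, ⟨c', hc'⟩, ⟨d', hd'⟩⟩ h
      obtain ⟨rfl, rfl⟩ := join_injective hc hd hc' hd' (Subtype.ext_iff.1 h)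
      obtain rfl := typeII_disjoint hc hc'
      obtain rfl := typeII_disjoint hd hd'
      rfl
    · rintro ⟨c, hc, hc'⟩
      obtain ⟨p₁, p₂, hpp, c₁, h₁, c₂, h₂, rfl⟩ := exists_join hc hc'
      exact ⟨⟨⟨(p₁, p₂), Finset.HasAntidiagonal.mem_antidiagonal.2 hpp⟩, ⟨c₁, h₁⟩, ⟨c₂, h₂⟩⟩, rfl⟩
  have h4 : ∑' c : (almostTypeII (p + 1) \ typeII (p + 1) : Set PlanarMap), g (addEdge c) =
      ∑ ij ∈ Finset.HasAntidiagonal.antidiagonal (p + 1), ∑' (c : typeII ij.1) (c' : typeII ij.2),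
        g (addEdge (join c c')) := by
    rw [← (Equiv.ofBijective F hF).tsum_eq, ENNReal.tsum_sigma', tsum_fintype,
      ← Finset.sum_coe_sort (Finset.HasAntidiagonal.antidiagonal (p + 1))
        (fun ij => ∑' (c : typeII ij.1) (c' : typeII ij.2), g (addEdge (join c c')))]
    exact Finset.sum_congr rfl fun ij _ => ENNReal.tsum_prod
      (f := fun (c : typeII ij.1.1) (c' : typeII ij.1.2) => g (addEdge (join c.1 c'.1)))
  rw [h1, h2, h3, h4, add_assoc]

theorem numVertices_edge : edge.numVertices = 2 := by
  rw [edge, numVertices_cls (edgeMap_isTri true).planar, edgeMap_numCycles.1]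

theorem addEdge_num {c : PlanarMap} {p : ℕ} (hp : 2 ≤ p) (hc : c ∈ almostTypeII (p + 1)) :
    (addEdge c).numVertices = c.numVertices ∧ (addEdge c).numEdges = c.numEdges + 1 := by
  obtain ⟨n, N, x, rfl, h, hs⟩ := hc
  have h1 := ((addEdge_isTri_iff hp).2 ⟨h, hs⟩).1
  rw [addEdge_cls h.planar, numVertices_cls h.planar, numVertices_cls h1.planar,
    numEdges_cls h.planar, numEdges_cls h1.planar]
  exact ⟨addEdge_numCycles.1, addEdge_numCycles.2.2⟩

theorem join_num {c c' : PlanarMap} {p p' : ℕ} (hc : c ∈ typeII p) (hc' : c' ∈ typeII p') :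
    (join c c').numVertices + 1 = c.numVertices + c'.numVertices ∧
      (join c c').numEdges = c.numEdges + c'.numEdges := by
  obtain ⟨n, N, x, hN, rfl⟩ := exists_eq_cls c
  obtain ⟨n', N', x', hN', rfl⟩ := exists_eq_cls c'
  rw [cls_mem_typeII hN] at hc
  rw [cls_mem_typeII hN'] at hc'
  have h := hc.1.join hc'.1
  rw [join_cls hN hN', numVertices_cls hN, numVertices_cls h.planar, numVertices_cls hN',
    numEdges_cls hN, numEdges_cls h.planar, numEdges_cls hN']
  exact ⟨join_numCycles.1, join_numCycles.2.2⟩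

/-- The generating function, with weight `x` per inner vertex, of the type II triangulations of the
`p`-gon with fewer than `n` edges. -/
noncomputable def genFunLT (x : ℝ≥0∞) (n p : ℕ) : ℝ≥0∞ :=
  ∑' c : typeII p, if c.1.numEdges < n then x ^ c.1.numVertices * (x⁻¹) ^ p else 0

/-- The generating function of the type II triangulations of the `p`-gon, with weight `x` per inner
vertex. -/
noncomputable def genFun (x : ℝ≥0∞) (p : ℕ) : ℝ≥0∞ :=
  ∑' c : typeII p, x ^ c.1.numVertices * (x⁻¹) ^ p

theorem genFun_le {x : ℝ≥0∞} {p : ℕ} {B : ℝ≥0∞} (h : ∀ n, genFunLT x n p ≤ B) : genFun x p ≤ B := by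
  rw [genFun, ENNReal.tsum_eq_iSup_sum]
  refine iSup_le fun s => ?_
  obtain ⟨n, hn⟩ : ∃ n, ∀ c ∈ s, c.1.numEdges < n :=
    ⟨s.sup (fun c => c.1.numEdges) + 1, fun c hc =>
      Nat.lt_succ_of_le (Finset.le_sup (f := fun c => c.1.numEdges) hc)⟩
  refine le_trans ?_ (h n)
  rw [Finset.sum_congr rfl fun c hc => (if_pos (hn c hc)).symm]
  exact ENNReal.sum_le_tsum s

section Weights

variable {x : ℝ≥0∞} (hx0 : x ≠ 0) (hx : x ≠ ∞)
include hx0 hx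

theorem weight_edge : x ^ edge.numVertices * (x⁻¹) ^ 2 = 1 := by
  rw [numVertices_edge, ← mul_pow, ENNReal.mul_inv_cancel hx0 hx, one_pow]

theorem weight_addEdge {c : PlanarMap} {p : ℕ} (hp : 2 ≤ p) (hc : c ∈ almostTypeII (p + 1)) :
    x ^ (addEdge c).numVertices * (x⁻¹) ^ p = x * (x ^ c.numVertices * (x⁻¹) ^ (p + 1)) := by
  rw [(addEdge_num hp hc).1]
  calc x ^ c.numVertices * (x⁻¹) ^ p = x ^ c.numVertices * (x⁻¹) ^ p * (x * x⁻¹) := by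
        rw [ENNReal.mul_inv_cancel hx0 hx, mul_one]
    _ = _ := by ring

theorem weight_join {c c' : PlanarMap} {p i j : ℕ} (hp : 2 ≤ p) (hij : i + j = p + 1)
    (hc : c ∈ typeII i) (hc' : c' ∈ typeII j) :
    x ^ (addEdge (join c c')).numVertices * (x⁻¹) ^ p =
      (x ^ c.numVertices * (x⁻¹) ^ i) * (x ^ c'.numVertices * (x⁻¹) ^ j) := by
  have hm := (join_mem hc hc').1
  rw [hij] at hm
  rw [weight_addEdge hx0 hx hp hm, ← hij]
  have h := (join_num hc hc').1
  calc x * (x ^ (join c c').numVertices * x⁻¹ ^ (i + j))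
      = x ^ ((join c c').numVertices + 1) * x⁻¹ ^ (i + j) := by ring
    _ = _ := by rw [h]; ring

/-- Tutte's equation. -/
theorem genFun_eq {p : ℕ} (hp : 2 ≤ p) : genFun x p = (if p = 2 then 1 else 0) +
    x * genFun x (p + 1) +
      ∑ ij ∈ Finset.HasAntidiagonal.antidiagonal (p + 1), genFun x ij.1 * genFun x ij.2 := by
  rw [genFun, tsum_typeII (fun c => x ^ c.numVertices * (x⁻¹) ^ p) hp]
  congr 1
  · congr 1
    · split_ifs with h
      · rw [h, weight_edge hx0 hx]
      · rfl
    · rw [genFun, ← ENNReal.tsum_mul_left]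
      exact tsum_congr fun c => weight_addEdge hx0 hx hp (typeII_subset_almostTypeII _ c.2)
  · refine Finset.sum_congr rfl fun ij hij => ?_
    rw [genFun, genFun, ← ENNReal.tsum_mul_right]
    refine tsum_congr fun c => ?_
    rw [← ENNReal.tsum_mul_left]
    exact tsum_congr fun c' =>
      weight_join hx0 hx hp (Finset.HasAntidiagonal.mem_antidiagonal.1 hij) c.2 c'.2

/-- Truncated form of Tutte's equation: each of the pieces has fewer edges than the whole. -/
theorem genFunLT_succ_le (n : ℕ) {p : ℕ} (hp : 2 ≤ p) :
    genFunLT x (n + 1) p ≤ (if p = 2 then 1 else 0) + x * genFunLT x n (p + 1) +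
      ∑ ij ∈ Finset.HasAntidiagonal.antidiagonal (p + 1),
        genFunLT x n ij.1 * genFunLT x n ij.2 := by
  rw [genFunLT, tsum_typeII
    (fun c => if c.numEdges < n + 1 then x ^ c.numVertices * (x⁻¹) ^ p else 0) hp]
  refine add_le_add (add_le_add ?_ ?_) (Finset.sum_le_sum fun ij hij => ?_)
  · split_ifs with h
    · rw [h, weight_edge hx0 hx]
    · exact zero_le
    · exact le_rfl
  · rw [genFunLT, ← ENNReal.tsum_mul_left]
    refine ENNReal.tsum_le_tsum fun c => ?_
    have hm := typeII_subset_almostTypeII _ c.2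
    have h2 := (addEdge_num hp hm).2
    split_ifs with h h'
    · rw [weight_addEdge hx0 hx hp hm]
    · omega
    · exact zero_le
    · exact zero_le
  · rw [genFunLT, genFunLT, ← ENNReal.tsum_mul_right]
    refine ENNReal.tsum_le_tsum fun c => ?_
    rw [← ENNReal.tsum_mul_left]
    refine ENNReal.tsum_le_tsum fun c' => ?_
    have hij' := Finset.HasAntidiagonal.mem_antidiagonal.1 hij
    have hm := (join_mem c.2 c'.2).1
    rw [hij'] at hm
    have h2 := (addEdge_num hp hm).2
    have h3 := (join_num c.2 c'.2).2
    split_ifs with h h' h''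
    · rw [weight_join hx0 hx hp hij' c.2 c'.2]
    · omega
    · omega
    · omega
    all_goals exact zero_le

end Weights

end PlanarMap

/-! ### Solution of Tutte's equation -/

/-- The solution `z 0, z 1, …` of the recursion of triangulations of the `2, 3, …`-gon, for the
weight `θ * (1 - 2 * θ) ^ 2` per inner vertex. -/
noncomputable def tutteSol (θ : ℝ) (k : ℕ) : ℝ :=
  (1 / (1 - 2 * θ) ^ 2) ^ k *
    (catalan k / (1 - 2 * θ) - θ * catalan (k + 1) / (1 - 2 * θ) ^ 2)

section Catalan

/-- Telescoping form, which gives the convergence of the Catalan series at its singularity. -/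
theorem catalan_div_four_pow (k : ℕ) : (catalan k : ℝ) / 4 ^ k =
    2 * (k.centralBinom / 4 ^ k - (k + 1).centralBinom / 4 ^ (k + 1)) := by
  have h1 : ((k : ℝ) + 1) * catalan k = k.centralBinom := by
    exact_mod_cast succ_mul_catalan_eq_centralBinom k
  have h2 : ((k : ℝ) + 1) * (k + 1).centralBinom = 2 * (2 * k + 1) * k.centralBinom := by
    exact_mod_cast Nat.succ_mul_centralBinom_succ k
  have h3 : ((k + 1).centralBinom : ℝ) = 2 * (2 * k + 1) * catalan k := by
    have h0 : (k : ℝ) + 1 ≠ 0 := by positivity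
    apply mul_left_cancel₀ h0
    rw [h2, ← h1]
    ring
  rw [h3, ← h1, pow_succ]
  field_simp
  ring

theorem catalan_succ_le (k : ℕ) : (catalan (k + 1) : ℝ) ≤ 4 * catalan k := by
  have h1 : ((k : ℝ) + 1) * catalan k = k.centralBinom := by
    exact_mod_cast succ_mul_catalan_eq_centralBinom k
  have h2 : ((k : ℝ) + 1) * (k + 1).centralBinom = 2 * (2 * k + 1) * k.centralBinom := by
    exact_mod_cast Nat.succ_mul_centralBinom_succ k
  have h3 : ((k : ℝ) + 1 + 1) * catalan (k + 1) = (k + 1).centralBinom := by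
    exact_mod_cast succ_mul_catalan_eq_centralBinom (k + 1)
  have hC : (0 : ℝ) ≤ catalan k := Nat.cast_nonneg _
  have h0 : (0 : ℝ) < k + 1 + 1 := by positivity
  have h4 : ((k : ℝ) + 1 + 1) * catalan (k + 1) = 2 * (2 * k + 1) * catalan k := by
    have h0 : (k : ℝ) + 1 ≠ 0 := by positivity
    apply mul_left_cancel₀ h0
    rw [h3, h2, ← h1]
    ring
  refine le_of_mul_le_mul_left ?_ h0
  rw [h4]
  nlinarith

theorem summable_catalan : Summable fun k => (catalan k : ℝ) / 4 ^ k := by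
  refine summable_of_sum_range_le (c := 2) (fun k => by positivity) fun n => ?_
  simp_rw [catalan_div_four_pow]
  rw [← Finset.mul_sum, Finset.sum_range_sub']
  have : (0 : ℝ) ≤ n.centralBinom / 4 ^ n := by positivity
  simp
  linarith

theorem sum_catalan_mul (m : ℕ) :
    ∑ ij ∈ Finset.HasAntidiagonal.antidiagonal m, (catalan ij.1 : ℝ) * catalan ij.2 =
      catalan (m + 1) := by
  rw [catalan_succ']
  push_cast
  rfl

theorem sum_catalan_mul_succ (m : ℕ) :
    ∑ ij ∈ Finset.HasAntidiagonal.antidiagonal m, (catalan ij.1 : ℝ) * catalan (ij.2 + 1) =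
      catalan (m + 2) - catalan (m + 1) := by
  have h := sum_catalan_mul (m + 1)
  rw [Finset.Nat.sum_antidiagonal_succ'] at h
  simp only [catalan_zero, Nat.cast_one, mul_one] at h
  linarith

theorem sum_catalan_succ_mul (m : ℕ) :
    ∑ ij ∈ Finset.HasAntidiagonal.antidiagonal m, (catalan (ij.1 + 1) : ℝ) * catalan ij.2 =
      catalan (m + 2) - catalan (m + 1) := by
  have h := sum_catalan_mul (m + 1)
  rw [Finset.Nat.sum_antidiagonal_succ] at h
  simp only [catalan_zero, Nat.cast_one, one_mul] at h
  linarith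

theorem sum_catalan_succ_mul_succ (m : ℕ) :
    ∑ ij ∈ Finset.HasAntidiagonal.antidiagonal m, (catalan (ij.1 + 1) : ℝ) * catalan (ij.2 + 1) =
      catalan (m + 3) - 2 * catalan (m + 2) := by
  have h := sum_catalan_succ_mul (m + 1)
  rw [Finset.Nat.sum_antidiagonal_succ'] at h
  simp only [catalan_zero, Nat.cast_one, mul_one] at h
  linarith

end Catalan

section Solution

variable {θ : ℝ}

theorem tutteSol_nonneg (h0 : 0 < θ) (h1 : θ ≤ 1 / 6) (k : ℕ) : 0 ≤ tutteSol θ k := by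
  have hc : 0 < 1 - 2 * θ := by linarith
  have hC : (0 : ℝ) ≤ catalan k := Nat.cast_nonneg _
  refine mul_nonneg (by positivity) ?_
  rw [sub_nonneg, div_le_div_iff₀ (by positivity) hc]
  have h := mul_le_mul_of_nonneg_left (catalan_succ_le k) h0.le
  have h2 : θ * (4 * catalan k) ≤ catalan k * (1 - 2 * θ) := by nlinarith
  calc θ * catalan (k + 1) * (1 - 2 * θ) ≤ catalan k * (1 - 2 * θ) * (1 - 2 * θ) :=
        mul_le_mul_of_nonneg_right (h.trans h2) hc.le
    _ = _ := by ring

theorem tutteSol_zero (h1 : θ ≤ 1 / 6) :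
    tutteSol θ 0 = 1 + θ * (1 - 2 * θ) ^ 2 * tutteSol θ 1 := by
  have hc : 1 - 2 * θ ≠ 0 := by linarith
  simp only [tutteSol, catalan_zero, catalan_one, zero_add, one_add_one_eq_two, catalan_two]
  field_simp
  push_cast
  ring

theorem tutteSol_zero_eq (h1 : θ ≤ 1 / 6) : tutteSol θ 0 = (1 - 3 * θ) / (1 - 2 * θ) ^ 2 := by
  have hc : 1 - 2 * θ ≠ 0 := by linarith
  simp only [tutteSol, catalan_zero, catalan_one, zero_add]
  field_simp
  push_cast
  ring

/-- Together with `tutteSol_zero`: `tutteSol θ` solves Tutte's equation. -/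
theorem tutteSol_succ (h1 : θ ≤ 1 / 6) (m : ℕ) :
    tutteSol θ (m + 1) = θ * (1 - 2 * θ) ^ 2 * tutteSol θ (m + 2) +
      ∑ ij ∈ Finset.HasAntidiagonal.antidiagonal m, tutteSol θ ij.1 * tutteSol θ ij.2 := by
  have hc : 1 - 2 * θ ≠ 0 := by linarith
  have hs : ∑ ij ∈ Finset.HasAntidiagonal.antidiagonal m, tutteSol θ ij.1 * tutteSol θ ij.2 =
      ∑ ij ∈ Finset.HasAntidiagonal.antidiagonal m,
        ((1 / (1 - 2 * θ) ^ 2) ^ m / (1 - 2 * θ) ^ 2 * ((catalan ij.1 : ℝ) * catalan ij.2)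
        - (1 / (1 - 2 * θ) ^ 2) ^ m * θ / (1 - 2 * θ) ^ 3 *
            ((catalan ij.1 : ℝ) * catalan (ij.2 + 1))
        - (1 / (1 - 2 * θ) ^ 2) ^ m * θ / (1 - 2 * θ) ^ 3 *
            ((catalan (ij.1 + 1) : ℝ) * catalan ij.2)
        + (1 / (1 - 2 * θ) ^ 2) ^ m * θ ^ 2 / (1 - 2 * θ) ^ 4 *
            ((catalan (ij.1 + 1) : ℝ) * catalan (ij.2 + 1))) := by
    refine Finset.sum_congr rfl fun ij hij => ?_
    rw [← Finset.HasAntidiagonal.mem_antidiagonal.1 hij, pow_add]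
    simp only [tutteSol]
    field_simp
    ring
  rw [hs]
  simp only [Finset.sum_add_distrib, Finset.sum_sub_distrib, ← Finset.mul_sum, sum_catalan_mul,
    sum_catalan_mul_succ, sum_catalan_succ_mul, sum_catalan_succ_mul_succ]
  simp only [tutteSol]
  rw [pow_succ _ (m + 1), pow_succ]
  generalize (1 / (1 - 2 * θ) ^ 2) ^ m = u
  generalize (catalan (m + 1) : ℝ) = c1
  rw [show m + 1 + 1 = m + 2 from rfl, show m + 2 + 1 = m + 3 from rfl]
  generalize (catalan (m + 2) : ℝ) = c2
  generalize (catalan (m + 3) : ℝ) = c3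
  field_simp
  ring

theorem tutteSol_mul_pow_le (h0 : 0 < θ) (h1 : θ ≤ 1 / 6) (k : ℕ) :
    tutteSol θ k * (θ * (1 - 2 * θ)) ^ k ≤ 1 / (1 - 2 * θ) * (catalan k / 4 ^ k) := by
  have hc : 0 < 1 - 2 * θ := by linarith
  have hC : (0 : ℝ) ≤ catalan k := Nat.cast_nonneg _
  have hC' : (0 : ℝ) ≤ catalan (k + 1) := Nat.cast_nonneg _
  have e : tutteSol θ k * (θ * (1 - 2 * θ)) ^ k =
      (θ / (1 - 2 * θ)) ^ k *
        (catalan k / (1 - 2 * θ) - θ * catalan (k + 1) / (1 - 2 * θ) ^ 2) := by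
    rw [tutteSol, mul_right_comm, ← mul_pow]
    congr 2
    field_simp
  have e2 : 1 / (1 - 2 * θ) * (catalan k / 4 ^ k) = (1 / 4) ^ k * (catalan k / (1 - 2 * θ)) := by
    rw [div_pow, one_pow]
    ring
  rw [e, e2]
  have h4 : θ / (1 - 2 * θ) ≤ 1 / 4 := by
    rw [div_le_div_iff₀ hc (by norm_num)]
    linarith
  have h5 : θ * catalan (k + 1) / (1 - 2 * θ) ^ 2 ≥ 0 := by positivity
  calc _ ≤ (θ / (1 - 2 * θ)) ^ k * (catalan k / (1 - 2 * θ)) := by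
        gcongr
        linarith
    _ ≤ _ := by gcongr

end Solution

namespace PlanarMap

theorem genFun_eq_zero {x : ℝ≥0∞} {p : ℕ} (hp : p < 2) : genFun x p = 0 := by
  have : IsEmpty (typeII p) := ⟨fun c => absurd (two_le_of_mem_typeII c.2) (by omega)⟩
  exact tsum_empty

theorem genFunLT_eq_zero {x : ℝ≥0∞} {n p : ℕ} (hp : p < 2) : genFunLT x n p = 0 := by
  have : IsEmpty (typeII p) := ⟨fun c => absurd (two_le_of_mem_typeII c.2) (by omega)⟩
  exact tsum_empty

theorem sum_antidiagonal_three {f : ℕ → ℝ≥0∞} (h : ∀ p < 2, f p = 0) :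
    ∑ ij ∈ Finset.HasAntidiagonal.antidiagonal 3, f ij.1 * f ij.2 = 0 := by
  refine Finset.sum_eq_zero fun ij hij => ?_
  rcases lt_or_ge ij.1 2 with h1 | h1
  · rw [h _ h1, zero_mul]
  · rw [h ij.2 (by have := Finset.HasAntidiagonal.mem_antidiagonal.1 hij; omega), mul_zero]

theorem sum_antidiagonal_add_four {f : ℕ → ℝ≥0∞} (h : ∀ p < 2, f p = 0) (m : ℕ) :
    ∑ ij ∈ Finset.HasAntidiagonal.antidiagonal (m + 4), f ij.1 * f ij.2 =
      ∑ ij ∈ Finset.HasAntidiagonal.antidiagonal m, f (ij.1 + 2) * f (ij.2 + 2) := by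
  rw [Finset.Nat.sum_antidiagonal_succ, Finset.Nat.sum_antidiagonal_succ,
    Finset.Nat.sum_antidiagonal_succ', Finset.Nat.sum_antidiagonal_succ']
  simp [h]

variable {θ : ℝ}

/-- The generating functions are the smallest nonnegative solution of Tutte's equation; the proof is
by induction on the truncation. -/
theorem genFunLT_le_tutteSol (h0 : 0 < θ) (h1 : θ ≤ 1 / 6) (n k : ℕ) :
    genFunLT (ENNReal.ofReal (θ * (1 - 2 * θ) ^ 2)) n (k + 2) ≤ ENNReal.ofReal (tutteSol θ k) := by
  have hc : 0 < 1 - 2 * θ := by linarith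
  have hx : 0 < θ * (1 - 2 * θ) ^ 2 := by positivity
  induction n generalizing k with
  | zero => simp [genFunLT]
  | succ n ih =>
    refine (genFunLT_succ_le (by simpa using hx) ENNReal.ofReal_ne_top n (by omega)).trans ?_
    rcases k with _ | m
    · rw [if_pos rfl, sum_antidiagonal_three fun p hp => genFunLT_eq_zero hp, add_zero,
        tutteSol_zero h1, ENNReal.ofReal_add zero_le_one
          (mul_nonneg hx.le (tutteSol_nonneg h0 h1 _)),
        ENNReal.ofReal_one, ENNReal.ofReal_mul hx.le]
      gcongr
      exact ih 1
    · rw [if_neg (by omega), zero_add, show m + 1 + 2 + 1 = m + 4 from rfl,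
        sum_antidiagonal_add_four fun p hp => genFunLT_eq_zero hp, tutteSol_succ h1,
        ENNReal.ofReal_add (mul_nonneg hx.le (tutteSol_nonneg h0 h1 _))
          (Finset.sum_nonneg fun _ _ => mul_nonneg (tutteSol_nonneg h0 h1 _)
            (tutteSol_nonneg h0 h1 _)),
        ENNReal.ofReal_mul hx.le, ENNReal.ofReal_sum_of_nonneg fun _ _ =>
          mul_nonneg (tutteSol_nonneg h0 h1 _) (tutteSol_nonneg h0 h1 _)]
      refine add_le_add (mul_le_mul_right (ih (m + 2)) _) (Finset.sum_le_sum fun ij _ => ?_)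
      rw [ENNReal.ofReal_mul (tutteSol_nonneg h0 h1 _)]
      exact mul_le_mul' (ih _) (ih _)

theorem genFun_le_tutteSol (h0 : 0 < θ) (h1 : θ ≤ 1 / 6) (k : ℕ) :
    genFun (ENNReal.ofReal (θ * (1 - 2 * θ) ^ 2)) (k + 2) ≤ ENNReal.ofReal (tutteSol θ k) :=
  genFun_le fun n => genFunLT_le_tutteSol h0 h1 n k

/-- The upper bound comes from the minimality of `genFun` among the solutions of the recursion. The
lower bound is the nonnegativity of the discriminant of the quadratic equation satisfied by the
generating function over the perimeter, at the point `θ * (1 - 2 * θ)` where it still converges. -/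
theorem genFun_two (h0 : 0 < θ) (h1 : θ ≤ 1 / 6) :
    genFun (ENNReal.ofReal (θ * (1 - 2 * θ) ^ 2)) 2 =
      ENNReal.ofReal ((1 - 3 * θ) / (1 - 2 * θ) ^ 2) := by
  have hc : 0 < 1 - 2 * θ := by linarith
  have hx : 0 < θ * (1 - 2 * θ) ^ 2 := by positivity
  have hup := genFun_le_tutteSol h0 h1
  set x := ENNReal.ofReal (θ * (1 - 2 * θ) ^ 2) with hxd
  have hx0 : x ≠ 0 := by simpa [hxd] using hx
  have hfin : ∀ k, genFun x (k + 2) ≠ ∞ := fun k =>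
    ne_top_of_le_ne_top ENNReal.ofReal_ne_top (hup k)
  set A : ℕ → ℝ := fun k => (genFun x (k + 2)).toReal with hA
  have hA0 : ∀ k, 0 ≤ A k := fun k => ENNReal.toReal_nonneg
  have hAz : ∀ k, A k ≤ tutteSol θ k := fun k =>
    ENNReal.toReal_le_of_le_ofReal (tutteSol_nonneg h0 h1 k) (hup k)
  have hr0 : A 0 = 1 + θ * (1 - 2 * θ) ^ 2 * A 1 := by
    simp only [hA]
    rw [genFun_eq hx0 ENNReal.ofReal_ne_top le_rfl, if_pos rfl,
      sum_antidiagonal_three fun p hp => genFun_eq_zero hp, add_zero,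
      ENNReal.toReal_add ENNReal.one_ne_top (ENNReal.mul_ne_top ENNReal.ofReal_ne_top (hfin 1)),
      ENNReal.toReal_mul, ENNReal.toReal_ofReal hx.le, ENNReal.toReal_one]
  have hr : ∀ m, A (m + 1) = θ * (1 - 2 * θ) ^ 2 * A (m + 2) +
      ∑ ij ∈ Finset.HasAntidiagonal.antidiagonal m, A ij.1 * A ij.2 := by
    intro m
    simp only [hA]
    rw [genFun_eq hx0 ENNReal.ofReal_ne_top (by omega), if_neg (by omega), zero_add,
      show m + 1 + 2 + 1 = m + 4 from rfl,
      sum_antidiagonal_add_four fun p hp => genFun_eq_zero hp,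
      ENNReal.toReal_add (ENNReal.mul_ne_top ENNReal.ofReal_ne_top (hfin (m + 2)))
        (ENNReal.sum_ne_top.2 fun ij _ => ENNReal.mul_ne_top (hfin _) (hfin _)),
      ENNReal.toReal_mul, ENNReal.toReal_ofReal hx.le,
      ENNReal.toReal_sum fun ij _ => ENNReal.mul_ne_top (hfin _) (hfin _)]
    simp only [ENNReal.toReal_mul]
  set y := θ * (1 - 2 * θ) with hy
  have hy0 : 0 < y := by positivity
  have hs : Summable fun k => A k * y ^ k := by
    refine Summable.of_nonneg_of_le (fun k => mul_nonneg (hA0 k) (by positivity)) (fun k => ?_)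
      (summable_catalan.mul_left (1 / (1 - 2 * θ)))
    exact (mul_le_mul_of_nonneg_right (hAz k) (by positivity)).trans (tutteSol_mul_pow_le h0 h1 k)
  have hnorm : Summable fun k => ‖A k * y ^ k‖ := hs.abs
  have hs1 : Summable fun k => A (k + 1) * y ^ k := by
    have := ((summable_nat_add_iff 1).2 hs).mul_left y⁻¹
    refine this.congr fun k => ?_
    rw [pow_succ]
    field_simp
  have hs2 : Summable fun k => A (k + 2) * y ^ k := by
    have := ((summable_nat_add_iff 2).2 hs).mul_left (y ^ 2)⁻¹
    refine this.congr fun k => ?_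
    rw [pow_add]
    field_simp
  set F := ∑' k, A k * y ^ k with hF
  have hmul := tsum_mul_tsum_eq_tsum_sum_antidiagonal_of_summable_norm hnorm hnorm
  have hprod := summable_norm_sum_mul_antidiagonal_of_summable_norm hnorm hnorm
  have e1 : F = A 0 + y * ∑' k, A (k + 1) * y ^ k := by
    rw [hF, hs.tsum_eq_zero_add, pow_zero, mul_one, ← tsum_mul_left]
    congr 1
    exact tsum_congr fun k => by ring
  have e2 : ∑' k, A (k + 1) * y ^ k = A 1 + y * ∑' k, A (k + 2) * y ^ k := by
    rw [hs1.tsum_eq_zero_add, pow_zero, mul_one, ← tsum_mul_left]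
    congr 1
    exact tsum_congr fun k => by ring
  have e3 : ∑' k, A (k + 1) * y ^ k = θ * (1 - 2 * θ) ^ 2 * ∑' k, A (k + 2) * y ^ k + F * F := by
    rw [hmul, ← tsum_mul_left, ← (hs2.mul_left _).tsum_add hprod.of_norm]
    refine tsum_congr fun k => ?_
    rw [hr k, add_mul, Finset.sum_mul]
    congr 1
    · ring
    · refine Finset.sum_congr rfl fun ij hij => ?_
      rw [← Finset.HasAntidiagonal.mem_antidiagonal.1 hij, pow_add]
      ring
  set G := ∑' k, A (k + 1) * y ^ k
  set H := ∑' k, A (k + 2) * y ^ k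
  set X := θ * (1 - 2 * θ) ^ 2 with hX
  have hquad : y ^ 2 * (F * F) + (-(y - X)) * F + (y - X * A 0) = 0 := by
    linear_combination -y ^ 2 * e3 + (X - y) * e1 + X * y * e2 - y * hr0
  -- the discriminant factors, and its sign gives a lower bound for `A 0`
  have hdisc := discrim_eq_sq_of_quadratic_eq_zero hquad
  rw [discrim] at hdisc
  have hsq := sq_nonneg (2 * y ^ 2 * F + -(y - X))
  rw [← hdisc, hX, hy] at hsq
  have hfac : 4 * (θ * (1 - 2 * θ)) ^ 2 * ((1 - 2 * θ) ^ 2 * A 0 * θ - (1 - 3 * θ) * θ) ≥ 0 := by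
    linear_combination hsq
  have h6 : (1 - 2 * θ) ^ 2 * A 0 * θ - (1 - 3 * θ) * θ ≥ 0 := by
    by_contra hneg
    push Not at hneg
    have : 0 < 4 * (θ * (1 - 2 * θ)) ^ 2 := by positivity
    nlinarith
  have h7 : (1 - 3 * θ) / (1 - 2 * θ) ^ 2 ≤ A 0 := by
    rw [div_le_iff₀ (by positivity)]
    refine le_of_mul_le_mul_right ?_ h0
    linarith
  have h8 := hAz 0
  rw [tutteSol_zero_eq h1] at h8
  rw [← ENNReal.ofReal_toReal (hfin 0)]
  exact congrArg _ (le_antisymm h8 h7)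

end PlanarMap

/-! ### Triangulations of the 2-gon at the critical weight -/

/-- Euler's formula for triangulations of the `p`-gon. -/
theorem CombMap.IsTri.card_edges {D : Type} [Finite D] {N : CombMap D} {r : D} {p : ℕ}
    (h : N.IsTri r p) : numCycles N.flip + p + 3 = 3 * numCycles N.rot := by
  classical
  have := Fintype.ofFinite (Quotient (SameCycle.setoid N.face))
  have h1 := card_eq_sum_card_cycles N.face
  rw [← Finset.add_sum_erase _ _ (Finset.mem_univ (Quotient.mk (SameCycle.setoid N.face) r)),
    Finset.sum_congr rfl (g := fun _ => 3), Finset.sum_const, Finset.card_erase_of_mem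
      (Finset.mem_univ _), Finset.card_univ] at h1
  · have h2 :
        Nat.card {y // N.face.SameCycle (Quotient.mk (SameCycle.setoid N.face) r).out y} = p := by
      rw [← h.root_deg]
      have : N.face.SameCycle (Quotient.mk (SameCycle.setoid N.face) r).out r :=
        Quotient.mk_out (s := SameCycle.setoid N.face) r
      exact Nat.card_congr (Equiv.subtypeEquivRight fun y =>
        ⟨fun k => this.symm.trans k, fun k => this.trans k⟩)
    have h3 := h.planar.euler
    have h4 := N.card_eq
    have h5 : 0 < numCycles N.face := by
      rw [numCycles]
      have : Nonempty (Quotient (SameCycle.setoid N.face)) := ⟨Quotient.mk _ r⟩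
      exact Nat.card_pos
    have h6 : Fintype.card (Quotient (SameCycle.setoid N.face)) = numCycles N.face :=
      Nat.card_eq_fintype_card.symm
    rw [h2, h6, smul_eq_mul] at h1
    omega
  · intro q hq
    refine h.other_deg _ fun k => (Finset.mem_erase.1 hq).1 ?_
    rw [← q.out_eq]
    exact (Quotient.sound k).symm

namespace PlanarMap

theorem card_edges {c : PlanarMap} {p : ℕ} (hc : c ∈ typeII p) :
    c.numEdges + p + 3 = 3 * c.numVertices := by
  obtain ⟨n, N, x, hN, rfl⟩ := CombMap.exists_eq_cls c
  rw [CombMap.cls_mem_typeII hN] at hc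
  rw [CombMap.numVertices_cls hN, CombMap.numEdges_cls hN]
  exact hc.1.card_edges

theorem typeII_nonempty {p : ℕ} (hp : 2 ≤ p) : (typeII p).Nonempty := by
  induction p, hp using Nat.le_induction with
  | base => exact ⟨edge, edge_mem_typeII_iff.2 rfl⟩
  | succ p hp ih =>
    obtain ⟨c, hc⟩ := ih
    have h := (join_mem hc (edge_mem_typeII_iff.2 rfl)).1
    exact ⟨_, ((addEdge_bijOn (p := p + 1) (by omega)).mapsTo h).1⟩

theorem two_le_numVertices (c : typeII 2) : 2 ≤ c.1.numVertices := by
  have := card_edges c.2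
  omega

theorem hasSum_digon_of_le {θ : ℝ} (h0 : 0 < θ) (h1 : θ ≤ 1 / 6) :
    HasSum (fun c : typeII 2 => (θ * (1 - 2 * θ) ^ 2) ^ (c.1.numVertices - 2))
      ((1 - 3 * θ) / (1 - 2 * θ) ^ 2) := by
  have hc : 0 < 1 - 2 * θ := by linarith
  have hx : 0 < θ * (1 - 2 * θ) ^ 2 := by positivity
  have h := genFun_two h0 h1
  set x := θ * (1 - 2 * θ) ^ 2
  have h2 : ∀ c : typeII 2, ENNReal.ofReal x ^ c.1.numVertices * (ENNReal.ofReal x)⁻¹ ^ 2 =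
      ENNReal.ofReal (x ^ (c.1.numVertices - 2)) := by
    intro c
    rw [ENNReal.ofReal_pow hx.le]
    obtain ⟨k, hk⟩ := Nat.exists_eq_add_of_le' (two_le_numVertices c)
    rw [hk, Nat.add_sub_cancel, pow_add, mul_assoc, ← mul_pow, ENNReal.mul_inv_cancel
      (by simpa using hx) ENNReal.ofReal_ne_top, one_pow, mul_one]
  rw [genFun, tsum_congr h2] at h
  have h3 : Summable fun c : typeII 2 => x ^ (c.1.numVertices - 2) := by
    refine ENNReal.summable_toReal (h ▸ ENNReal.ofReal_ne_top) |>.congr fun c => ?_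
    exact ENNReal.toReal_ofReal (by positivity)
  rw [← ENNReal.ofReal_tsum_of_nonneg (fun c => by positivity) h3] at h
  have h4 := (ENNReal.ofReal_eq_ofReal_iff (tsum_nonneg fun c => by positivity)
    (div_nonneg (by linarith) (by positivity))).1 h
  exact h4 ▸ h3.hasSum

theorem hasSum_digon :
    HasSum (fun c : typeII 2 => (2 / 27 : ℝ) ^ (c.1.numVertices - 2)) (9 / 8) := by
  have h := hasSum_digon_of_le (θ := 1 / 6) (by norm_num) le_rfl
  norm_num at h
  exact h

/-- The derivative of the generating function of digons at its singularity, computed as the limit of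
difference quotients, which are parametrized by `c = 1 - 2 * θ`. -/
theorem hasSum_digon_mul :
    HasSum (fun c : typeII 2 => ((c.1.numVertices - 2 : ℕ) : ℝ) *
      (2 / 27 : ℝ) ^ (c.1.numVertices - 2 - 1)) (81 / 16) := by
  let n : typeII 2 → ℕ := fun c => c.1.numVertices - 2
  let X : ℝ → ℝ := fun c => (1 - c) * c ^ 2 / 2
  -- `q c k` is the difference quotient of `t ↦ t ^ k` between `X c` and `2 / 27 = X (2 / 3)`
  let q : ℝ → ℕ → ℝ := fun c k => ∑ i ∈ Finset.range k, (2 / 27 : ℝ) ^ i * X c ^ (k - 1 - i)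
  have hX : ∀ c : ℝ, 2 / 27 - X c = (3 * c - 2) ^ 2 * (3 * c + 1) / 54 := fun c => by
    simp only [X]; ring
  have hq : ∀ c : ℝ, 2 / 3 < c → c < 1 →
      HasSum (fun d => q c (n d)) (27 / (4 * c ^ 2 * (3 * c + 1))) := by
    intro c h1 h2
    have hs := hasSum_digon_of_le (θ := (1 - c) / 2) (by linarith) (by linarith)
    have hXc : (1 - c) / 2 * (1 - 2 * ((1 - c) / 2)) ^ 2 = X c := by simp only [X]; ring
    rw [hXc] at hs
    have hpos : 0 < 2 / 27 - X c := by
      rw [hX]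
      have : 0 < 3 * c - 2 := by linarith
      have : 0 < 3 * c + 1 := by linarith
      positivity
    have := (hasSum_digon.sub hs).div_const (2 / 27 - X c)
    have hv : (9 / 8 - (1 - 3 * ((1 - c) / 2)) / (1 - 2 * ((1 - c) / 2)) ^ 2) / (2 / 27 - X c) =
        27 / (4 * c ^ 2 * (3 * c + 1)) := by
      have e1 : 3 * c - 2 ≠ 0 := by linarith
      have e2 : 3 * c + 1 ≠ 0 := by linarith
      have e3 : c ≠ 0 := by linarith
      rw [hX, show 1 - 2 * ((1 - c) / 2) = c by ring]
      field_simp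
      ring
    rw [hv] at this
    refine Eq.mp (congrArg (fun f => HasSum f _) (funext fun d => ?_)) this
    rw [div_eq_iff hpos.ne']
    exact (geom_sum₂_mul _ _ _).symm
  have hq0 : ∀ k, q (2 / 3) k = k * (2 / 27 : ℝ) ^ (k - 1) := by
    intro k
    have : X (2 / 3) = 2 / 27 := by simp only [X]; norm_num
    simp only [q, this]
    rw [Finset.sum_congr rfl (g := fun _ => (2 / 27 : ℝ) ^ (k - 1)), Finset.sum_const,
      Finset.card_range, nsmul_eq_mul]
    intro i hi
    rw [← pow_add]
    congr 1
    have := Finset.mem_range.1 hi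
    omega
  have hle : ∀ c : ℝ, 2 / 3 < c → c < 1 → ∀ k, q c k ≤ q (2 / 3) k := by
    intro c h1 h2 k
    refine Finset.sum_le_sum fun i _ => ?_
    have h3 : 0 ≤ X c := by
      simp only [X]
      have : 0 < 1 - c := by linarith
      positivity
    have h4 : X c ≤ X (2 / 3) := by
      have h5 := hX c
      have h6 : X (2 / 3) = 2 / 27 := by simp only [X]; norm_num
      have : 0 ≤ (3 * c - 2) ^ 2 * (3 * c + 1) / 54 := by
        have : 0 < 3 * c + 1 := by linarith
        positivity
      linarith
    gcongr
  have hev : ∀ᶠ c : ℝ in 𝓝[>] (2 / 3), 2 / 3 < c ∧ c < 1 :=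
    Ioo_mem_nhdsGT (by norm_num : (2 / 3 : ℝ) < 1)
  have hlim :
      Tendsto (fun c : ℝ => 27 / (4 * c ^ 2 * (3 * c + 1))) (𝓝[>] (2 / 3)) (𝓝 (81 / 16)) := by
    have : ContinuousAt (fun c : ℝ => 27 / (4 * c ^ 2 * (3 * c + 1))) (2 / 3) := by
      refine ContinuousAt.div (by fun_prop) (by fun_prop) (by norm_num)
    have h := this.tendsto.mono_left (nhdsWithin_le_nhds (s := Set.Ioi (2 / 3)))
    norm_num at h ⊢
    exact h
  have hqlim : ∀ k, Tendsto (fun c => q c k) (𝓝[>] (2 / 3)) (𝓝 (q (2 / 3) k)) := by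
    intro k
    have : Continuous fun c => q c k := by
      simp only [q, X]
      fun_prop
    exact (this.tendsto _).mono_left nhdsWithin_le_nhds
  have hqnn : ∀ k, 0 ≤ q (2 / 3) k := fun k => by rw [hq0]; positivity
  have hup : ∀ s : Finset (typeII 2), ∑ d ∈ s, q (2 / 3) (n d) ≤ 81 / 16 := by
    intro s
    refine le_of_tendsto_of_tendsto (tendsto_finsetSum s fun d _ => hqlim (n d)) hlim ?_
    filter_upwards [hev] with c hc
    refine sum_le_hasSum s (fun d _ => ?_) (hq c hc.1 hc.2)
    refine Finset.sum_nonneg fun i _ => ?_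
    have : 0 < 1 - c := by linarith [hc.2]
    simp only [X]
    positivity
  have hsum : Summable fun d => q (2 / 3) (n d) :=
    summable_of_sum_le (fun d => hqnn _) hup
  have hlow : 81 / 16 ≤ ∑' d, q (2 / 3) (n d) := by
    refine le_of_tendsto hlim ?_
    filter_upwards [hev] with c hc
    exact hasSum_le (fun d => hle c hc.1 hc.2 _) (hq c hc.1 hc.2) hsum.hasSum
  have hval : ∑' d, q (2 / 3) (n d) = 81 / 16 :=
    le_antisymm (hsum.tsum_le_of_sum_le hup) hlow
  have := hval ▸ hsum.hasSum
  simpa only [hq0] using this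

/-- A triangulation of the 2-gon with `n` inner vertices has `3 * n + 1` edges. -/
theorem hasSum_digon_numEdges :
    HasSum (fun c : typeII 2 => (c.1.numEdges : ℝ) * (2 / 27 : ℝ) ^ (c.1.numVertices - 2))
      (9 / 4) := by
  have h := (hasSum_digon_mul.mul_left (3 * (2 / 27))).add hasSum_digon
  norm_num at h
  refine Eq.mp (congrArg (fun f => HasSum f _) (funext fun c => ?_)) h
  have h1 := card_edges c.2
  obtain ⟨k, hk⟩ := Nat.exists_eq_add_of_le' (two_le_numVertices c)
  have h2 : c.1.numEdges = 3 * k + 1 := by omega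
  rw [hk, h2, Nat.add_sub_cancel]
  rcases k with _ | k
  · simp
  · rw [Nat.add_sub_cancel]
    push_cast
    ring

theorem tsum_typeII_ne_top {p : ℕ} (hp : 2 ≤ p) :
    ∑' c : typeII p, (2 / 27 : ℝ≥0∞) ^ c.1.numVertices ≠ ∞ := by
  obtain ⟨k, rfl⟩ := Nat.exists_eq_add_of_le' hp
  have h := genFun_le_tutteSol (θ := 1 / 6) (by norm_num) le_rfl k
  have hx : ENNReal.ofReal (1 / 6 * (1 - 2 * (1 / 6)) ^ 2) = 2 / 27 := by
    rw [show (1 / 6 * (1 - 2 * (1 / 6)) ^ 2 : ℝ) = 2 / 27 by norm_num,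
      ENNReal.ofReal_div_of_pos (by norm_num)]
    norm_num
  rw [hx, genFun, ENNReal.tsum_mul_right] at h
  intro htop
  rw [htop, ENNReal.top_mul] at h
  · exact ENNReal.ofReal_ne_top (top_le_iff.1 h)
  · refine pow_ne_zero _ (ENNReal.inv_ne_zero.2 ?_)
    exact ENNReal.div_ne_top (by norm_num) (by norm_num)

end PlanarMap

/-! ### Merging cycles of a permutation -/

namespace Equiv.Perm

variable {D D' ι : Type}

theorem numCycles_eq_sum [Finite D] [Fintype ι] (π : Perm D) (f : D → ι)
    (h : ∀ q x, π x ∈ {x | f x = q} ↔ x ∈ {x | f x = q}) :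
    numCycles π = ∑ q, numCycles (π.subtypePerm (h q)) := by
  have hf : ∀ x y, π.SameCycle x y → f x = f y := by
    intro x y hxy
    exact (hxy.mem_of_mapsTo (A := {y | f y = f x}) (fun z hz => (h _ z).2 hz) rfl).symm
  let P : Quotient (SameCycle.setoid π) → ι := Quotient.lift f hf
  have h1 : numCycles π = ∑ q, Nat.card {c // P c = q} := by
    rw [numCycles, Nat.card_congr (Equiv.sigmaFiberEquiv P).symm, Nat.card_sigma]
  rw [h1]
  refine Finset.sum_congr rfl fun q _ => ?_
  let g : {x | f x = q} → {c // P c = q} := fun x => ⟨Quotient.mk _ x.1, x.2⟩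
  have hg : Function.Surjective g := by
    rintro ⟨c, hc⟩
    induction c using Quotient.inductionOn with
    | h x => exact ⟨⟨x, hc⟩, rfl⟩
  have hker : SameCycle.setoid (π.subtypePerm (h q)) = Setoid.ker g := by
    ext x y
    rw [Setoid.ker_def, setoid_apply, ← sameCycle_map_iff (g := ((↑) : {x | f x = q} → D))
      Subtype.val_injective (π' := π) fun _ _ => rfl, Subtype.ext_iff]
    exact ⟨fun k => Quotient.sound k, fun k => Quotient.exact k⟩
  rw [numCycles, hker]
  exact (Nat.card_congr (Setoid.quotientKerEquivOfSurjective g hg)).symm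

section Merge

variable [Finite D] [Finite D'] {ρ : Perm D} {side : D' ↪ D} {s : Perm D'}

theorem sameCycle_viaEmbedding_mul_side
    (h : ∀ d d', ρ.SameCycle (side d) (side d') → d = d') {d d' : D'} (hs : s.SameCycle d d') :
    (s.viaEmbedding side * ρ).SameCycle (side d) (side d') := by
  set π := s.viaEmbedding side * ρ with hπ
  have key : ∀ d, π.SameCycle (side d) (side (s d)) := by
    intro d
    by_contra hn
    have hlast : π (ρ⁻¹ (side d)) = side (s d) := by
      rw [hπ, mul_apply, ← mul_apply ρ, mul_inv_cancel, one_apply, viaEmbedding_apply]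
    refine hn (hlast ▸ SameCycle.trans ?_ (sameCycle_apply_self π (ρ⁻¹ (side d))))
    have hA : ρ.SameCycle (side d) (ρ⁻¹ (side d)) :=
      SameCycle.symm (by simpa using sameCycle_apply_self ρ (ρ⁻¹ (side d)))
    refine (hA.mem_of_mapsTo (A := {y | ρ.SameCycle (side d) y ∧ π.SameCycle (side d) y}) ?_
      ⟨SameCycle.refl _ _, SameCycle.refl _ _⟩).2
    rintro y ⟨h1, h2⟩
    have h1' := h1.trans (sameCycle_apply_self ρ y)
    refine ⟨h1', ?_⟩
    by_cases hr : ρ y ∈ Set.range side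
    · obtain ⟨e, he⟩ := hr
      obtain rfl := h d e (he ▸ h1')
      rw [← he]
    · have : π y = ρ y := by rw [hπ, mul_apply, viaEmbedding_apply_of_notMem _ _ _ hr]
      rw [← this]
      exact h2.trans (sameCycle_apply_self π y)
  have : SameCycle.setoid s ≤ (SameCycle.setoid π).comap side :=
    setoid_le_iff.2 fun d => key d
  exact this hs

theorem sameCycle_viaEmbedding_mul
    (h : ∀ d d', ρ.SameCycle (side d) (side d') → d = d') {x y : D} (hxy : ρ.SameCycle x y) :
    (s.viaEmbedding side * ρ).SameCycle x y := by
  set π := s.viaEmbedding side * ρ with hπ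
  refine (setoid_le_iff (s := SameCycle.setoid π)).2 (fun z => ?_) hxy
  change π.SameCycle z (ρ z)
  by_cases hr : ρ z ∈ Set.range side
  · obtain ⟨e, he⟩ := hr
    have h1 : π z = side (s e) := by rw [hπ, mul_apply, ← he, viaEmbedding_apply]
    have h2 := sameCycle_viaEmbedding_mul_side h (sameCycle_apply_self s e)
    rw [← hπ, ← h1] at h2
    rw [← he]
    exact (sameCycle_apply_self π z).trans h2.symm
  · have : π z = ρ z := by rw [hπ, mul_apply, viaEmbedding_apply_of_notMem _ _ _ hr]
    exact this ▸ sameCycle_apply_self π z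

theorem sameCycle_viaEmbedding_mul_side_iff
    (h : ∀ d d', ρ.SameCycle (side d) (side d') → d = d') {d : D'} {y : D} :
    (s.viaEmbedding side * ρ).SameCycle (side d) y ↔
      ∃ d', s.SameCycle d d' ∧ ρ.SameCycle (side d') y := by
  constructor
  · intro hy
    refine hy.mem_of_mapsTo (A := {y | ∃ d', s.SameCycle d d' ∧ ρ.SameCycle (side d') y}) ?_
      ⟨d, SameCycle.refl _ _, SameCycle.refl _ _⟩
    rintro z ⟨d', h1, h2⟩
    have h2' := h2.trans (sameCycle_apply_self ρ z)
    rw [mul_apply]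
    by_cases hr : ρ z ∈ Set.range side
    · obtain ⟨e, he⟩ := hr
      obtain rfl := h d' e (he ▸ h2')
      rw [← he, viaEmbedding_apply]
      exact ⟨s d', h1.trans (sameCycle_apply_self _ _), SameCycle.refl _ _⟩
    · rw [viaEmbedding_apply_of_notMem _ _ _ hr]
      exact ⟨d', h1, h2'⟩
  · rintro ⟨d', h1, h2⟩
    exact (sameCycle_viaEmbedding_mul_side h h1).trans (sameCycle_viaEmbedding_mul h h2)

theorem sameCycle_viaEmbedding_mul_iff
    (h : ∀ d d', ρ.SameCycle (side d) (side d') → d = d') {x y : D}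
    (hx : ∀ d, ¬ ρ.SameCycle x (side d)) :
    (s.viaEmbedding side * ρ).SameCycle x y ↔ ρ.SameCycle x y := by
  refine ⟨fun hy => ?_, sameCycle_viaEmbedding_mul h⟩
  refine hy.mem_of_mapsTo (A := {y | ρ.SameCycle x y}) (fun z hz => ?_) (SameCycle.refl _ _)
  have hz' := SameCycle.trans hz (sameCycle_apply_self ρ z)
  rw [mul_apply, viaEmbedding_apply_of_notMem]
  · exact hz'
  · rintro ⟨e, he⟩
    exact hx e (he ▸ hz')

/-- The cycles of `ρ` which contain a marked element `side d`, at most one each, are merged along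
the cycles of `s`. -/
theorem numCycles_viaEmbedding_mul (h : ∀ d d', ρ.SameCycle (side d) (side d') → d = d') :
    numCycles (s.viaEmbedding side * ρ) + Nat.card D' = numCycles ρ + numCycles s := by
  classical
  set π := s.viaEmbedding side * ρ with hπ
  let U := {c : Quotient (SameCycle.setoid ρ) // ∀ d, c ≠ Quotient.mk _ (side d)}
  -- cycles of `ρ`
  have h1 : numCycles ρ = Nat.card D' + Nat.card U := by
    rw [← Nat.card_sum]
    refine (Nat.card_congr (Equiv.ofBijective (Sum.elim (fun d => Quotient.mk _ (side d))
      (fun c : U => c.1)) ⟨?_, fun c => ?_⟩)).symm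
    · rintro (d | c) (d' | c') hc
      · exact congrArg _ (h _ _ (Quotient.exact hc))
      · exact absurd hc.symm (c'.2 d)
      · exact absurd hc (c.2 d')
      · exact congrArg _ (Subtype.ext hc)
    · by_cases hc : ∃ d, c = Quotient.mk _ (side d)
      · obtain ⟨d, rfl⟩ := hc
        exact ⟨Sum.inl d, rfl⟩
      · push Not at hc
        exact ⟨Sum.inr ⟨c, hc⟩, rfl⟩
  -- cycles of `π`
  have h2 : numCycles π = numCycles s + Nat.card U := by
    rw [numCycles, numCycles, ← Nat.card_sum]
    have hle : SameCycle.setoid ρ ≤ SameCycle.setoid π := fun {x y} hxy =>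
      sameCycle_viaEmbedding_mul h hxy
    let g : Quotient (SameCycle.setoid s) → Quotient (SameCycle.setoid π) :=
      Quotient.map side fun a b hab => sameCycle_viaEmbedding_mul_side h hab
    let k : Quotient (SameCycle.setoid ρ) → Quotient (SameCycle.setoid π) :=
      Quotient.map id fun a b hab => hle hab
    refine (Nat.card_congr (Equiv.ofBijective (Sum.elim g (fun c : U => k c.1))
      ⟨?_, fun c => ?_⟩)).symm
    · have hgk : ∀ a (c : U), g a ≠ k c.1 := by
        rintro a ⟨c, hc⟩ hac
        induction a using Quotient.inductionOn with
        | h a =>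
          induction c using Quotient.inductionOn with
          | h c =>
            obtain ⟨d', -, h4⟩ := (sameCycle_viaEmbedding_mul_side_iff h).1
              (show π.SameCycle (side a) c from Quotient.exact hac)
            exact hc d' (Quotient.sound h4.symm)
      rintro (a | c) (a' | c') hc
      · refine congrArg _ ?_
        induction a using Quotient.inductionOn with
        | h a =>
          induction a' using Quotient.inductionOn with
          | h a' =>
            obtain ⟨d', h3, h4⟩ := (sameCycle_viaEmbedding_mul_side_iff h).1
              (show π.SameCycle (side a) (side a') from Quotient.exact hc)
            obtain rfl := h _ _ h4
            exact Quotient.sound h3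
      · exact absurd hc (hgk a c')
      · exact absurd hc.symm (hgk a' c)
      · refine congrArg _ ?_
        obtain ⟨c, hc1⟩ := c
        obtain ⟨c', hc2⟩ := c'
        induction c using Quotient.inductionOn with
        | h c =>
          induction c' using Quotient.inductionOn with
          | h c' =>
            have := (sameCycle_viaEmbedding_mul_iff h fun d hd => hc1 d (Quotient.sound hd)).1
              (show π.SameCycle c c' from Quotient.exact hc)
            exact Subtype.ext (Quotient.sound this)
    · induction c using Quotient.inductionOn with
      | h x =>
        by_cases hx : ∃ d, ρ.SameCycle x (side d)
        · obtain ⟨d, hd⟩ := hx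
          exact ⟨Sum.inl (Quotient.mk _ d), Quotient.sound (hle hd.symm)⟩
        · push Not at hx
          exact ⟨Sum.inr ⟨Quotient.mk _ x, fun d hd => hx d (Quotient.exact hd)⟩, rfl⟩
  omega

end Merge

end Equiv.Perm

/-! ### Insertion of maps into the edges of a map -/

namespace CombMap

variable {D D' : Type}

/-- The edges of a map. -/
abbrev Edge (S : CombMap D) : Type := Quotient (SameCycle.setoid S.flip)

/-- The edge of a dart. -/
def toEdge (S : CombMap D) (d : D) : S.Edge := Quotient.mk _ d

theorem toEdge_flip (S : CombMap D) (d : D) : S.toEdge (S.flip d) = S.toEdge d :=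
  Quotient.sound (sameCycle_apply_self S.flip d).symm

theorem toEdge_eq_iff [Finite D] {S : CombMap D} {d e : D} :
    S.toEdge e = S.toEdge d ↔ e = d ∨ e = S.flip d := by
  constructor
  · intro h
    have h' : S.flip.SameCycle d e := (Quotient.exact h.symm)
    refine h'.mem_of_mapsTo (A := {e | e = d ∨ e = S.flip d}) ?_ (Or.inl rfl)
    rintro z (rfl | rfl)
    · exact Or.inr rfl
    · exact Or.inl (S.flip_flip d)
  · rintro (rfl | rfl)
    · rfl
    · exact S.toEdge_flip d

theorem eq_of_face_eq_of_flip_eq {M N : CombMap D} (h : ∀ x, M.face x = N.face x)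
    (h' : ∀ x, M.flip x = N.flip x) : M = N := by
  cases M
  cases N
  have h1 := Equiv.ext h
  have h2 := Equiv.ext h'
  simp only at h1 h2
  subst h1 h2
  rfl

theorem IsTri.of_sameCycle {N : CombMap D} {r r' : D} {p : ℕ} (h : N.IsTri r p)
    (hr : N.face.SameCycle r r') : N.IsTri r' p where
  planar := h.planar
  root_deg := by
    rw [← h.root_deg]
    exact Nat.card_congr (Equiv.subtypeEquivRight fun y =>
      ⟨fun k => hr.trans k, fun k => hr.symm.trans k⟩)
  other_deg x hx := h.other_deg x fun k => hx (hr.symm.trans k)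
  loopless := h.loopless

/-- The data needed to glue the components of `U` into the edges of `S`: a bijection `part` between
the components of `U` and the edges of `S`, and for every edge of `S` a face of degree 2 of the
corresponding component, whose two darts are in bijection with those of the edge, by `side`. -/
structure Insertion (U : CombMap D) (S : CombMap D') where
  side : D' ↪ D
  part : D → S.Edge
  face_side : ∀ d, U.face (side d) = side (S.flip d)
  part_face : ∀ x, part (U.face x) = part x
  part_flip : ∀ x, part (U.flip x) = part x
  part_side : ∀ d, part (side d) = S.toEdge d
  reach_of_part_eq : ∀ x y, part x = part y → U.reach x y

namespace Insertion

variable {U : CombMap D} {S : CombMap D'} (I : Insertion U S)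

theorem isClosed (q : S.Edge) : U.IsClosed {x | I.part x = q} :=
  ⟨fun x => by rw [Set.mem_ofPred_eq, I.part_face, Set.mem_ofPred_eq],
    fun x => by rw [Set.mem_ofPred_eq, I.part_flip, Set.mem_ofPred_eq]⟩

/-- The component glued into an edge. -/
def comp (q : S.Edge) : CombMap {x | I.part x = q} := U.restrict _ (I.isClosed q)

/-- The darts on the root face of a component. -/
def compRoot (d : D') : {x | I.part x = S.toEdge d} := ⟨I.side d, I.part_side d⟩

/-- The result of the gluing: the vertices of `U` at the origins of the darts `side d` are merged
around the vertices of `S`. -/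
noncomputable def map : CombMap D := U.withFace (S.rot.viaEmbedding I.side * U.face)

theorem map_rot : I.map.rot = S.rot.viaEmbedding I.side * U.rot := withFace_rot _ _

theorem map_flip : I.map.flip = U.flip := rfl

theorem map_face_side (d : D') : I.map.face (I.side d) = I.side (S.face d) := by
  change S.rot.viaEmbedding I.side (U.face (I.side d)) = _
  rw [I.face_side, viaEmbedding_apply, rot_flip]

theorem face_notMem_range {x : D} (hx : x ∉ Set.range I.side) : U.face x ∉ Set.range I.side := by
  rintro ⟨d, hd⟩
  refine hx ⟨S.flip d, U.face.injective ?_⟩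
  rw [I.face_side, S.flip_flip, hd]

theorem map_face_of_notMem {x : D} (hx : x ∉ Set.range I.side) : I.map.face x = U.face x :=
  viaEmbedding_apply_of_notMem _ _ _ (I.face_notMem_range hx)

theorem sameCycle_map_face_of_notMem [Finite D] {x y : D} (hx : x ∉ Set.range I.side) :
    I.map.face.SameCycle x y ↔ U.face.SameCycle x y := by
  constructor
  · intro h
    refine (h.mem_of_mapsTo (A := {y | y ∉ Set.range I.side ∧ U.face.SameCycle x y}) ?_
      ⟨hx, SameCycle.refl _ _⟩).2
    rintro z ⟨h1, h2⟩
    rw [I.map_face_of_notMem h1]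
    exact ⟨I.face_notMem_range h1, h2.trans (sameCycle_apply_self _ _)⟩
  · intro h
    refine (h.mem_of_mapsTo (A := {y | y ∉ Set.range I.side ∧ I.map.face.SameCycle x y}) ?_
      ⟨hx, SameCycle.refl _ _⟩).2
    rintro z ⟨h1, h2⟩
    exact ⟨I.face_notMem_range h1,
      h2.trans (I.map_face_of_notMem h1 ▸ sameCycle_apply_self I.map.face z)⟩

section Finite

variable [Finite D] [Finite D']

omit [Finite D'] in
theorem part_eq_of_reach {x y : D} (h : U.reach x y) : I.part x = I.part y :=
  ((I.isClosed _).mem_of_reach h rfl).symm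

omit [Finite D'] in
theorem part_eq_of_rot {x y : D} (h : U.rot.SameCycle x y) : I.part x = I.part y :=
  I.part_eq_of_reach (reach_of_sameCycle_rot h)

omit [Finite D] in
theorem mem_range_iff {x : D} {d : D'} (h : I.part x = S.toEdge d) :
    x ∈ Set.range I.side ↔ x = I.side d ∨ x = I.side (S.flip d) := by
  constructor
  · rintro ⟨e, rfl⟩
    rw [I.part_side, toEdge_eq_iff] at h
    exact h.imp (congrArg _) (congrArg _)
  · rintro (rfl | rfl) <;> exact Set.mem_range_self _

omit [Finite D'] in
theorem loopless_of_comp (h : ∀ q, (I.comp q).Loopless) : U.Loopless := fun x hx =>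
  h (I.part x) ⟨x, rfl⟩ ((restrict_rot_sameCycle (I.isClosed _)).2 hx)

theorem transversal_of_not (h : ∀ d, ¬ U.rot.SameCycle (I.side d) (I.side (S.flip d))) (d d' : D')
    (hd : U.rot.SameCycle (I.side d) (I.side d')) : d = d' := by
  have h1 := I.part_eq_of_rot hd
  rw [I.part_side, I.part_side, eq_comm, toEdge_eq_iff] at h1
  rcases h1 with rfl | rfl
  · rfl
  · exact absurd hd (h d)

/-- The two darts of the root face of a component have distinct origins. -/
theorem transversal (h : U.Loopless) : ∀ d d', U.rot.SameCycle (I.side d) (I.side d') → d = d' := by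
  refine I.transversal_of_not fun d hd => h (I.side d) ?_
  rw [← I.face_side] at hd
  exact hd.trans (U.sameCycle_rot_flip_face _).symm

/-- If the two darts of the root face of a component had the same origin, then turning around this
vertex, from one of them to the other one, in `U` or in the glued map, would reveal a loop. -/
theorem transversal_of_map (h : I.map.Loopless) :
    ∀ d d', U.rot.SameCycle (I.side d) (I.side d') → d = d' := by
  refine I.transversal_of_not fun d hd => h (I.side d) ?_
  by_contra hn
  have hlast : U.rot (U.flip (I.side d)) = I.side (S.flip d) := by rw [rot_flip, I.face_side]
  have hd' : U.rot.SameCycle (I.side d) (U.flip (I.side d)) :=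
    hd.trans (hlast ▸ (sameCycle_apply_self U.rot (U.flip (I.side d))).symm)
  refine hn (hd'.mem_of_mapsTo
    (A := {y | U.rot.SameCycle (I.side d) y ∧ I.map.rot.SameCycle (I.side d) y}) ?_
    ⟨SameCycle.refl _ _, SameCycle.refl _ _⟩).2
  rintro y ⟨h1, h2⟩
  have h1' := h1.trans (sameCycle_apply_self _ y)
  refine ⟨h1', ?_⟩
  have hp : I.part (U.rot y) = S.toEdge d := by rw [← I.part_eq_of_rot h1', I.part_side]
  by_cases hr : U.rot y ∈ Set.range I.side
  · rcases (I.mem_range_iff hp).1 hr with e | e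
    · rw [e]
    · rw [← hlast] at e
      obtain rfl := U.rot.injective e
      exact absurd h2 hn
  · have : I.map.rot y = U.rot y := by
      rw [map_rot, mul_apply, viaEmbedding_apply_of_notMem _ _ _ hr]
    exact this ▸ h2.trans (sameCycle_apply_self I.map.rot y)

section Transversal

variable (ht : ∀ d d', U.rot.SameCycle (I.side d) (I.side d') → d = d')
include ht

theorem map_rot_of_rot {x y : D} (h : U.rot.SameCycle x y) : I.map.rot.SameCycle x y := by
  rw [map_rot]; exact sameCycle_viaEmbedding_mul ht h

theorem map_rot_side_iff {d : D'} {y : D} : I.map.rot.SameCycle (I.side d) y ↔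
    ∃ d', S.rot.SameCycle d d' ∧ U.rot.SameCycle (I.side d') y := by
  rw [map_rot]; exact sameCycle_viaEmbedding_mul_side_iff ht

theorem map_rot_side_side_iff {d d' : D'} : I.map.rot.SameCycle (I.side d) (I.side d') ↔
    S.rot.SameCycle d d' := by
  rw [I.map_rot_side_iff ht]
  constructor
  · rintro ⟨e, h1, h2⟩
    exact ht _ _ h2 ▸ h1
  · exact fun h => ⟨d', h, SameCycle.refl _ _⟩

theorem map_rot_iff {x y : D} (hx : ∀ d, ¬ U.rot.SameCycle x (I.side d)) :
    I.map.rot.SameCycle x y ↔ U.rot.SameCycle x y := by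
  rw [map_rot]; exact sameCycle_viaEmbedding_mul_iff ht hx

theorem map_numCycles_rot :
    numCycles I.map.rot + 2 * numCycles S.flip = numCycles U.rot + numCycles S.rot := by
  rw [map_rot, ← S.card_eq]; exact numCycles_viaEmbedding_mul ht

end Transversal

omit [Finite D'] in
theorem numCycles_eq_sum [Fintype S.Edge] :
    numCycles U.rot = ∑ q, numCycles (I.comp q).rot ∧
    numCycles U.face = ∑ q, numCycles (I.comp q).face ∧
    numCycles U.flip = ∑ q, numCycles (I.comp q).flip :=
  ⟨Perm.numCycles_eq_sum U.rot I.part fun q _ => ((I.isClosed q).1 _).trans ((I.isClosed q).2 _),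
    Perm.numCycles_eq_sum U.face I.part fun q => (I.isClosed q).1,
    Perm.numCycles_eq_sum U.flip I.part fun q => (I.isClosed q).2⟩

omit [Finite D'] in
/-- The faces of the glued map are those of `S` and those of `U` which are not root faces of
components. -/
theorem map_numCycles_face :
    numCycles I.map.face + numCycles S.flip = numCycles U.face + numCycles S.face := by
  have hM : ∀ x, I.map.face x ∈ Set.range I.side ↔ x ∈ Set.range I.side := by
    intro x
    refine ⟨fun h => ?_, ?_⟩
    · by_contra hx
      rw [I.map_face_of_notMem hx] at h
      exact I.face_notMem_range hx h
    · rintro ⟨d, rfl⟩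
      rw [I.map_face_side]
      exact Set.mem_range_self _
  have hU : ∀ x, U.face x ∈ Set.range I.side ↔ x ∈ Set.range I.side := by
    intro x
    refine ⟨fun h => ?_, ?_⟩
    · by_contra hx
      exact I.face_notMem_range hx h
    · rintro ⟨d, rfl⟩
      rw [I.face_side]
      exact Set.mem_range_self _
  have h1 := numCycles_subtypePerm_add I.map.face (Set.range I.side) hM fun x => not_congr (hM x)
  have h2 := numCycles_subtypePerm_add U.face (Set.range I.side) hU fun x => not_congr (hU x)
  have h3 : numCycles S.face = numCycles (I.map.face.subtypePerm hM) :=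
    numCycles_congr (Equiv.ofInjective I.side I.side.injective) fun d =>
      Subtype.ext (I.map_face_side d).symm
  have h4 : numCycles S.flip = numCycles (U.face.subtypePerm hU) :=
    numCycles_congr (Equiv.ofInjective I.side I.side.injective) fun d =>
      Subtype.ext (I.face_side d).symm
  have h5 : I.map.face.subtypePerm (p := (· ∈ (Set.range I.side)ᶜ)) (fun x => not_congr (hM x)) =
      U.face.subtypePerm fun x => not_congr (hU x) :=
    Equiv.ext fun x => Subtype.ext (I.map_face_of_notMem x.2)
  rw [h5] at h1
  omega

theorem reach_le_map_reach (ht : ∀ d d', U.rot.SameCycle (I.side d) (I.side d') → d = d') :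
    U.reach ≤ I.map.reach := by
  refine reach_le_iff.2 ⟨fun x => ?_, fun x => I.map.reach_flip x⟩
  exact I.map.reach.trans' (I.map.reach_flip x)
    (reach_of_sameCycle_rot (I.map_rot_of_rot ht (U.sameCycle_rot_flip_face x)))

theorem map_connected (ht : ∀ d d', U.rot.SameCycle (I.side d) (I.side d') → d = d')
    (hS : S.Connected) : I.map.Connected := by
  have hU := I.reach_le_map_reach ht
  have h1 : ∀ d d', I.map.reach (I.side d) (I.side d') := by
    intro d d'
    refine mem_of_reach (A := {e | I.map.reach (I.side d) (I.side e)}) (fun z hz => ?_)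
      (fun z hz => ?_) (hS d d') (I.map.reach.refl' _)
    · exact I.map.reach.trans' hz (I.map_face_side z ▸ I.map.reach_face (I.side z))
    · exact I.map.reach.trans' hz (hU (I.face_side z ▸ U.reach_face (I.side z)))
  have h2 : ∀ x, ∃ d, I.map.reach x (I.side d) := by
    intro x
    obtain ⟨d, hd⟩ := Quotient.exists_rep (I.part x)
    exact ⟨d, hU (I.reach_of_part_eq _ _ (hd.symm.trans (I.part_side d).symm))⟩
  intro x y
  obtain ⟨d, hd⟩ := h2 x
  obtain ⟨d', hd'⟩ := h2 y
  exact I.map.reach.trans' hd (I.map.reach.trans' (h1 d d') (I.map.reach.symm' hd'))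

omit [Finite D'] in
theorem comp_connected (q : S.Edge) : (I.comp q).Connected := fun x y =>
  (restrict_reach _).2 (I.reach_of_part_eq _ _ (x.2.trans y.2.symm))

instance comp_nonempty (q : S.Edge) : Nonempty {x | I.part x = q} := by
  obtain ⟨d, rfl⟩ := Quotient.exists_rep q
  exact ⟨I.compRoot d⟩

omit [Finite D'] in
theorem comp_euler_le (q : S.Edge) : numCycles (I.comp q).rot + numCycles (I.comp q).face ≤
    numCycles (I.comp q).flip + 2 := by
  have := (I.comp q).euler_le
  rwa [card_quotient_reach_of_connected (I.comp_connected q), mul_one] at this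

/-- Euler's formulas for the glued map and for `S`, added up: the components are planar on
average. -/
theorem sum_comp_numCycles [Fintype S.Edge] (hS : S.IsPlanar) (hM : I.map.IsPlanar)
    (ht : ∀ d d', U.rot.SameCycle (I.side d) (I.side d') → d = d') :
    ∑ q, (numCycles (I.comp q).rot + numCycles (I.comp q).face) =
      ∑ q, (numCycles (I.comp q).flip + 2) := by
  obtain ⟨h1, h2, h3⟩ := I.numCycles_eq_sum
  rw [Finset.sum_add_distrib, ← h1, ← h2, Finset.sum_add_distrib, ← h3, Finset.sum_const,
    Finset.card_univ, ← Nat.card_eq_fintype_card, smul_eq_mul]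
  change _ = numCycles U.flip + numCycles S.flip * 2
  have h4 := I.map_numCycles_face
  have h5 := I.map_numCycles_rot ht
  have h6 := hS.euler
  have h7 : numCycles I.map.rot + numCycles I.map.face = numCycles U.flip + 2 := hM.euler
  omega

theorem map_isPlanar (hS : S.IsPlanar) (hU : ∀ q, (I.comp q).IsPlanar)
    (ht : ∀ d d', U.rot.SameCycle (I.side d) (I.side d') → d = d') : I.map.IsPlanar := by
  classical
  have := Fintype.ofFinite S.Edge
  refine ⟨I.map_connected ht hS.connected, ?_⟩
  have h := Finset.sum_congr rfl fun q (_ : q ∈ Finset.univ) => (hU q).euler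
  obtain ⟨h1, h2, h3⟩ := I.numCycles_eq_sum
  rw [Finset.sum_add_distrib, ← h1, ← h2, Finset.sum_add_distrib, ← h3, Finset.sum_const,
    Finset.card_univ, ← Nat.card_eq_fintype_card, smul_eq_mul] at h
  change _ = numCycles U.flip + numCycles S.flip * 2 at h
  have h4 := I.map_numCycles_face
  have h5 := I.map_numCycles_rot ht
  have h6 := hS.euler
  change _ = numCycles U.flip + 2
  omega

/-- No component exceeds the Euler characteristic of the sphere, and they attain it on average. -/
theorem comp_isPlanar (hS : S.IsPlanar) (hM : I.map.IsPlanar)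
    (ht : ∀ d d', U.rot.SameCycle (I.side d) (I.side d') → d = d') (q : S.Edge) :
    (I.comp q).IsPlanar := by
  classical
  have := Fintype.ofFinite S.Edge
  exact ⟨I.comp_connected q, (Finset.sum_eq_sum_iff_of_le fun q _ => I.comp_euler_le q).1
    (I.sum_comp_numCycles hS hM ht) q (Finset.mem_univ q)⟩

omit [Finite D'] in
theorem sameCycle_face_side_iff {d : D'} {x : D} :
    U.face.SameCycle (I.side d) x ↔ x = I.side d ∨ x = I.side (S.flip d) := by
  constructor
  · intro h
    refine h.mem_of_mapsTo (A := {x | x = I.side d ∨ x = I.side (S.flip d)}) ?_ (Or.inl rfl)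
    rintro z (rfl | rfl)
    · exact Or.inr (I.face_side d)
    · rw [Set.mem_ofPred_eq, I.face_side, S.flip_flip]; exact Or.inl rfl
  · rintro (rfl | rfl)
    · exact SameCycle.refl _ _
    · exact I.face_side d ▸ sameCycle_apply_self _ _

omit [Finite D'] in
theorem comp_card_root (d : D') :
    Nat.card {x // (I.comp (S.toEdge d)).face.SameCycle (I.compRoot d) x} = 2 := by
  rw [comp, restrict_face_card]
  have hs : {x | U.face.SameCycle (I.side d) x} = {I.side d, I.side (S.flip d)} :=
    Set.ext fun x => I.sameCycle_face_side_iff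
  have := Set.ncard_pair (I.side.injective.ne (S.flip_ne d).symm)
  rw [← hs] at this
  exact this

theorem compRoot_sameCycle_iff {d : D'} {x : {x | I.part x = S.toEdge d}} :
    (I.comp (S.toEdge d)).face.SameCycle (I.compRoot d) x ↔ x.1 ∈ Set.range I.side := by
  rw [comp, restrict_face_sameCycle, I.mem_range_iff x.2]
  exact I.sameCycle_face_side_iff

theorem map_loopless (hS : S.Loopless) (hU : U.Loopless) : I.map.Loopless := by
  intro x hx
  rw [map_flip] at hx
  have ht := I.transversal hU
  by_cases h : ∃ d, U.rot.SameCycle x (I.side d)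
  · obtain ⟨d, hd⟩ := h
    obtain ⟨d', h1, h2⟩ := (I.map_rot_side_iff ht).1 ((I.map_rot_of_rot ht hd).symm.trans hx)
    have h3 := I.part_eq_of_rot h2
    rw [I.part_side, I.part_flip, I.part_eq_of_rot hd, I.part_side, toEdge_eq_iff] at h3
    rcases h3 with rfl | rfl
    · exact hU x (hd.trans h2)
    · exact hS d h1
  · push Not at h
    exact hU x ((I.map_rot_iff ht h).1 hx)

theorem isTri_map {r : D'} {p : ℕ} (hS : S.IsTri r p)
    (hU : ∀ d, (I.comp (S.toEdge d)).IsTri (I.compRoot d) 2) : I.map.IsTri (I.side r) p := by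
  have hq : ∀ q, (I.comp q).Loopless := fun q => by
    obtain ⟨d, rfl⟩ := Quotient.exists_rep q
    exact (hU d).loopless
  have hq' : ∀ q, (I.comp q).IsPlanar := fun q => by
    obtain ⟨d, rfl⟩ := Quotient.exists_rep q
    exact (hU d).planar
  have hl := I.loopless_of_comp hq
  have hface : ∀ d, Nat.card {x // I.map.face.SameCycle (I.side d) x} =
      Nat.card {x // S.face.SameCycle d x} := fun d =>
    card_sameCycle_map I.side.injective fun _ _ => I.map_face_side _
  refine ⟨I.map_isPlanar hS.planar hq' (I.transversal hl), (hface r).trans hS.root_deg,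
    fun x hx => ?_, I.map_loopless hS.loopless hl⟩
  by_cases hr : x ∈ Set.range I.side
  · obtain ⟨d, rfl⟩ := hr
    rw [hface]
    exact hS.other_deg d fun h => hx ((sameCycle_map_iff I.side.injective fun _ _ =>
      I.map_face_side _).2 h)
  · obtain ⟨d, hd⟩ := Quotient.exists_rep (I.part x)
    have h := (hU d).other_deg ⟨x, hd.symm⟩ fun h => hr (I.compRoot_sameCycle_iff.1 h)
    rw [comp, restrict_face_card] at h
    rw [← h]
    exact Nat.card_congr (Equiv.subtypeEquivRight fun y => I.sameCycle_map_face_of_notMem hr)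

theorem simpleBoundary_map (ht : ∀ d d', U.rot.SameCycle (I.side d) (I.side d') → d = d') {r : D'} :
    I.map.SimpleBoundary (I.side r) ↔ S.SimpleBoundary r := by
  have hg : ∀ y, S.face.SameCycle r y → I.map.face (I.side y) = I.side (S.face y) := fun _ _ =>
    I.map_face_side _
  constructor
  · intro h d d' hd hd' hdd
    exact I.side.injective (h _ _ ((sameCycle_image_iff I.side hg _).2 ⟨d, hd, rfl⟩)
      ((sameCycle_image_iff I.side hg _).2 ⟨d', hd', rfl⟩) ((I.map_rot_side_side_iff ht).2 hdd))
  · intro h x x' hx hx' hxx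
    obtain ⟨d, hd, rfl⟩ := (sameCycle_image_iff I.side hg _).1 hx
    obtain ⟨d', hd', rfl⟩ := (sameCycle_image_iff I.side hg _).1 hx'
    rw [h d d' hd hd' ((I.map_rot_side_side_iff ht).1 hxx)]

theorem comp_isTri {r : D'} {p : ℕ} (hM : I.map.IsTri (I.side r) p) (hS : S.IsPlanar) (d : D') :
    (I.comp (S.toEdge d)).IsTri (I.compRoot d) 2 := by
  have ht := I.transversal_of_map hM.loopless
  refine ⟨I.comp_isPlanar hS hM.planar ht _, I.comp_card_root d, fun x hx => ?_, fun x hx => ?_⟩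
  · rw [I.compRoot_sameCycle_iff] at hx
    rw [comp, restrict_face_card, ← hM.other_deg x fun h => hx ?_]
    · exact Nat.card_congr (Equiv.subtypeEquivRight fun y =>
        (I.sameCycle_map_face_of_notMem hx).symm)
    · obtain ⟨e, -, he⟩ := (sameCycle_image_iff I.side (fun _ _ => I.map_face_side _) _).1 h
      exact ⟨e, he⟩
  · exact hM.loopless x (I.map_rot_of_rot ht ((restrict_rot_sameCycle _).1 hx))

end Finite

/-- Construction of an insertion from the glued map. -/
theorem exists_of_map (M : CombMap D) (S : CombMap D') (side : D' ↪ D) (part : D → S.Edge)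
    (h1 : ∀ d, M.face (side d) = side (S.face d))
    (h2 : ∀ x, x ∉ Set.range side → part (M.face x) = part x)
    (h3 : ∀ x, part (M.flip x) = part x) (h4 : ∀ d, part (side d) = S.toEdge d)
    (h5 : ∀ U : CombMap D, (∀ x, U.flip x = M.flip x) → (∀ d, U.face (side d) = side (S.flip d)) →
      (∀ x, x ∉ Set.range side → U.face x = M.face x) → ∀ x y, part x = part y → U.reach x y) :
    ∃ (U : CombMap D) (I : Insertion U S), I.map = M ∧ I.side = side ∧ I.part = part := by
  set σ := S.rot.viaEmbedding side with hσ
  let U := M.withFace (σ⁻¹ * M.face)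
  have hs : ∀ d, U.face (side d) = side (S.flip d) := by
    intro d
    change σ⁻¹ (M.face (side d)) = _
    rw [h1, inv_eq_iff_eq, hσ, viaEmbedding_apply, rot_flip]
  have hM : ∀ x, x ∉ Set.range side → M.face x ∉ Set.range side := by
    rintro x hx ⟨d, hd⟩
    refine hx ⟨S.face⁻¹ d, M.face.injective ?_⟩
    rw [h1, ← hd, ← mul_apply, mul_inv_cancel, one_apply]
  have hn : ∀ x, x ∉ Set.range side → U.face x = M.face x := by
    intro x hx
    change σ⁻¹ (M.face x) = _
    rw [inv_eq_iff_eq, hσ, viaEmbedding_apply_of_notMem _ _ _ (hM x hx)]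
  refine ⟨U, ⟨side, part, hs, fun x => ?_, h3, h4, h5 U (fun _ => rfl) hs hn⟩, ?_, rfl, rfl⟩
  · by_cases hx : x ∈ Set.range side
    · obtain ⟨d, rfl⟩ := hx
      rw [hs, h4, h4, toEdge_flip]
    · rw [hn x hx, h2 x hx]
  · refine eq_of_face_eq_of_flip_eq (fun x => ?_) fun _ => rfl
    change σ (σ⁻¹ (M.face x)) = _
    rw [← mul_apply, mul_inv_cancel, one_apply]

end Insertion

end CombMap

/-! ### Uniqueness of the core -/

namespace CombMap

namespace Insertion

variable {D D' D₁ D₂ : Type}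

section Parallel

variable [Finite D] [Finite D'] {U : CombMap D} {S : CombMap D'} (I : Insertion U S)

/-- The two darts on the root face of a component are antiparallel. -/
theorem map_rot_side_flip (h : I.map.Loopless) (d : D') :
    I.map.rot.SameCycle (I.side (S.flip d)) (I.map.flip (I.side d)) := by
  refine (I.map_rot_of_rot (I.transversal_of_map h) ?_).symm
  have := U.sameCycle_rot_flip_face (I.side d)
  rwa [I.face_side] at this

/-- Darts parallel to a dart on the root face of a component belong to this component, as `S` has no
multiple edges. -/
theorem part_eq_of_parallel_side (h : I.map.Loopless) (hl : S.Loopless) (hm : S.NoMultipleEdges)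
    {d : D'} {y : D} (h1 : I.map.rot.SameCycle (I.side d) y)
    (h2 : I.map.rot.SameCycle (I.map.flip (I.side d)) (I.map.flip y)) :
    I.part y = S.toEdge d := by
  have ht := I.transversal_of_map h
  obtain ⟨d', hd, hy⟩ := (I.map_rot_side_iff ht).1 h1
  obtain ⟨e, he, hy'⟩ := (I.map_rot_side_iff ht).1 ((I.map_rot_side_flip h d).trans h2)
  have e1 := I.part_eq_of_rot hy
  have e2 := I.part_eq_of_rot hy'
  rw [map_flip, I.part_flip] at e2
  rw [← e1, I.part_side]
  have e3 := e2.trans e1.symm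
  rw [I.part_side, I.part_side, toEdge_eq_iff] at e3
  rcases e3 with rfl | rfl
  · exact absurd (hd.trans he.symm) (hl d)
  · rw [hm d d' hd he]

/-- Parallel darts of the glued map belong to the same component. -/
theorem part_eq_of_parallel (h : I.map.Loopless) (hl : S.Loopless) (hm : S.NoMultipleEdges)
    {y z : D} (h1 : I.map.rot.SameCycle y z)
    (h2 : I.map.rot.SameCycle (I.map.flip y) (I.map.flip z)) : I.part y = I.part z := by
  have ht := I.transversal_of_map h
  by_cases hy : ∃ e, U.rot.SameCycle y (I.side e)
  · by_cases hy' : ∃ e, U.rot.SameCycle (I.map.flip y) (I.side e)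
    · obtain ⟨e, he⟩ := hy
      obtain ⟨e', he'⟩ := hy'
      have e1 := I.part_eq_of_rot he
      have e2 := I.part_eq_of_rot he'
      rw [map_flip, I.part_flip] at e2
      have e3 := e2.symm.trans e1
      rw [I.part_side, I.part_side, toEdge_eq_iff] at e3
      rcases e3 with rfl | rfl
      · exact absurd (I.map_rot_of_rot ht (he.trans he'.symm)) (h y)
      · rw [e1, I.part_side]
        refine (I.part_eq_of_parallel_side h hl hm
          ((I.map_rot_of_rot ht he).symm.trans h1) ?_).symm
        exact (I.map_rot_side_flip h e).symm.trans ((I.map_rot_of_rot ht he').symm.trans h2)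
    · push Not at hy'
      have := I.part_eq_of_rot ((I.map_rot_iff ht hy').1 h2)
      rwa [map_flip, I.part_flip, I.part_flip] at this
  · push Not at hy
    exact I.part_eq_of_rot ((I.map_rot_iff ht hy).1 h1)

end Parallel

section Unique

variable [Finite D] [Finite D₁] [Finite D₂] {U₁ U₂ : CombMap D} {S₁ : CombMap D₁} {S₂ : CombMap D₂}
  (I₁ : Insertion U₁ S₁) (I₂ : Insertion U₂ S₂) (hM : I₁.map = I₂.map) (hl : I₁.map.Loopless)
include hM hl

theorem part_side_flip (hl₁ : S₁.Loopless) (hm₁ : S₁.NoMultipleEdges) {d₁ : D₁} {d₂ : D₂}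
    (h : I₁.side d₁ = I₂.side d₂) : I₁.part (I₂.side (S₂.flip d₂)) = S₁.toEdge d₁ := by
  have h1 := I₂.map_rot_side_flip (hM ▸ hl) (S₂.flip d₂)
  have h2 := I₂.map_rot_side_flip (hM ▸ hl) d₂
  rw [S₂.flip_flip, ← hM, ← h] at h1
  rw [← hM, ← h] at h2
  rw [← I₁.part_flip, ← I₁.map_flip]
  refine I₁.part_eq_of_parallel_side hl hl₁ hm₁ h1 ?_
  rw [flip_flip]
  exact h2.symm

/-- If the cores start with the same dart `a` of the glued map, then the two components containing
it are bounded by the same second dart. Otherwise, the component of `I₁` would separate, in `S₂`,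
the faces on the two sides of the edge of `a`. -/
theorem side_flip_eq (hl₁ : S₁.Loopless) (hm₁ : S₁.NoMultipleEdges) (hl₂ : S₂.Loopless)
    (hm₂ : S₂.NoMultipleEdges) {d₁ : D₁} {d₂ : D₂} (h : I₁.side d₁ = I₂.side d₂) :
    I₁.side (S₁.flip d₁) = I₂.side (S₂.flip d₂) := by
  by_contra hne
  have p12 := part_side_flip I₁ I₂ hM hl hl₁ hm₁ h
  have p21 := part_side_flip I₂ I₁ hM.symm (hM ▸ hl) hl₂ hm₂ h.symm
  -- the darts of `S₂` inside the component of `a` in `U₁`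
  let X : Set D₂ := {d | I₁.part (I₂.side d) = S₁.toEdge d₁ ∧ I₂.side d ∉ Set.range I₁.side}
  have hX : ∀ d, I₁.part (I₂.side d) = S₁.toEdge d₁ → I₂.side d ≠ I₁.side d₁ →
      I₂.side d ≠ I₁.side (S₁.flip d₁) → d ∈ X := by
    intro d e1 e2 e3
    refine ⟨e1, fun hr => ?_⟩
    rcases (I₁.mem_range_iff e1).1 hr with e | e
    exacts [e2 e, e3 e]
  have hd₂ : S₂.flip d₂ ∈ X := by
    refine hX _ p12 ?_ (Ne.symm hne)
    rw [h]
    exact I₂.side.injective.ne (S₂.flip_ne d₂)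
  have hmem : d₂ ∈ X := by
    refine S₂.mem_of_flip_mem (hl₂ d₂) ?_ ?_ hd₂
    · rintro z ⟨h1, h2⟩
      change I₁.part _ = _ ∧ _
      rw [← I₂.map_face_side, ← hM, I₁.map_face_of_notMem h2, I₁.part_face]
      exact ⟨h1, I₁.face_notMem_range h2⟩
    · rintro z ⟨h1, h2⟩ n1 n2
      refine hX _ ?_ ?_ ?_
      · rw [← h1, ← I₁.part_flip (I₂.side z), ← I₁.map_flip]
        refine I₁.part_eq_of_parallel hl hl₁ hm₁ ?_ ?_
        · rw [hM]; exact I₂.map_rot_side_flip (hM ▸ hl) z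
        · rw [flip_flip, hM]
          have := I₂.map_rot_side_flip (hM ▸ hl) (S₂.flip z)
          rw [S₂.flip_flip] at this
          exact this.symm
      · rw [h]
        refine I₂.side.injective.ne fun e => n2 ?_
        rw [← e, S₂.flip_flip]
      · intro e
        rw [← e, I₂.part_side, toEdge_eq_iff] at p21
        rcases p21 with e' | e'
        · exact n2 (e' ▸ (S₂.flip_flip z).symm)
        · exact n1 (S₂.flip.injective e')
  exact hmem.2 ⟨d₁, h⟩

/-- Uniqueness of the core. -/
theorem iso_of_map_eq (hl₁ : S₁.Loopless) (hm₁ : S₁.NoMultipleEdges) (hl₂ : S₂.Loopless)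
    (hm₂ : S₂.NoMultipleEdges) (hc₁ : S₁.Connected) (hc₂ : S₂.Connected) {r₁ : D₁} {r₂ : D₂}
    (h : I₁.side r₁ = I₂.side r₂) : S₁.Iso r₁ S₂ r₂ := by
  refine Iso.of_rel hc₁ hc₂ (fun d₁ d₂ => I₁.side d₁ = I₂.side d₂) h (fun d₁ d₂ hd => ?_)
    (fun d₁ d₂ hd => side_flip_eq I₁ I₂ hM hl hl₁ hm₁ hl₂ hm₂ hd)
    (fun a b c hb hc => I₂.side.injective (hb.symm.trans hc))
    (fun a b c hb hc => I₁.side.injective (hb.trans hc.symm))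
  rw [← I₁.map_face_side, ← I₂.map_face_side, hd, hM]

end Unique

/-- Uniqueness of the components, for a given core. -/
theorem comp_iso_of_map_eq [Finite D] [Finite D'] {U₁ U₂ : CombMap D} {S : CombMap D'}
    (I₁ : Insertion U₁ S) (I₂ : Insertion U₂ S) (hM : I₁.map = I₂.map) (hl : I₁.map.Loopless)
    (hS : S.Loopless) (hm : S.NoMultipleEdges) (hc : S.Connected) {r : D'}
    (h : I₁.side r = I₂.side r) (d : D') :
    (I₁.comp (S.toEdge d)).Iso (I₁.compRoot d) (I₂.comp (S.toEdge d)) (I₂.compRoot d) := by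
  have hs : I₁.side = I₂.side := by
    refine DFunLike.ext _ _ fun d => ?_
    refine mem_of_reach (A := {d | I₁.side d = I₂.side d}) (fun z hz => ?_)
      (fun z hz => side_flip_eq I₁ I₂ hM hl hS hm hS hm hz) (hc r d) h
    have hz' : I₁.side z = I₂.side z := hz
    rw [Set.mem_ofPred_eq, ← I₁.map_face_side, ← I₂.map_face_side, hz', hM]
  have hU : U₁ = U₂ := by
    refine eq_of_face_eq_of_flip_eq (fun x => ?_) fun x => ?_
    · by_cases hx : x ∈ Set.range I₁.side
      · obtain ⟨d, rfl⟩ := hx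
        rw [I₁.face_side, hs, I₂.face_side]
      · rw [← I₁.map_face_of_notMem hx, ← I₂.map_face_of_notMem (hs ▸ hx), hM]
    · rw [← I₁.map_flip, ← I₂.map_flip, hM]
  subst hU
  have hp : I₁.part = I₂.part := by
    funext x
    obtain ⟨d, hd⟩ := Quotient.exists_rep (I₁.part x)
    have h1 := I₁.reach_of_part_eq x (I₁.side d) (by rw [I₁.part_side]; exact hd.symm)
    rw [I₂.part_eq_of_reach h1, hs, I₂.part_side]
    exact hd.symm
  cases I₁
  cases I₂
  simp only at hs hp
  subst hs hp
  exact Iso.refl _ _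

end Insertion

end CombMap

/-! ### Existence of the core -/

namespace CombMap

section Rewire

variable {D : Type} (N : CombMap D) {a b : D}

open Classical in
/-- Cut the map along the edges of `a` and `b`, and glue the sides `a` and `b` together, as well as
their opposite sides: `a`, `b` and `N.flip a`, `N.flip b` become the darts of two edges. -/
noncomputable def rewire (hab : a ≠ b) (hab' : a ≠ N.flip b) : CombMap D where
  face := N.face
  flip := N.flip * swap a (N.flip b) * swap b (N.flip a)
  flip_flip := by
    have h1 := N.flip_ne
    have h2 := N.flip_flip
    have h3 : N.flip a ≠ b := fun h => hab' (by rw [← h, h2])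
    have h4 : N.flip a ≠ N.flip b := fun h => hab (N.flip.injective h)
    have e1 : ∀ x, x ≠ a → x ≠ b → x ≠ N.flip a → x ≠ N.flip b →
        (N.flip * swap a (N.flip b) * swap b (N.flip a)) x = N.flip x := by
      intro x x1 x2 x3 x4
      simp [swap_apply_of_ne_of_ne, *]
    have ea : (N.flip * swap a (N.flip b) * swap b (N.flip a)) a = b := by
      rw [mul_apply, mul_apply, swap_apply_of_ne_of_ne hab (h1 a).symm, swap_apply_left, h2]
    have eb : (N.flip * swap a (N.flip b) * swap b (N.flip a)) b = a := by
      rw [mul_apply, mul_apply, swap_apply_left, swap_apply_of_ne_of_ne (h1 a) h4, h2]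
    have ea' : (N.flip * swap a (N.flip b) * swap b (N.flip a)) (N.flip a) = N.flip b := by
      rw [mul_apply, mul_apply, swap_apply_right, swap_apply_of_ne_of_ne hab.symm (h1 b).symm]
    have eb' : (N.flip * swap a (N.flip b) * swap b (N.flip a)) (N.flip b) = N.flip a := by
      rw [mul_apply, mul_apply, swap_apply_of_ne_of_ne (h1 b) h4.symm, swap_apply_right]
    intro x
    by_cases x1 : x = a
    · rw [x1, ea, eb]
    by_cases x2 : x = b
    · rw [x2, eb, ea]
    by_cases x3 : x = N.flip a
    · rw [x3, ea', eb']
    by_cases x4 : x = N.flip b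
    · rw [x4, eb', ea']
    rw [e1 x x1 x2 x3 x4, e1, h2]
    · exact fun h => x3 (by rw [← h, h2])
    · exact fun h => x4 (by rw [← h, h2])
    · exact fun h => x1 (N.flip.injective h)
    · exact fun h => x2 (N.flip.injective h)
  flip_ne := by
    have h1 := N.flip_ne
    intro x hx
    rw [mul_assoc, mul_apply] at hx
    have h2 := N.flip_flip
    have h3 : N.flip a ≠ b := fun h => hab' (by rw [← h, h2])
    have h4 : N.flip a ≠ N.flip b := fun h => hab (N.flip.injective h)
    by_cases x1 : x = a
    · subst x1
      rw [mul_apply, swap_apply_of_ne_of_ne hab (h1 x).symm, swap_apply_left, h2] at hx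
      exact hab hx.symm
    by_cases x2 : x = b
    · subst x2
      rw [mul_apply, swap_apply_left, swap_apply_of_ne_of_ne (h1 a) h4, h2] at hx
      exact hab hx
    by_cases x3 : x = N.flip a
    · rw [x3, mul_apply, swap_apply_right, swap_apply_of_ne_of_ne hab.symm (h1 b).symm] at hx
      exact h4 hx.symm
    by_cases x4 : x = N.flip b
    · rw [x4, mul_apply, swap_apply_of_ne_of_ne (h1 b) h4.symm, swap_apply_right] at hx
      exact h4 hx
    rw [mul_apply, swap_apply_of_ne_of_ne x2 x3, swap_apply_of_ne_of_ne x1 x4] at hx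
    exact h1 x hx

variable (hab : a ≠ b) (hab' : a ≠ N.flip b)

open Classical in
theorem rewire_flip_left : (N.rewire hab hab').flip a = b := by
  change (N.flip * swap a (N.flip b) * swap b (N.flip a)) a = b
  rw [mul_apply, mul_apply, swap_apply_of_ne_of_ne hab (N.flip_ne a).symm, swap_apply_left,
    N.flip_flip]

theorem rewire_flip_right : (N.rewire hab hab').flip b = a := by
  have := (N.rewire hab hab').flip_flip a
  rwa [rewire_flip_left] at this

open Classical in
theorem rewire_flip_flip_left : (N.rewire hab hab').flip (N.flip a) = N.flip b := by
  change (N.flip * swap a (N.flip b) * swap b (N.flip a)) (N.flip a) = N.flip b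
  rw [mul_apply, mul_apply, swap_apply_right, swap_apply_of_ne_of_ne hab.symm (N.flip_ne b).symm]

theorem rewire_flip_flip_right : (N.rewire hab hab').flip (N.flip b) = N.flip a := by
  have := (N.rewire hab hab').flip_flip (N.flip a)
  rwa [rewire_flip_flip_left] at this

open Classical in
theorem rewire_flip_of_ne {x : D} (x1 : x ≠ a) (x2 : x ≠ b) (x3 : x ≠ N.flip a)
    (x4 : x ≠ N.flip b) : (N.rewire hab hab').flip x = N.flip x := by
  change (N.flip * swap a (N.flip b) * swap b (N.flip a)) x = N.flip x
  rw [mul_apply, mul_apply, swap_apply_of_ne_of_ne x2 x3, swap_apply_of_ne_of_ne x1 x4]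

open Classical in
theorem rewire_rot : (N.rewire hab hab').rot = N.rot * swap a (N.flip b) * swap b (N.flip a) := by
  simp only [rot, mul_assoc]
  rfl

/-- If `a` and `b` belong to parallel edges, cutting splits each of their two endpoints. -/
theorem rewire_parallel [Finite D] (hl : N.Loopless) (h1 : N.rot.SameCycle a (N.flip b))
    (h2 : N.rot.SameCycle (N.flip a) b) :
    (∀ x y, (N.rewire hab hab').rot.SameCycle x y → N.rot.SameCycle x y) ∧
    numCycles (N.rewire hab hab').rot = numCycles N.rot + 2 ∧ (N.rewire hab hab').Loopless := by
  classical
  have e1 := setoid_eq_glue_mul_swap h1 hab'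
  set π := N.rot * swap a (N.flip b)
  have hle : SameCycle.setoid π ≤ SameCycle.setoid N.rot := e1 ▸ Setoid.le_glue _ _ _
  have h3 : π.SameCycle b (N.flip a) := by
    have : (SameCycle.setoid N.rot) b (N.flip a) := h2.symm
    rw [e1, Setoid.glue_apply] at this
    rcases this with h | ⟨h, -⟩ | ⟨h, -⟩
    · exact h
    · exact absurd (SameCycle.trans (hle h) h1) (hl b)
    · exact absurd (hle h) (hl b)
  have hab'' : b ≠ N.flip a := fun h => hab' (by rw [h, N.flip_flip])
  have e2 := setoid_eq_glue_mul_swap h3 hab''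
  have hrot := N.rewire_rot hab hab'
  have hle' : ∀ x y, (N.rewire hab hab').rot.SameCycle x y → N.rot.SameCycle x y := by
    intro x y h
    rw [hrot] at h
    exact hle ((e2 ▸ Setoid.le_glue _ _ _ : SameCycle.setoid (π * swap b (N.flip a)) ≤ _) h)
  refine ⟨hle', ?_, fun x hx => ?_⟩
  · rw [hrot, numCycles_mul_swap h3 hab'', numCycles_mul_swap h1 hab']
  · have hx' := hle' _ _ hx
    by_cases x1 : x = a
    · rw [x1, rewire_flip_left] at hx'
      exact hl b (hx'.symm.trans h1)
    by_cases x2 : x = b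
    · rw [x2, rewire_flip_right] at hx'
      exact hl b (hx'.trans h1)
    by_cases x3 : x = N.flip a
    · rw [x3, rewire_flip_flip_left] at hx'
      exact hl b (h2.symm.trans hx')
    by_cases x4 : x = N.flip b
    · rw [x4, rewire_flip_flip_right] at hx'
      exact hl a (h1.trans hx')
    rw [rewire_flip_of_ne _ _ _ x1 x2 x3 x4] at hx'
    exact hl x hx'

theorem rewire_reach [Finite D] (hc : N.Connected) (z : D) :
    (N.rewire hab hab').reach a z ∨ (N.rewire hab hab').reach (N.flip a) z := by
  set N' := N.rewire hab hab'
  have hb : N'.reach a b := N.rewire_flip_left hab hab' ▸ N'.reach_flip a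
  have hb' : N'.reach (N.flip a) (N.flip b) :=
    N.rewire_flip_flip_left hab hab' ▸ N'.reach_flip (N.flip a)
  refine mem_of_reach (A := {z | N'.reach a z ∨ N'.reach (N.flip a) z}) (fun z hz => ?_)
    (fun z hz => ?_) (hc a z) (Or.inl (N'.reach.refl' a))
  · exact hz.imp (fun h => N'.reach.trans' h (N'.reach_face z))
      (fun h => N'.reach.trans' h (N'.reach_face z))
  · by_cases x1 : z = a
    · rw [x1]; exact Or.inr (N'.reach.refl' _)
    by_cases x2 : z = b
    · rw [x2]; exact Or.inr hb'
    by_cases x3 : z = N.flip a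
    · rw [x3, N.flip_flip]; exact Or.inl (N'.reach.refl' _)
    by_cases x4 : z = N.flip b
    · rw [x4, N.flip_flip]; exact Or.inl hb
    rw [Set.mem_ofPred_eq, ← N.rewire_flip_of_ne hab hab' x1 x2 x3 x4]
    exact hz.imp (fun h => N'.reach.trans' h (N'.reach_flip z))
      (fun h => N'.reach.trans' h (N'.reach_flip z))

/-- The piece containing the root is a triangulation of the same polygon: the number of vertices has
increased by 2, so that the cut map consists of two planar components. -/
theorem rewire_isTri [Finite D] {r : D} {p : ℕ} (h : N.IsTri r p)
    (hs : N.SimpleBoundary r) (h1 : N.rot.SameCycle a (N.flip b))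
    (h2 : N.rot.SameCycle (N.flip a) b) (hr : (N.rewire hab hab').reach a r) :
    ¬ (N.rewire hab hab').reach a (N.flip a) ∧
    ((N.rewire hab hab').restrict _ ((N.rewire hab hab').isClosed_reach a)).IsTri ⟨r, hr⟩ p ∧
    ((N.rewire hab hab').restrict _ ((N.rewire hab hab').isClosed_reach a)).SimpleBoundary
      ⟨r, hr⟩ := by
  obtain ⟨hle, hcard, hl⟩ := N.rewire_parallel hab hab' h.loopless h1 h2
  set N' := N.rewire hab hab'
  have hE : numCycles N'.flip = numCycles N.flip := by
    have e1 := N.card_eq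
    have e2 := N'.card_eq
    omega
  have hF : numCycles N'.face = numCycles N.face := rfl
  have he := h.planar.euler
  obtain ⟨g1, g2, -⟩ := planar_components (N := N') (N.rewire_reach hab hab' h.planar.connected)
    (by omega)
  refine ⟨g1, ⟨g2, ?_, fun x hx => ?_, fun x hx => hl x ((restrict_rot_sameCycle _).1 hx)⟩, ?_⟩
  · rw [restrict_face_card]
    exact h.root_deg
  · rw [restrict_face_sameCycle] at hx
    rw [restrict_face_card]
    exact h.other_deg _ hx
  · intro d d' hd hd' hdd
    rw [restrict_face_sameCycle] at hd hd'
    rw [restrict_rot_sameCycle] at hdd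
    exact Subtype.ext (hs _ _ hd hd' (hle _ _ hdd))

/-- If one of the two pieces obtained by cutting along two parallel edges comes from an insertion
into `S`, then so does the whole map: the other piece is added to the component of the edge along
which the first piece has been closed. -/
theorem exists_insertion_of_rewire [Finite D] {D' : Type} [Finite D'] {S : CombMap D'}
    {N' : CombMap D} (hN' : N' = N.rewire hab hab') (hl : N'.Loopless) (hc : N.Connected)
    {A : Set D} (hA : A = {z | N'.reach a z}) (hn : N.flip a ∉ A) (hcl : N'.IsClosed A)
    {U₁ : CombMap A} (I₁ : Insertion U₁ S) (hI : I₁.map = N'.restrict A hcl) :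
    ∃ (U : CombMap D) (I : Insertion U S), I.map = N ∧ ∀ d, I.side d = (I₁.side d : D) := by
  classical
  have hcov := N.rewire_reach hab hab' hc
  have eab := N.rewire_flip_left hab hab'
  have eba := N.rewire_flip_right hab hab'
  have eab' := N.rewire_flip_flip_left hab hab'
  have eba' := N.rewire_flip_flip_right hab hab'
  have eo := fun x => N.rewire_flip_of_ne hab hab' (x := x)
  have ef : ∀ x, (N.rewire hab hab').face x = N.face x := fun _ => rfl
  rw [← hN'] at hcov eab eba eab' eba' eo ef
  have haA : a ∈ A := hA ▸ N'.reach.refl' a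
  have hbA : b ∈ A := hA ▸ eab ▸ N'.reach_flip a
  have hfa : N.flip a ∉ A := hn
  have hfb : N.flip b ∉ A := by rw [← eab', hcl.2]; exact hn
  have hfA : ∀ x, N.face x ∈ A ↔ x ∈ A := fun x => ef x ▸ hcl.1 x
  have hflip : ∀ x, x ≠ a → x ≠ b → x ≠ N.flip a → x ≠ N.flip b → (N.flip x ∈ A ↔ x ∈ A) :=
    fun x x1 x2 x3 x4 => eo x x1 x2 x3 x4 ▸ hcl.2 x
  let part : D → S.Edge := fun x => if h : x ∈ A then I₁.part ⟨x, h⟩ else I₁.part ⟨a, haA⟩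
  have part_mem : ∀ x (h : x ∈ A), part x = I₁.part ⟨x, h⟩ := fun x h => dif_pos h
  have part_not : ∀ x, x ∉ A → part x = I₁.part ⟨a, haA⟩ := fun x h => dif_neg h
  have part_b : part b = I₁.part ⟨a, haA⟩ := by
    rw [part_mem b hbA, ← I₁.part_flip ⟨a, haA⟩, ← I₁.map_flip, hI]
    congr 1
    exact Subtype.ext eab.symm
  let side : D' ↪ D := I₁.side.trans (Function.Embedding.subtype _)
  have hface : ∀ x (h : x ∈ A), ((I₁.map.face ⟨x, h⟩ : A) : D) = N.face x := by
    intro x h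
    rw [hI]
    exact ef x
  have hside : ∀ x (h : x ∈ A), x ∉ Set.range side → (⟨x, h⟩ : A) ∉ Set.range I₁.side := by
    rintro x h hx ⟨d, hd⟩
    exact hx ⟨d, congrArg Subtype.val hd⟩
  suffices h : ∃ (U : CombMap D) (I : Insertion U S), I.map = N ∧ I.side = side ∧ I.part = part by
    obtain ⟨U, I, h1, h2, -⟩ := h
    exact ⟨U, I, h1, fun d => by rw [h2]; rfl⟩
  refine Insertion.exists_of_map N S side part ?_ ?_ ?_ ?_ ?_
  · intro d
    change N.face (I₁.side d : D) = (I₁.side (S.face d) : D)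
    rw [← I₁.map_face_side, ← hface _ (I₁.side d).2]
  · intro x hx
    by_cases h : x ∈ A
    · rw [part_mem _ ((hfA x).2 h), part_mem x h, ← I₁.part_face ⟨x, h⟩,
        ← I₁.map_face_of_notMem (hside x h hx)]
      congr 1
      exact Subtype.ext (hface x h).symm
    · rw [part_not x h, part_not _ (mt (hfA x).1 h)]
  · intro x
    by_cases x1 : x = a
    · rw [x1, part_not _ hfa, part_mem a haA]
    by_cases x2 : x = b
    · rw [x2, part_not _ hfb, part_b]
    by_cases x3 : x = N.flip a
    · rw [x3, N.flip_flip, part_not _ hfa, part_mem a haA]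
    by_cases x4 : x = N.flip b
    · rw [x4, N.flip_flip, part_not _ hfb, part_b]
    by_cases h : x ∈ A
    · rw [part_mem x h, part_mem _ ((hflip x x1 x2 x3 x4).2 h), ← I₁.part_flip ⟨x, h⟩,
        ← I₁.map_flip, hI]
      congr 1
      exact Subtype.ext (eo x x1 x2 x3 x4).symm
    · rw [part_not x h, part_not _ (mt (hflip x x1 x2 x3 x4).1 h)]
  · intro d
    exact (part_mem _ (I₁.side d).2).trans (I₁.part_side d)
  · intro U u1 u2 u3
    have r1 : ∀ x, x ∉ A → U.reach x (N.face x) := by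
      intro x hx
      rw [← u3 x fun ⟨d, hd⟩ => hx (hd ▸ (I₁.side d).2)]
      exact U.reach_face x
    have r2 : ∀ x, U.reach x (N.flip x) := fun x => u1 x ▸ U.reach_flip x
    -- the second piece is attached to both ends of the edge along which the first one is closed
    let X : Set D := {z | z ∉ A ∧ U.reach a z}
    have hXf : ∀ z ∈ X, N'.face z ∈ X := fun z hz =>
      ⟨mt (hcl.1 z).1 hz.1, ef z ▸ U.reach.trans' hz.2 (r1 z hz.1)⟩
    have hXa : ∀ z ∈ X, z ≠ N.flip a → z ≠ N.flip b → N'.flip z ∈ X := by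
      intro z hz x3 x4
      have x1 : z ≠ a := fun h => hz.1 (h ▸ haA)
      have x2 : z ≠ b := fun h => hz.1 (h ▸ hbA)
      rw [eo z x1 x2 x3 x4]
      exact ⟨mt (hflip z x1 x2 x3 x4).1 hz.1, U.reach.trans' hz.2 (r2 z)⟩
    have hXfa : N.flip a ∈ X := ⟨hfa, r2 a⟩
    have hXfb : N.flip b ∈ X := by
      refine N'.mem_of_flip_mem (hl _) hXf (fun z hz x4 x3 => hXa z hz ?_ x4) ?_
      · rwa [eba'] at x3
      · rwa [eba']
    have rab : U.reach a b := by
      refine U.reach.trans' hXfb.2 ?_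
      have := r2 (N.flip b)
      rwa [N.flip_flip] at this
    have rX : ∀ z, z ∉ A → U.reach a z := by
      intro z hz
      have hz' : ¬ N'.reach a z := by rwa [hA] at hz
      refine (mem_of_reach (A := X) hXf (fun z hz => ?_) ((hcov z).resolve_left hz') hXfa).2
      by_cases x3 : z = N.flip a
      · rw [x3, eab']; exact hXfb
      by_cases x4 : z = N.flip b
      · rw [x4, eba']; exact hXfa
      exact hXa z hz x3 x4
    have rA : ∀ x y : A, I₁.part x = I₁.part y → U.reach x y := by
      intro x y hxy
      have : U₁.reach ≤ U.reach.comap ((↑) : A → D) := by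
        refine reach_le_iff.2 ⟨fun x => ?_, fun x => ?_⟩
        · change U.reach x (U₁.face x : D)
          by_cases hx : x ∈ Set.range I₁.side
          · obtain ⟨d, rfl⟩ := hx
            rw [I₁.face_side]
            have := U.reach_face (side d)
            rwa [u2 d] at this
          · have hx' : (x : D) ∉ Set.range side := by
              rintro ⟨d, hd⟩
              exact hx ⟨d, Subtype.ext hd⟩
            rw [← I₁.map_face_of_notMem hx, hface x x.2, ← u3 _ hx']
            exact U.reach_face _
        · change U.reach x (U₁.flip x : D)
          have hfx : (U₁.flip x : D) = N'.flip x := by rw [← I₁.map_flip, hI]; rfl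
          rw [hfx]
          by_cases x1 : (x : D) = a
          · rw [x1, eab]; exact rab
          by_cases x2 : (x : D) = b
          · rw [x2, eba]; exact U.reach.symm' rab
          rw [eo x x1 x2 (fun h => hfa (h ▸ x.2)) fun h => hfb (h ▸ x.2)]
          exact r2 x
      exact this (I₁.reach_of_part_eq _ _ hxy)
    have key : ∀ x, ∃ y : A, U.reach x y ∧ part x = I₁.part y := by
      intro x
      by_cases h : x ∈ A
      · exact ⟨⟨x, h⟩, U.reach.refl' x, part_mem x h⟩
      · exact ⟨⟨a, haA⟩, U.reach.symm' (rX x h), part_not x h⟩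
    intro x y hxy
    obtain ⟨x', hx, hx'⟩ := key x
    obtain ⟨y', hy, hy'⟩ := key y
    exact U.reach.trans' hx (U.reach.trans' (rA x' y' (hx'.symm.trans (hxy.trans hy')))
      (U.reach.symm' hy))

end Rewire

/-- Every triangulation of a polygon without loops is obtained by gluing triangulations of the
2-gon into the edges of a simple one: cut along two parallel edges and proceed by induction with the
piece which contains the root. -/
theorem IsTri.exists_insertion {D : Type} [Finite D] {N : CombMap D} {r : D} {p : ℕ}
    (h : N.IsTri r p) (hs : N.SimpleBoundary r) :
    ∃ (D' : Type) (_ : Finite D') (S : CombMap D') (r' : D') (U : CombMap D) (I : Insertion U S),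
      I.map = N ∧ I.side r' = r ∧ S.IsTri r' p ∧ S.SimpleBoundary r' ∧ S.NoMultipleEdges := by
  induction hn : Nat.card D using Nat.strong_induction_on generalizing D with
  | _ n ih =>
    by_cases hm : N.NoMultipleEdges
    · obtain ⟨U, I, h1, h2, -⟩ := Insertion.exists_of_map N N (Function.Embedding.refl D) N.toEdge
        (fun _ => rfl) (fun x hx => absurd ⟨x, rfl⟩ hx) (fun x => N.toEdge_flip x) (fun _ => rfl)
        (fun U u1 _ _ x y hxy => by
          rcases toEdge_eq_iff.1 hxy with rfl | rfl
          · exact U.reach.refl' _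
          · exact U.reach.symm' (u1 y ▸ U.reach_flip y))
      exact ⟨D, inferInstance, N, r, U, I, h1, by rw [h2]; rfl, h, hs, hm⟩
    · -- the case where the root belongs to the piece on the left of `a`
      have key : ∀ (a b : D) (hab : a ≠ b) (hab' : a ≠ N.flip b), N.rot.SameCycle a (N.flip b) →
          N.rot.SameCycle (N.flip a) b → (N.rewire hab hab').reach a r →
          ∃ (D' : Type) (_ : Finite D') (S : CombMap D') (r' : D') (U : CombMap D)
            (I : Insertion U S), I.map = N ∧ I.side r' = r ∧ S.IsTri r' p ∧ S.SimpleBoundary r' ∧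
              S.NoMultipleEdges := by
        intro a b hab hab' h1 h2 hr
        obtain ⟨hn', ht, hb⟩ := N.rewire_isTri hab hab' h hs h1 h2 hr
        have hlt : Nat.card {z | (N.rewire hab hab').reach a z} < n := by
          rw [← hn]
          exact Finite.card_subtype_lt (x := N.flip a) hn'
        obtain ⟨D', hD', S, r', U₁, I₁, hI, hr', hS⟩ := ih _ hlt ht hb rfl
        obtain ⟨U, I, hM, hside⟩ := N.exists_insertion_of_rewire hab hab' rfl
          (N.rewire_parallel hab hab' h.loopless h1 h2).2.2 h.planar.connected rfl hn' _ I₁ hI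
        exact ⟨D', hD', S, r', U, I, hM, by rw [hside, hr'], hS⟩
      unfold NoMultipleEdges at hm
      push Not at hm
      obtain ⟨a, a', h1, h2, hne⟩ := hm
      obtain ⟨b, rfl⟩ := N.flip.surjective a'
      rw [N.flip_flip] at h2
      have hab : a ≠ b := by
        rintro rfl
        exact h.loopless a h1
      rcases N.rewire_reach hab hne h.planar.connected r with hr | hr
      · exact key a b hab hne h1 h2 hr
      · have hab' : N.flip a ≠ N.flip b := N.flip.injective.ne hab
        have hne' : N.flip a ≠ N.flip (N.flip b) := N.flip.injective.ne hne
        refine key (N.flip a) (N.flip b) hab' hne' (by rwa [N.flip_flip]) (by rwa [N.flip_flip]) ?_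
        have : N.rewire hab' hne' = N.rewire hab hne := by
          refine eq_of_face_eq_of_flip_eq (fun _ => rfl) fun x => ?_
          have e1 := (N.rewire hab' hne').flip_flip
          by_cases x1 : x = a
          · have := N.rewire_flip_flip_left hab' hne'
            rw [N.flip_flip, N.flip_flip] at this
            rw [x1, this, rewire_flip_left]
          by_cases x2 : x = b
          · have := N.rewire_flip_flip_right hab' hne'
            rw [N.flip_flip, N.flip_flip] at this
            rw [x2, this, rewire_flip_right]
          by_cases x3 : x = N.flip a
          · rw [x3, rewire_flip_left, rewire_flip_flip_left]
          by_cases x4 : x = N.flip b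
          · rw [x4, rewire_flip_right, rewire_flip_flip_right]
          rw [rewire_flip_of_ne _ _ _ x1 x2 x3 x4, rewire_flip_of_ne _ _ _ x3 x4
            (by rwa [N.flip_flip]) (by rwa [N.flip_flip])]
        rwa [this]

end CombMap

/-! ### Gluing families of maps into the edges of a map -/

namespace CombMap

namespace Insertion

variable {D D' E : Type}

section

variable {U : CombMap D} {S : CombMap D'} (I : Insertion U S)

/-- The distinguished dart on the root face of a component. -/
noncomputable def base (q : S.Edge) : {x | I.part x = q} :=
  ⟨I.side q.out, (I.part_side _).trans q.out_eq⟩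

theorem comp_isTri_base [Finite D] [Finite D'] {r : D'} {p : ℕ} (hM : I.map.IsTri (I.side r) p)
    (hS : S.IsPlanar) (q : S.Edge) : (I.comp q).IsTri (I.base q) 2 := by
  have key : ∀ d (h : S.toEdge d = q), (I.comp q).IsTri ⟨I.side d, (I.part_side d).trans h⟩ 2 := by
    rintro d rfl
    exact I.comp_isTri hM hS d
  exact key _ q.out_eq

theorem compRoot_isTri_of_base [Finite D] [Finite D']
    (h : ∀ q, (I.comp q).IsTri (I.base q) 2) (d : D') :
    (I.comp (S.toEdge d)).IsTri (I.compRoot d) 2 := by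
  refine (h (S.toEdge d)).of_sameCycle ?_
  exact (I.compRoot_sameCycle_iff.2 ⟨_, rfl⟩ : (I.comp (S.toEdge d)).face.SameCycle
    (I.compRoot d) (I.base (S.toEdge d))).symm

/-- Renaming the darts of the glued map. -/
def relabel [Finite D] (e : D ≃ E) : Insertion (U.relabel e) S where
  side := I.side.trans e.toEmbedding
  part x := I.part (e.symm x)
  face_side d := by
    change e (U.face (e.symm (e (I.side d)))) = e (I.side (S.flip d))
    rw [e.symm_apply_apply, I.face_side]
  part_face x := by
    change I.part (e.symm (e (U.face (e.symm x)))) = _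
    rw [e.symm_apply_apply, I.part_face]
  part_flip x := by
    change I.part (e.symm (e (U.flip (e.symm x)))) = _
    rw [e.symm_apply_apply, I.part_flip]
  part_side d := by
    change I.part (e.symm (e (I.side d))) = _
    rw [e.symm_apply_apply, I.part_side]
  reach_of_part_eq x y h := by
    have hle : U.reach ≤ (U.relabel e).reach.comap e := by
      refine reach_le_iff.2 ⟨fun x => ?_, fun x => ?_⟩
      · have := (U.relabel e).reach_face (e x)
        rwa [show (U.relabel e).face (e x) = e (U.face (e.symm (e x))) from rfl,
          e.symm_apply_apply] at this
      · have := (U.relabel e).reach_flip (e x)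
        rwa [show (U.relabel e).flip (e x) = e (U.flip (e.symm (e x))) from rfl,
          e.symm_apply_apply] at this
    have := hle (I.reach_of_part_eq _ _ h)
    rwa [Setoid.comap_rel, e.apply_symm_apply, e.apply_symm_apply] at this

theorem relabel_side [Finite D] (e : D ≃ E) (d : D') : (I.relabel e).side d = e (I.side d) := rfl

theorem relabel_map [Finite D] (e : D ≃ E) : (I.relabel e).map = I.map.relabel e := by
  refine eq_of_face_eq_of_flip_eq (fun x => ?_) fun x => rfl
  obtain ⟨x, rfl⟩ := e.surjective x
  change _ = e (I.map.face (e.symm (e x)))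
  rw [e.symm_apply_apply]
  by_cases hx : x ∈ Set.range I.side
  · obtain ⟨d, rfl⟩ := hx
    rw [I.map_face_side, ← I.relabel_side e, map_face_side, relabel_side]
  · rw [I.map_face_of_notMem hx, map_face_of_notMem]
    · change e (U.face (e.symm (e x))) = _
      rw [e.symm_apply_apply]
    · rintro ⟨d, hd⟩
      exact hx ⟨d, e.injective hd⟩

theorem relabel_comp_iso [Finite D] (e : D ≃ E) (q : S.Edge) :
    (I.comp q).Iso (I.base q) ((I.relabel e).comp q) ((I.relabel e).base q) := by
  refine ⟨e.subtypeEquiv fun x => ?_, fun x => Subtype.ext ?_, fun x => Subtype.ext ?_, rfl⟩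
  · change _ ↔ I.part (e.symm (e x)) = q
    rw [e.symm_apply_apply]; rfl
  · change e (U.face x.1) = e (U.face (e.symm (e x.1)))
    rw [e.symm_apply_apply]
  · change e (U.flip x.1) = e (U.flip (e.symm (e x.1)))
    rw [e.symm_apply_apply]

end

/-- The glued map is determined by the isomorphism classes of the components. -/
theorem map_iso_of_comp_iso [Finite D'] {D₁ D₂ : Type} {U₁ : CombMap D₁} {U₂ : CombMap D₂}
    {S : CombMap D'} (I₁ : Insertion U₁ S) (I₂ : Insertion U₂ S)
    (h : ∀ q, (I₁.comp q).Iso (I₁.base q) (I₂.comp q) (I₂.base q)) (r : D') :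
    I₁.map.Iso (I₁.side r) I₂.map (I₂.side r) := by
  choose φ hf ha h0 using h
  let Φ : D₁ ≃ D₂ := (Equiv.sigmaFiberEquiv I₁.part).symm.trans
    ((Equiv.sigmaCongrRight φ).trans (Equiv.sigmaFiberEquiv I₂.part))
  have hΦ : ∀ x q (hx : I₁.part x = q), Φ x = (φ q ⟨x, hx⟩ : D₂) := by
    rintro x _ rfl
    rfl
  have hface : ∀ x, Φ (U₁.face x) = U₂.face (Φ x) := by
    intro x
    rw [hΦ x _ rfl, hΦ _ _ (I₁.part_face x)]
    exact congrArg Subtype.val (hf _ ⟨x, rfl⟩)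
  have hflip : ∀ x, Φ (U₁.flip x) = U₂.flip (Φ x) := by
    intro x
    rw [hΦ x _ rfl, hΦ _ _ (I₁.part_flip x)]
    exact congrArg Subtype.val (ha _ ⟨x, rfl⟩)
  have hside0 : ∀ q : S.Edge, Φ (I₁.side q.out) = I₂.side q.out := by
    intro q
    refine (hΦ (I₁.base q).1 q (I₁.base q).2).trans ?_
    exact congrArg Subtype.val (h0 q)
  have hside : ∀ d, Φ (I₁.side d) = I₂.side d := by
    intro d
    have hd : S.toEdge (S.toEdge d).out = S.toEdge d := (S.toEdge d).out_eq
    rw [eq_comm, toEdge_eq_iff] at hd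
    rcases hd with hd | hd
    · rw [hd, hside0]
    · rw [hd, ← I₁.face_side, hface, hside0, I₂.face_side]
  refine ⟨Φ, fun x => ?_, hflip, hside r⟩
  by_cases hx : x ∈ Set.range I₁.side
  · obtain ⟨d, rfl⟩ := hx
    rw [I₁.map_face_side, hside, hside, I₂.map_face_side]
  · rw [I₁.map_face_of_notMem hx, I₂.map_face_of_notMem, hface]
    rintro ⟨d, hd⟩
    rw [← hside] at hd
    exact hx ⟨d, Φ.injective hd⟩

/-- The components are determined by the isomorphism class of the glued map, if `S` is simple. -/
theorem comp_iso_of_map_iso [Finite D'] {D₁ D₂ : Type} [Finite D₁] [Finite D₂] {U₁ : CombMap D₁}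
    {U₂ : CombMap D₂} {S : CombMap D'} (I₁ : Insertion U₁ S) (I₂ : Insertion U₂ S)
    (hl : I₂.map.Loopless) (hS : S.Loopless) (hm : S.NoMultipleEdges) (hc : S.Connected) {r : D'}
    (h : I₁.map.Iso (I₁.side r) I₂.map (I₂.side r)) (q : S.Edge) :
    (I₁.comp q).Iso (I₁.base q) (I₂.comp q) (I₂.base q) := by
  obtain ⟨e, hf, ha, h0⟩ := h
  have hM : (I₁.relabel e).map = I₂.map := by
    rw [relabel_map]
    refine eq_of_face_eq_of_flip_eq (fun x => ?_) fun x => ?_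
    · change e (I₁.map.face (e.symm x)) = _
      rw [hf, e.apply_symm_apply]
    · change e (I₁.map.flip (e.symm x)) = _
      rw [ha, e.apply_symm_apply]
  refine (I₁.relabel_comp_iso e q).trans ?_
  have key : ∀ d (hd : S.toEdge d = q), ((I₁.relabel e).comp q).Iso
      ⟨(I₁.relabel e).side d, ((I₁.relabel e).part_side d).trans hd⟩
      (I₂.comp q) ⟨I₂.side d, (I₂.part_side d).trans hd⟩ := by
    rintro d rfl
    exact comp_iso_of_map_eq _ _ hM (hM ▸ hl) hS hm hc h0 d
  exact key _ q.out_eq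

/-- Every family of maps with root faces of degree 2 can be glued. -/
theorem exists_of_comp {D' : Type} [Finite D'] (S : CombMap D') {X : S.Edge → Type}
    [∀ q, Finite (X q)] (N : ∀ q, CombMap (X q)) (x : ∀ q, X q) (hc : ∀ q, (N q).Connected)
    (h2 : ∀ q, (N q).face ((N q).face (x q)) = x q) (hne : ∀ q, (N q).face (x q) ≠ x q) :
    ∃ (U : CombMap (Σ q, X q)) (I : Insertion U S),
      ∀ q, (I.comp q).Iso (I.base q) (N q) (x q) := by
  classical
  let U : CombMap (Σ q, X q) :=
    { face := Equiv.sigmaCongrRight fun q => (N q).face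
      flip := Equiv.sigmaCongrRight fun q => (N q).flip
      flip_flip := fun ⟨q, y⟩ => Sigma.ext rfl (heq_of_eq ((N q).flip_flip y))
      flip_ne := fun ⟨q, y⟩ h => (N q).flip_ne y (eq_of_heq (Sigma.mk.inj h).2) }
  have hUf : ∀ q y, U.face ⟨q, y⟩ = ⟨q, (N q).face y⟩ := fun _ _ => rfl
  have hUa : ∀ q y, U.flip ⟨q, y⟩ = ⟨q, (N q).flip y⟩ := fun _ _ => rfl
  let s : D' → Σ q, X q := fun d =>
    ⟨S.toEdge d, if (S.toEdge d).out = d then x _ else (N _).face (x _)⟩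
  have hout : ∀ d, (S.toEdge d).out = d ∨ (S.toEdge d).out = S.flip d := fun d =>
    toEdge_eq_iff.1 (S.toEdge d).out_eq
  have hs1 : ∀ d, (S.toEdge d).out = d → s d = ⟨S.toEdge d, x _⟩ := fun d hd => by
    simp only [s, if_pos hd]
  have hs2 : ∀ d, (S.toEdge d).out ≠ d → s d = ⟨S.toEdge d, (N _).face (x _)⟩ := fun d hd => by
    simp only [s, if_neg hd]
  have hsf : ∀ d, U.face (s d) = s (S.flip d) := by
    intro d
    rcases hout d with hd | hd
    · have hd' : (S.toEdge (S.flip d)).out ≠ S.flip d := by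
        rw [toEdge_flip, hd]
        exact (S.flip_ne d).symm
      rw [hs1 d hd, hs2 _ hd', hUf, toEdge_flip]
    · have hd' : (S.toEdge (S.flip d)).out = S.flip d := by rw [toEdge_flip, hd]
      have hd'' : (S.toEdge d).out ≠ d := by rw [hd]; exact S.flip_ne d
      rw [hs2 d hd'', hs1 _ hd', hUf, h2, toEdge_flip]
  have hsinj : Function.Injective s := by
    intro d d' h
    have h1 : S.toEdge d = S.toEdge d' := congrArg Sigma.fst h
    rw [toEdge_eq_iff] at h1
    rcases h1 with rfl | rfl
    · rfl
    · rw [← hsf] at h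
      exfalso
      rcases hout d' with hd | hd
      · rw [hs1 d' hd, hUf] at h
        exact hne _ (eq_of_heq (Sigma.mk.inj h).2)
      · rw [hs2 d' (by rw [hd]; exact S.flip_ne d'), hUf, h2] at h
        exact hne _ (eq_of_heq (Sigma.mk.inj h).2).symm
  have hreach : ∀ q y z, U.reach ⟨q, y⟩ ⟨q, z⟩ := by
    intro q y z
    have hle : (N q).reach ≤ U.reach.comap (Sigma.mk q) := reach_le_iff.2
      ⟨fun y => U.reach_face ⟨q, y⟩, fun y => U.reach_flip ⟨q, y⟩⟩
    exact hle (hc q y z)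
  let I : Insertion U S :=
    { side := ⟨s, hsinj⟩
      part := Sigma.fst
      face_side := hsf
      part_face := fun ⟨q, y⟩ => rfl
      part_flip := fun ⟨q, y⟩ => rfl
      part_side := fun d => rfl
      reach_of_part_eq := by
        rintro ⟨q, y⟩ ⟨q', z⟩ h
        obtain rfl : q = q' := h
        exact hreach q y z }
  refine ⟨U, I, fun q => Iso.symm ⟨(Equiv.sigmaSubtype q).symm, fun y => rfl, fun y => rfl, ?_⟩⟩
  refine Subtype.ext ?_
  have h := hs1 q.out (congrArg Quotient.out q.out_eq)
  change (⟨q, x q⟩ : Σ q, X q) = s q.out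
  rw [h, show S.toEdge q.out = q from q.out_eq]

end Insertion

end CombMap

/-! ### Core decompositions as insertions -/

theorem CombMap.IsTri.sameCycle_root_iff {D : Type} [Finite D] {N : CombMap D} {r : D}
    (h : N.IsTri r 2) {y : D} : N.face.SameCycle r y ↔ y = r ∨ y = N.face r := by
  have hne := IsPlanar.face_ne h.loopless r
  have hsub : ({r, N.face r} : Set D) ⊆ {y | N.face.SameCycle r y} := by
    rintro _ (rfl | rfl)
    · exact SameCycle.refl _ _
    · exact sameCycle_apply_self _ _
  have heq := Set.eq_of_subset_of_ncard_le hsub (by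
    rw [Set.ncard_pair hne.symm]
    exact h.root_deg.le) (Set.toFinite _)
  change y ∈ {y | N.face.SameCycle r y} ↔ _
  rw [← heq]
  rfl

theorem CombMap.IsTri.face_face_root {D : Type} [Finite D] {N : CombMap D} {r : D}
    (h : N.IsTri r 2) : N.face (N.face r) = r := by
  have : N.face.SameCycle r (N.face (N.face r)) :=
    (sameCycle_apply_self N.face r).trans (sameCycle_apply_self _ _)
  rcases h.sameCycle_root_iff.1 this with h' | h'
  · exact h'
  · exact absurd h' (IsPlanar.face_ne h.loopless _)

namespace RootedPlanarMap

open CombMap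

variable {D D' : Type} [Finite D] [Finite D'] {m : RootedPlanarMap D} {s : RootedPlanarMap D'}

omit [Finite D] in
/-- A core decomposition is an insertion: `U` is the disjoint union of the 2-gons. -/
theorem CoreDecomposition.exists_insertion (C : m.CoreDecomposition s) :
    ∃ (U : CombMap D) (I : Insertion U s.comb), I.map = m.comb ∧ I.side s.root = m.root := by
  have hd := fun e => (C.comp e).isDigon_iff_comb.1 (C.comp_digon e)
  have horient : ∀ d : D', (∃ e : C.orient, d = e) ∨ ∃ e : C.orient, d = s.flip e := by
    intro d
    by_cases h : d ∈ C.orient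
    · exact Or.inl ⟨⟨d, h⟩, rfl⟩
    · exact Or.inr ⟨⟨s.flip d, (C.orient_flip d).2 h⟩, (s.flip_flip d).symm⟩
  have hmem : ∀ e : C.orient, s.flip e ∉ C.orient := fun e h => (C.orient_flip e).1 h e.2
  have hroot : ∀ e, (C.comp e).face (C.comp e).root ≠ (C.comp e).root := fun e =>
    IsPlanar.face_ne (hd e).loopless _
  let part : D → s.comb.Edge := fun x => s.comb.toEdge (C.glue.symm x).1
  have part_glue : ∀ e y, part (C.glue ⟨e, y⟩) = s.comb.toEdge e := fun e y => by
    simp only [part, Equiv.symm_apply_apply]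
  have hinj : Function.Injective C.side := by
    intro d d' h
    rcases horient d with ⟨e, rfl⟩ | ⟨e, rfl⟩ <;> rcases horient d' with ⟨e', rfl⟩ | ⟨e', rfl⟩
    · rw [C.side_orient, C.side_orient] at h
      rw [(Sigma.mk.inj (C.glue.injective h)).1]
    · rw [C.side_orient, C.side_flip] at h
      obtain ⟨rfl, h2⟩ := Sigma.mk.inj (C.glue.injective h)
      exact absurd (eq_of_heq h2).symm (hroot e)
    · rw [C.side_orient, C.side_flip] at h
      obtain ⟨rfl, h2⟩ := Sigma.mk.inj (C.glue.injective h)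
      exact absurd (eq_of_heq h2) (hroot e)
    · rw [C.side_flip, C.side_flip] at h
      rw [(Sigma.mk.inj (C.glue.injective h)).1]
  have hside : ∀ e y, (C.comp e).OnRootFace y → C.glue ⟨e, y⟩ ∈ Set.range C.side := by
    intro e y hy
    rcases (hd e).sameCycle_root_iff.1 hy with rfl | h
    · exact ⟨e, C.side_orient e⟩
    · exact ⟨s.flip e, by rw [C.side_flip, h]; rfl⟩
  obtain ⟨U, I, h1, h2, -⟩ := Insertion.exists_of_map m.comb s.comb ⟨C.side, hinj⟩ part
    (fun d => C.face_side d)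
    (by
      intro x hx
      obtain ⟨⟨e, y⟩, rfl⟩ := C.glue.surjective x
      have : m.comb.face (C.glue ⟨e, y⟩) = _ := C.face_glue e y fun h => hx (hside e y h)
      rw [this, part_glue, part_glue])
    (by
      intro x
      obtain ⟨⟨e, y⟩, rfl⟩ := C.glue.surjective x
      have : m.comb.flip (C.glue ⟨e, y⟩) = _ := C.flip_glue e y
      rw [this, part_glue, part_glue])
    (by
      intro d
      change part (C.side d) = _
      rcases horient d with ⟨e, rfl⟩ | ⟨e, rfl⟩
      · rw [C.side_orient, part_glue]
      · rw [C.side_flip, part_glue]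
        exact (s.comb.toEdge_flip e).symm)
    (by
      intro U u1 u2 u3 x y hxy
      obtain ⟨⟨e, x⟩, rfl⟩ := C.glue.surjective x
      obtain ⟨⟨e', y⟩, rfl⟩ := C.glue.surjective y
      rw [part_glue, part_glue, toEdge_eq_iff] at hxy
      have hee : e = e' := by
        rcases hxy with h | h
        · exact Subtype.ext h
        · exact absurd (h ▸ e.2) (hmem e')
      subst hee
      have u2' : ∀ d, U.face (C.side d) = C.side (s.flip d) := u2
      have hface : ∀ z, U.face (C.glue ⟨e, z⟩) = C.glue ⟨e, (C.comp e).face z⟩ := by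
        intro z
        by_cases hz : (C.comp e).OnRootFace z
        · rcases (hd e).sameCycle_root_iff.1 hz with rfl | h
          · rw [← C.side_orient, u2', C.side_flip]
          · have hz' : z = (C.comp e).face (C.comp e).root := h
            rw [hz', ← C.side_flip, u2', s.flip_flip, C.side_orient]
            have := (hd e).face_face_root
            exact congrArg _ (Sigma.ext rfl (heq_of_eq this.symm))
        · rw [u3]
          · exact C.face_glue e z hz
          · rintro ⟨d, hd'⟩
            have hd'' : C.side d = C.glue ⟨e, z⟩ := hd'
            rcases horient d with ⟨e', rfl⟩ | ⟨e', rfl⟩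
            · rw [C.side_orient] at hd''
              obtain ⟨rfl, h2⟩ := Sigma.mk.inj (C.glue.injective hd'')
              exact hz (eq_of_heq h2 ▸ SameCycle.refl _ _)
            · rw [C.side_flip] at hd''
              obtain ⟨rfl, h2⟩ := Sigma.mk.inj (C.glue.injective hd'')
              exact hz (eq_of_heq h2 ▸ sameCycle_apply_self _ _)
      have hle : (C.comp e).comb.reach ≤ U.reach.comap fun z => C.glue ⟨e, z⟩ := by
        refine reach_le_iff.2 ⟨fun z => ?_, fun z => ?_⟩
        · have := U.reach_face (C.glue ⟨e, z⟩)
          rwa [hface] at this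
        · have := U.reach_flip (C.glue ⟨e, z⟩)
          rw [u1, show m.comb.flip (C.glue ⟨e, z⟩) = _ from C.flip_glue e z] at this
          exact this
      exact hle ((hd e).planar.connected x y))
  exact ⟨U, I, h1, by rw [h2]; exact C.root_side.symm⟩

/-- Converse of `CoreDecomposition.exists_insertion`; edges are oriented by `Quotient.out`. -/
theorem nonempty_coreDecomposition {U : CombMap D} (I : Insertion U s.comb) (hM : I.map = m.comb)
    (hr : I.side s.root = m.root)
    (hc : ∀ d, (I.comp (s.comb.toEdge d)).IsTri (I.compRoot d) 2) :
    Nonempty (m.CoreDecomposition s) := by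
  have hout : ∀ d, (s.comb.toEdge d).out = d ∨ (s.comb.toEdge d).out = s.flip d := fun d =>
    toEdge_eq_iff.1 (s.comb.toEdge d).out_eq
  have htf : ∀ d, s.comb.toEdge (s.flip d) = s.comb.toEdge d := s.comb.toEdge_flip
  let O : Set D' := {d | (s.comb.toEdge d).out = d}
  let ε := fun e : O => Finite.equivFin {x | I.part x = s.comb.toEdge e}
  let g : (Σ e : O, Fin (Nat.card {x | I.part x = s.comb.toEdge e})) → D :=
    fun t => ((ε t.1).symm t.2 : D)
  have hg : Function.Bijective g := by
    constructor
    · rintro ⟨e, i⟩ ⟨e', i'⟩ h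
      have h' : ((ε e).symm i : D) = ((ε e').symm i' : D) := h
      have h1 : s.comb.toEdge e = s.comb.toEdge e' :=
        ((ε e).symm i).2.symm.trans ((congrArg I.part h').trans ((ε e').symm i').2)
      have h2 : e = e' := Subtype.ext (e.2.symm.trans ((congrArg Quotient.out h1).trans e'.2))
      subst h2
      rw [(ε e).symm.injective (Subtype.ext h')]
    · intro x
      have hx : s.comb.toEdge (I.part x).out = I.part x := (I.part x).out_eq
      have hO : (I.part x).out ∈ O := congrArg Quotient.out hx
      exact ⟨⟨⟨_, hO⟩, ε ⟨_, hO⟩ ⟨x, hx.symm⟩⟩,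
        congrArg Subtype.val ((ε ⟨_, hO⟩).symm_apply_apply ⟨x, hx.symm⟩)⟩
  have hp := fun e : O => ((I.comp _).iso_relabel (ε e) (I.compRoot e)).isTri (hc e)
  let comp : ∀ e : O, RootedPlanarMap (Fin (Nat.card {x | I.part x = s.comb.toEdge e})) := fun e =>
    ((I.comp _).relabel (ε e)).toRooted (ε e (I.compRoot e)) (hp e).planar
  have hcomb : ∀ e, (comp e).comb = (I.comp _).relabel (ε e) := fun e => comb_toRooted _ _ _
  have hface : ∀ e, (comp e).face = ((I.comp _).relabel (ε e)).face := fun e =>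
    congrArg CombMap.face (hcomb e)
  have gface : ∀ e i, ((ε e).symm ((comp e).face i) : D) = U.face ((ε e).symm i) := by
    intro e i
    rw [hface]
    change ((ε e).symm (ε e ((I.comp _).face ((ε e).symm i))) : D) = _
    rw [Equiv.symm_apply_apply]
    rfl
  have hrf : ∀ e i, (comp e).OnRootFace i ↔ ((ε e).symm i : D) ∈ Set.range I.side := by
    intro e i
    rw [← I.compRoot_sameCycle_iff]
    change (comp e).face.SameCycle (ε e (I.compRoot e)) i ↔ _
    rw [hface]
    have h := sameCycle_map_iff (π := (I.comp (s.comb.toEdge e)).face)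
      (π' := ((I.comp (s.comb.toEdge e)).relabel (ε e)).face) (ε e).injective
      (x := I.compRoot e) (y := (ε e).symm i) fun y _ => by
        change ε e ((I.comp _).face ((ε e).symm (ε e y))) = _
        rw [Equiv.symm_apply_apply]
    rwa [Equiv.apply_symm_apply] at h
  refine ⟨⟨O, fun d => ?_, _, comp, fun e => ?_, Equiv.ofBijective g hg, I.side, fun e => ?_,
    fun e => ?_, fun e i => ?_, fun e i hi => ?_, fun d => ?_, hr.symm⟩⟩
  · change (s.comb.toEdge (s.flip d)).out = s.flip d ↔ ¬ (s.comb.toEdge d).out = d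
    rw [htf]
    rcases hout d with h | h
    · rw [h]
      exact ⟨fun h => absurd h.symm (s.flip_ne d), fun h => absurd rfl h⟩
    · rw [h]
      exact ⟨fun _ => s.flip_ne d, fun _ => rfl⟩
  · rw [isDigon_iff_comb, hcomb]
    exact hp e
  · change _ = ((ε e).symm (ε e (I.compRoot e)) : D)
    rw [Equiv.symm_apply_apply]
    rfl
  · change _ = ((ε e).symm ((comp e).face (ε e (I.compRoot e))) : D)
    rw [gface, Equiv.symm_apply_apply]
    exact (I.face_side _).symm
  · change m.comb.flip ((ε e).symm i) =
      ((ε e).symm (ε e ((I.comp _).flip ((ε e).symm i))) : D)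
    rw [Equiv.symm_apply_apply, ← hM]
    rfl
  · rw [hrf] at hi
    change m.comb.face ((ε e).symm i) = ((ε e).symm ((comp e).face i) : D)
    rw [gface, ← hM, I.map_face_of_notMem hi]
  · change m.comb.face (I.side d) = I.side (s.comb.face d)
    rw [← hM, I.map_face_side]

end RootedPlanarMap

/-! ### The simple core of an isomorphism class -/

namespace CombMap

/-- The boundary of a loopless 2-gon is simple, so that `IsDigon` describes `PlanarMap.typeII 2`. -/
theorem IsTri.simpleBoundary {D : Type} [Finite D] {N : CombMap D} {r : D} (h : N.IsTri r 2) :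
    N.SimpleBoundary r := by
  have hr : ¬ N.rot.SameCycle r (N.face r) := fun k =>
    h.loopless r (k.trans (N.sameCycle_rot_flip_face r).symm)
  intro d d' hd hd' hdd
  rcases h.sameCycle_root_iff.1 hd with rfl | rfl <;>
    rcases h.sameCycle_root_iff.1 hd' with rfl | rfl
  · rfl
  · exact absurd hdd hr
  · exact absurd hdd.symm hr
  · rfl

namespace Insertion

variable {D D' D'' : Type} {U : CombMap D} {S : CombMap D'} {S' : CombMap D''}

/-- Renaming the darts of the core. -/
noncomputable def relabelCore [Finite D'] [Finite D''] (I : Insertion U S) (e : D' ≃ D'')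
    (ha : ∀ d, e (S.flip d) = S'.flip (e d)) : Insertion U S' where
  side := e.symm.toEmbedding.trans I.side
  part x := Quotient.congr (ra := SameCycle.setoid S.flip) (rb := SameCycle.setoid S'.flip) e
    (fun _ _ => (sameCycle_map_iff e.injective fun _ _ => (ha _).symm).symm) (I.part x)
  face_side d := by
    change U.face (I.side (e.symm d)) = I.side (e.symm (S'.flip d))
    rw [I.face_side]
    congr 1
    rw [Equiv.eq_symm_apply, ha, e.apply_symm_apply]
  part_face x := by rw [I.part_face]
  part_flip x := by rw [I.part_flip]
  part_side d := by
    change Quotient.congr _ _ (I.part (I.side (e.symm d))) = S'.toEdge d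
    rw [I.part_side]
    change S'.toEdge (e (e.symm d)) = _
    rw [e.apply_symm_apply]
  reach_of_part_eq x y h := I.reach_of_part_eq x y (Equiv.injective _ h)

theorem relabelCore_side [Finite D'] [Finite D''] (I : Insertion U S) (e : D' ≃ D'')
    (ha : ∀ d, e (S.flip d) = S'.flip (e d)) (d : D') :
    (I.relabelCore e ha).side (e d) = I.side d := by
  change I.side (e.symm (e d)) = _
  rw [e.symm_apply_apply]

theorem relabelCore_map [Finite D'] [Finite D''] (I : Insertion U S) (e : D' ≃ D'')
    (ha : ∀ d, e (S.flip d) = S'.flip (e d)) (hf : ∀ d, e (S.face d) = S'.face (e d)) :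
    (I.relabelCore e ha).map = I.map := by
  refine eq_of_face_eq_of_flip_eq (fun x => ?_) fun x => rfl
  by_cases hx : x ∈ Set.range I.side
  · obtain ⟨d, rfl⟩ := hx
    rw [I.map_face_side, ← I.relabelCore_side e ha, map_face_side, ← hf, relabelCore_side]
  · rw [I.map_face_of_notMem hx, map_face_of_notMem]
    rintro ⟨d, hd⟩
    exact hx ⟨e.symm d, hd⟩

end Insertion

end CombMap

namespace PlanarMap

open CombMap

section

variable {D D' : Type} [Finite D] [Finite D'] {U : CombMap D} {S : CombMap D'} {r : D'} {p : ℕ}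

theorem isSimpleCore_of_insertion (I : Insertion U S) (hp : 3 ≤ p) (hS : S.IsTri r p)
    (hb : S.SimpleBoundary r) (hm : S.NoMultipleEdges)
    (hc : ∀ q, (I.comp q).IsTri (I.base q) 2) :
    IsSimpleCore (I.map.cls (I.side r)) (S.cls r) := by
  have hM := I.isTri_map hS (I.compRoot_isTri_of_base hc)
  obtain ⟨n, m, hmc⟩ := exists_rep (I.map.cls (I.side r))
  obtain ⟨k, s, hsc⟩ := exists_rep (S.cls r)
  refine ⟨⟨p, hp, (cls_mem_typeIII hS.planar).2 ⟨⟨hS, hb⟩, hm⟩⟩, n, k, m, s, hmc, hsc, ?_⟩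
  obtain ⟨e, ef, ea, e0⟩ := ((mk_eq_cls_iff hM.planar).1 hmc).symm
  obtain ⟨g, gf, ga, g0⟩ := ((mk_eq_cls_iff hS.planar).1 hsc).symm
  let I' := (I.relabel e).relabelCore g ga
  have hI' : I'.map = m.comb := by
    rw [Insertion.relabelCore_map _ _ _ gf, Insertion.relabel_map]
    refine eq_of_face_eq_of_flip_eq (fun x => ?_) fun x => ?_
    · change e (I.map.face (e.symm x)) = _
      rw [ef, e.apply_symm_apply]
    · change e (I.map.flip (e.symm x)) = _
      rw [ea, e.apply_symm_apply]
  have hr' : I'.side s.root = m.root := by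
    rw [← g0, Insertion.relabelCore_side, Insertion.relabel_side, e0]
  have hs : s.comb.IsPlanar := s.comb_isPlanar
  refine RootedPlanarMap.nonempty_coreDecomposition I' hI' hr' fun d => ?_
  refine I'.comp_isTri (r := s.root) (p := p) ?_ hs d
  rw [hI', hr']
  exact ((mk_eq_cls_iff hM.planar).1 hmc).symm.isTri hM

/-- `c` is obtained by gluing into every edge `q` of `S` the triangulation `f q` of the 2-gon. -/
def IsGluing (S : CombMap D') (r : D') (f : S.Edge → typeII 2) (c : PlanarMap) : Prop :=
  ∃ (D : Type) (_ : Finite D) (U : CombMap D) (I : Insertion U S),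
    (∀ q, (I.comp q).IsTri (I.base q) 2 ∧ (I.comp q).cls (I.base q) = f q) ∧
      I.map.cls (I.side r) = c

theorem exists_isGluing (S : CombMap D') (r : D') (f : S.Edge → typeII 2) :
    ∃ c, IsGluing S r f c := by
  choose n N x hN hf using fun q => exists_eq_cls (f q : PlanarMap)
  have ht : ∀ q, (N q).IsTri (x q) 2 := fun q =>
    ((cls_mem_typeII (hN q)).1 (hf q ▸ (f q).2)).1
  obtain ⟨U, I, hI⟩ := Insertion.exists_of_comp S N x (fun q => (hN q).connected)
    (fun q => (ht q).face_face_root) fun q => IsPlanar.face_ne (ht q).loopless _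
  exact ⟨_, _, inferInstance, U, I, fun q => ⟨(hI q).symm.isTri (ht q),
    (hI q).cls_eq.trans (hf q).symm⟩, rfl⟩

variable {f f' : S.Edge → typeII 2} {c c' : PlanarMap}

theorem IsGluing.mem_typeII (hS : S.IsTri r p) (hb : S.SimpleBoundary r) (h : IsGluing S r f c) :
    c ∈ typeII p := by
  obtain ⟨D, hD, U, I, h1, rfl⟩ := h
  have hM := I.isTri_map hS (I.compRoot_isTri_of_base fun q => (h1 q).1)
  exact (cls_mem_typeII hM.planar).2 ⟨hM, (I.simpleBoundary_map
    (I.transversal_of_map hM.loopless)).2 hb⟩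

theorem IsGluing.num (hS : S.IsTri r p) [Fintype S.Edge] (h : IsGluing S r f c) :
    c.numVertices + 2 * (S.cls r).numEdges =
      (S.cls r).numVertices + ∑ q, (f q : PlanarMap).numVertices ∧
    c.numEdges = ∑ q, (f q : PlanarMap).numEdges := by
  obtain ⟨D, hD, U, I, h1, rfl⟩ := h
  have hM := I.isTri_map hS (I.compRoot_isTri_of_base fun q => (h1 q).1)
  obtain ⟨e1, -, e3⟩ := I.numCycles_eq_sum
  rw [numVertices_cls hM.planar, numEdges_cls hM.planar, numVertices_cls hS.planar,
    numEdges_cls hS.planar, I.map_numCycles_rot (I.transversal_of_map hM.loopless), I.map_flip, e1,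
    e3, add_comm]
  refine ⟨congrArg _ (Finset.sum_congr rfl fun q _ => ?_), Finset.sum_congr rfl fun q _ => ?_⟩
  · rw [← (h1 q).2, numVertices_cls (h1 q).1.planar]
  · rw [← (h1 q).2, numEdges_cls (h1 q).1.planar]

theorem IsGluing.eq_of_eq (h : IsGluing S r f c) (h' : IsGluing S r f c') : c = c' := by
  obtain ⟨D, hD, U, I, h1, rfl⟩ := h
  obtain ⟨D', hD', U', I', h1', rfl⟩ := h'
  refine (I.map_iso_of_comp_iso I' (fun q => ?_) r).cls_eq
  exact (cls_eq_cls_iff (h1 q).1.planar (h1' q).1.planar).1 ((h1 q).2.trans (h1' q).2.symm)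

theorem IsGluing.injective (hS : S.IsTri r p) (hm : S.NoMultipleEdges) (h : IsGluing S r f c)
    (h' : IsGluing S r f' c) : f = f' := by
  obtain ⟨D, hD, U, I, h1, rfl⟩ := h
  obtain ⟨D', hD', U', I', h1', hc⟩ := h'
  have hM := I.isTri_map hS (I.compRoot_isTri_of_base fun q => (h1 q).1)
  have hM' := I'.isTri_map hS (I'.compRoot_isTri_of_base fun q => (h1' q).1)
  rw [cls_eq_cls_iff hM'.planar hM.planar] at hc
  funext q
  refine Subtype.ext ?_
  rw [← (h1 q).2, ← (h1' q).2]
  exact (I'.comp_iso_of_map_iso I hM.loopless hS.loopless hm hS.planar.connected hc q).cls_eq.symm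

end

theorem IsSimpleCore.exists_insertion {k : ℕ} {s : RootedPlanarMap (Fin k)} {c : PlanarMap}
    (h : IsSimpleCore c (mk s)) : ∃ (n : ℕ) (m : RootedPlanarMap (Fin n)) (U : CombMap (Fin n))
      (I : Insertion U s.comb), mk m = c ∧ I.map = m.comb ∧ I.side s.root = m.root := by
  obtain ⟨-, n, k', m, s', rfl, hs, ⟨C⟩⟩ := h
  obtain ⟨U, I, h1, h2⟩ := C.exists_insertion
  obtain ⟨g, gf, ga, g0⟩ := mk_eq_mk_iff.1 hs
  refine ⟨n, m, U, I.relabelCore g ga, rfl, ?_, ?_⟩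
  · rw [Insertion.relabelCore_map _ _ _ gf, h1]
  · rw [← g0, Insertion.relabelCore_side, h2]

theorem mk_mem_typeII_iff {n : ℕ} {m : RootedPlanarMap (Fin n)} {p : ℕ} :
    mk m ∈ typeII p ↔ m.comb.IsTri m.root p ∧ m.comb.SimpleBoundary m.root := by
  rw [← cls_comb, cls_mem_typeII m.comb_isPlanar]

theorem mk_mem_typeIII_iff {n : ℕ} {m : RootedPlanarMap (Fin n)} {p : ℕ} :
    mk m ∈ typeIII p ↔ (m.comb.IsTri m.root p ∧ m.comb.SimpleBoundary m.root) ∧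
      m.comb.NoMultipleEdges := by
  rw [← cls_comb, cls_mem_typeIII m.comb_isPlanar]

theorem IsSimpleCore.mem_typeIII {c S : PlanarMap} {p : ℕ} (h : IsSimpleCore c S)
    (hc : c ∈ typeII p) : S ∈ typeIII p := by
  obtain ⟨k, s, rfl⟩ := exists_rep S
  obtain ⟨n, m, U, I, rfl, hM, hr⟩ := h.exists_insertion
  obtain ⟨⟨q, -, hq⟩, -⟩ := h
  have hq' := (mk_mem_typeIII_iff.1 hq).1.1.root_deg
  have hp' := (mk_mem_typeII_iff.1 hc).1.root_deg
  rw [← hM, ← hr, card_sameCycle_map I.side.injective fun _ _ => I.map_face_side _, hq'] at hp'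
  exact hp' ▸ hq

theorem IsSimpleCore.unique {c S S' : PlanarMap} {p : ℕ} (hc : c ∈ typeII p)
    (h : IsSimpleCore c S) (h' : IsSimpleCore c S') : S = S' := by
  obtain ⟨k, s, rfl⟩ := exists_rep S
  obtain ⟨k', s', rfl⟩ := exists_rep S'
  have hs := mk_mem_typeIII_iff.1 (h.mem_typeIII hc)
  have hs' := mk_mem_typeIII_iff.1 (h'.mem_typeIII hc)
  obtain ⟨n, m, U, I, rfl, hM, hr⟩ := h.exists_insertion
  obtain ⟨n', m', U', I', hm', hM', hr'⟩ := h'.exists_insertion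
  obtain ⟨e, ef, ea, e0⟩ := mk_eq_mk_iff.1 hm'.symm
  have hI : (I.relabel e).map = I'.map := by
    rw [Insertion.relabel_map, hM, hM']
    refine eq_of_face_eq_of_flip_eq (fun x => ?_) fun x => ?_
    · change e (m.comb.face (e.symm x)) = _
      rw [ef, e.apply_symm_apply]
    · change e (m.comb.flip (e.symm x)) = _
      rw [ea, e.apply_symm_apply]
  have hl : m'.comb.Loopless := (mk_mem_typeII_iff.1 (hm'.symm ▸ hc)).1.loopless
  refine mk_eq_mk_iff.2 (Insertion.iso_of_map_eq (I.relabel e) I' hI (by rw [hI, hM']; exact hl)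
    hs.1.1.loopless hs.2 hs'.1.1.loopless hs'.2 s.comb_isPlanar.connected
    s'.comb_isPlanar.connected ?_)
  rw [Insertion.relabel_side, hr, e0, hr']

theorem existsUnique_isSimpleCore {c : PlanarMap} {p : ℕ} (hp : 3 ≤ p) (hc : c ∈ typeII p) :
    ∃! S, IsSimpleCore c S := by
  obtain ⟨n, N, x, hN, rfl⟩ := exists_eq_cls c
  have h := (cls_mem_typeII hN).1 hc
  obtain ⟨D', hD', S, r', U, I, rfl, rfl, hS, hb, hm⟩ := h.1.exists_insertion h.2
  have hI := isSimpleCore_of_insertion I hp hS hb hm (I.comp_isTri_base h.1 hS.planar)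
  exact ⟨_, hI, fun S' h' => h'.unique hc hI⟩

theorem simpleCore_eq_iff {c S : PlanarMap} {p : ℕ} (hp : 3 ≤ p) (hc : c ∈ typeII p) :
    c.simpleCore = S ↔ IsSimpleCore c S := by
  have h := (existsUnique_isSimpleCore hp hc).exists
  have hs : IsSimpleCore c c.simpleCore := by
    rw [simpleCore, dif_pos h]
    exact h.choose_spec
  exact ⟨fun e => e ▸ hs, fun h' => hs.unique hc h'⟩

/-- The triangulations of the `p`-gon with a given simple core correspond to the families of
triangulations of the 2-gon indexed by the edges of the core. -/
theorem exists_core_equiv {k : ℕ} {s : RootedPlanarMap (Fin k)} {p : ℕ} (hp : 3 ≤ p)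
    (hs : mk s ∈ typeIII p) [Fintype s.comb.Edge] :
    ∃ Φ : (s.comb.Edge → typeII 2) ≃ {c // c ∈ typeII p ∧ c.simpleCore = mk s}, ∀ f,
      (Φ f).1.numVertices + 2 * (mk s).numEdges =
        (mk s).numVertices + ∑ q, (f q : PlanarMap).numVertices ∧
      (Φ f).1.numEdges = ∑ q, (f q : PlanarMap).numEdges := by
  obtain ⟨⟨hS, hb⟩, hm⟩ := mk_mem_typeIII_iff.1 hs
  choose g hg using exists_isGluing s.comb s.root
  have hg1 : ∀ f, g f ∈ typeII p := fun f => (hg f).mem_typeII hS hb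
  have hg2 : ∀ f, (g f).simpleCore = mk s := by
    intro f
    rw [simpleCore_eq_iff hp (hg1 f)]
    obtain ⟨D, hD, U, I, h1, h2⟩ := hg f
    rw [← h2, ← cls_comb]
    exact isSimpleCore_of_insertion I hp hS hb hm fun q => (h1 q).1
  refine ⟨Equiv.ofBijective (fun f => ⟨g f, hg1 f, hg2 f⟩) ⟨fun f f' h => ?_, ?_⟩, fun f => ?_⟩
  · have h' : g f = g f' := Subtype.ext_iff.1 h
    exact (hg f).injective hS hm (h' ▸ hg f')
  · rintro ⟨c, hc, hcs⟩
    have hcore := (simpleCore_eq_iff hp hc).1 hcs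
    obtain ⟨n, m, U, I, rfl, hM, hr⟩ := hcore.exists_insertion
    have hM' := (mk_mem_typeII_iff.1 hc).1
    rw [← hM, ← hr] at hM'
    have hq := I.comp_isTri_base hM' hS.planar
    refine ⟨fun q => ⟨(I.comp q).cls (I.base q), (cls_mem_typeII (hq q).planar).2
      ⟨hq q, (hq q).simpleBoundary⟩⟩, Subtype.ext ?_⟩
    refine (hg _).eq_of_eq ⟨_, inferInstance, U, I, fun q => ⟨hq q, rfl⟩, ?_⟩
    rw [hM, hr, cls_comb]
  · have := (hg f).num hS
    rwa [cls_comb] at this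

end PlanarMap

/-! ### The weak law of large numbers for product measures -/

section WeakLaw

open ProbabilityTheory

/-- The weak law of large numbers, with a rate which depends only on the number of factors. -/
theorem exists_weak_law {T : Type} [MeasurableSpace T] (ν : Measure T) [IsProbabilityMeasure ν]
    {g : T → ℝ} (hg : Measurable g) (hint : Integrable g ν) {ε : ℝ} (hε : 0 < ε) :
    ∃ δ : ℕ → ℝ≥0∞, Tendsto δ atTop (𝓝 0) ∧ ∀ (ι : Type) [Fintype ι],
      Measure.pi (fun _ : ι => ν)
        {f | ε ≤ |(∑ q, g (f q)) / (Fintype.card ι : ℝ) - ∫ x, g x ∂ν|} = δ (Fintype.card ι) := by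
  let P : Measure (ℕ → T) := Measure.infinitePi fun _ => ν
  have heval : ∀ i, P.map (fun ω => ω i) = ν := fun i => Measure.infinitePi_map_eval _ i
  have hmp : ∀ i, MeasurePreserving (fun ω : ℕ → T => ω i) P ν := fun i =>
    ⟨measurable_pi_apply i, heval i⟩
  have hmap : ∀ i, P.map (fun ω => g (ω i)) = ν.map g := fun i => by
    rw [← heval i, Measure.map_map hg (measurable_pi_apply i)]
    rfl
  have hind : iIndepFun (fun (i : ℕ) (ω : ℕ → T) => g (ω i)) P := iIndepFun_infinitePi fun _ => hg
  have hind' : iIndepFun (fun (i : ℕ) (ω : ℕ → T) => ω i) P :=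
    iIndepFun_infinitePi (X := fun _ => id) fun _ => measurable_id
  have hgm : ∀ i, Measurable fun ω : ℕ → T => g (ω i) := fun i => hg.comp (measurable_pi_apply i)
  have hlln := strong_law_ae_real (μ := P) (fun i ω => g (ω i))
    ((hmp 0).integrable_comp_of_integrable hint) (fun i j hij => hind.indepFun hij)
    (fun i => ⟨(hgm i).aemeasurable, (hgm 0).aemeasurable, by rw [hmap, hmap]⟩)
  have hmean : ∫ ω, g (ω 0) ∂P = ∫ x, g x ∂ν := by
    rw [← heval 0, integral_map (measurable_pi_apply 0).aemeasurable]
    · rw [heval 0]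
      exact hint.1
  rw [hmean] at hlln
  have hmeas : ∀ n : ℕ, Measurable fun ω : ℕ → T => (∑ i ∈ Finset.range n, g (ω i)) / (n : ℝ) :=
    fun n => (Finset.measurable_fun_sum _ fun i _ => hgm i).div_const _
  have hconv := tendstoInMeasure_of_tendsto_ae (fun n => (hmeas n).aestronglyMeasurable) hlln
  refine ⟨fun n => P {ω | ε ≤ |(∑ i ∈ Finset.range n, g (ω i)) / (n : ℝ) - ∫ x, g x ∂ν|}, ?_, ?_⟩
  · have := tendstoInMeasure_iff_dist.1 hconv ε hε
    simpa only [Real.dist_eq] using this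
  · intro ι _
    let e : ι ≃ Fin (Fintype.card ι) := Fintype.equivFin ι
    let j : ι → ℕ := fun q => e q
    have hj : Function.Injective j := Fin.val_injective.comp e.injective
    have hpi : Measure.pi (fun _ : ι => ν) = P.map fun ω q => ω (j q) := by
      rw [(iIndepFun_iff_map_fun_eq_pi_map fun q =>
        (measurable_pi_apply (j q)).aemeasurable).1 (hind'.precomp hj)]
      congr 1
      funext q
      exact (heval (j q)).symm
    rw [hpi, Measure.map_apply (measurable_pi_lambda _ fun q => measurable_pi_apply (j q))]
    · congr 1
      ext ω
      have : ∑ q, g (ω (j q)) = ∑ i ∈ Finset.range (Fintype.card ι), g (ω i) := by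
        rw [← Fin.sum_univ_eq_sum_range fun i => g (ω i)]
        exact Equiv.sum_comp e fun i : Fin (Fintype.card ι) => g (ω i)
      rw [Set.mem_preimage, Set.mem_ofPred_eq, Set.mem_ofPred_eq, this]
    · refine measurableSet_le measurable_const ?_
      have : Measurable fun f : ι → T => (∑ q, g (f q)) / (Fintype.card ι : ℝ) :=
        (Finset.measurable_fun_sum _ fun q _ => hg.comp (measurable_pi_apply q)).div_const _
      exact (this.sub_const _).abs

end WeakLaw

/-! ### The law of the core -/

theorem CombMap.SimpleBoundary.le_numCycles {D : Type} [Finite D] {N : CombMap D} {r : D} {p : ℕ}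
    (hb : N.SimpleBoundary r) (h : N.IsTri r p) : p ≤ numCycles N.rot := by
  rw [← h.root_deg]
  refine Nat.card_le_card_of_injective
    (fun d => (Quotient.mk (SameCycle.setoid N.rot) d.1)) fun d d' hd => ?_
  exact Subtype.ext (hb _ _ d.2 d'.2 (Quotient.exact hd))

namespace PlanarMap

instance : Countable PlanarMap := by
  have : ∀ n, Finite (RootedPlanarMap (Fin n)) := fun n => by
    refine Finite.of_injective (fun m : RootedPlanarMap (Fin n) => (m.rot, m.flip, m.root)) ?_
    rintro ⟨_, _, _, _, _, _, _, _⟩ ⟨_, _, _, _, _, _, _, _⟩ h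
    simp only [Prod.mk.injEq] at h
    obtain ⟨rfl, rfl, rfl⟩ := h
    rfl
  exact Quotient.countable

theorem typeIII_subset_typeII (p : ℕ) : typeIII p ⊆ typeII p := by
  intro c hc
  obtain ⟨n, m, rfl⟩ := CombMap.exists_rep c
  exact mk_mem_typeII_iff.2 (mk_mem_typeIII_iff.1 hc).1

/-- The boundary visits `p` vertices, and Euler's formula then gives as many edges. -/
theorem le_numEdges {c : PlanarMap} {p : ℕ} (hp : 3 ≤ p) (hc : c ∈ typeII p) :
    p ≤ c.numEdges := by
  have h := card_edges hc
  obtain ⟨n, N, x, hN, rfl⟩ := CombMap.exists_eq_cls c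
  obtain ⟨h1, h2⟩ := (CombMap.cls_mem_typeII hN).1 hc
  have h3 := h2.le_numCycles h1
  rw [← CombMap.numVertices_cls (x := x) hN] at h3
  omega

/-- The Boltzmann law of type II triangulations of the 2-gon. -/
noncomputable def digonLaw : Measure (typeII 2) :=
  Measure.sum fun d => (((2 / 27 : ℝ≥0) ^ (d.1.numVertices - 2) * (8 / 9) : ℝ≥0) : ℝ≥0∞) •
    Measure.dirac d

theorem digonLaw_singleton (d : typeII 2) :
    digonLaw {d} = (((2 / 27 : ℝ≥0) ^ (d.1.numVertices - 2) * (8 / 9) : ℝ≥0) : ℝ≥0∞) :=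
  Measure.sum_smul_dirac_singleton

instance : IsProbabilityMeasure digonLaw := by
  constructor
  have h : HasSum (fun d : typeII 2 => (2 / 27 : ℝ≥0) ^ (d.1.numVertices - 2) * (8 / 9)) 1 := by
    rw [← NNReal.hasSum_coe]
    have := hasSum_digon.mul_right (8 / 9)
    norm_num at this
    push_cast
    exact this
  rw [digonLaw, Measure.sum_apply _ MeasurableSet.univ]
  simp only [Measure.smul_apply, measure_univ, smul_eq_mul, mul_one]
  rw [ENNReal.tsum_coe_eq h, ENNReal.coe_one]

theorem integrable_numEdges : Integrable (fun d : typeII 2 => (d.1.numEdges : ℝ)) digonLaw := by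
  refine ⟨(measurable_of_countable _).aestronglyMeasurable, ?_⟩
  rw [HasFiniteIntegral, lintegral_countable']
  have h : ∀ d : typeII 2, ‖(d.1.numEdges : ℝ)‖ₑ * digonLaw {d} = ENNReal.ofReal
      ((d.1.numEdges : ℝ) * (2 / 27 : ℝ) ^ (d.1.numVertices - 2) * (8 / 9)) := by
    intro d
    rw [digonLaw_singleton, Real.enorm_eq_ofReal (by positivity), ENNReal.coe_nnreal_eq,
      ← ENNReal.ofReal_mul (by positivity)]
    congr 1
    push_cast
    ring
  rw [tsum_congr h, ← ENNReal.ofReal_tsum_of_nonneg (fun d => by positivity)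
    (hasSum_digon_numEdges.mul_right (8 / 9)).summable]
  exact ENNReal.ofReal_lt_top

theorem integral_numEdges : ∫ d : typeII 2, (d.1.numEdges : ℝ) ∂digonLaw = 2 := by
  rw [integral_countable integrable_numEdges]
  have h := hasSum_digon_numEdges.mul_right (8 / 9)
  norm_num at h
  rw [← h.tsum_eq]
  refine tsum_congr fun d => ?_
  rw [Measure.real, digonLaw_singleton, ENNReal.coe_toReal, smul_eq_mul]
  push_cast
  ring

/-- The total weight of the elements of `A` in `Δ`. -/
noncomputable def mass (Δ : Set PlanarMap) (ρ : ℝ≥0) (A : Set PlanarMap) : ℝ≥0∞ :=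
  ∑' M : Δ, ((ρ ^ numVertices M.1 : ℝ≥0) : ℝ≥0∞) * A.indicator 1 M.1

theorem boltzmann_apply (Δ : Set PlanarMap) (ρ : ℝ≥0) (A : Set PlanarMap) :
    boltzmann Δ ρ A = (mass Δ ρ Set.univ)⁻¹ * mass Δ ρ A := by
  have h : ∀ B : Set PlanarMap, (Measure.sum fun M : Δ =>
      ((ρ ^ numVertices M.1 : ℝ≥0) : ℝ≥0∞) • Measure.dirac M.1) B = mass Δ ρ B := by
    intro B
    rw [Measure.sum_apply _ (DiscreteMeasurableSpace.forall_measurableSet B), mass]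
    refine tsum_congr fun M => ?_
    rw [Measure.smul_apply, Measure.dirac_apply, smul_eq_mul]
  rw [boltzmann, Measure.smul_apply, h, h, smul_eq_mul]

/-- Conditionally on its core `S`, a Boltzmann triangulation of type II is obtained by gluing
independent Boltzmann triangulations of the 2-gon into the edges of `S`. The weight of `S` changes
from `2 / 27` to `2 / 27 * (9 / 8) ^ 3 = 27 / 256` per vertex, as the number of edges of `S` is
three times its number of vertices, up to an additive constant. -/
theorem exists_law {p : ℕ} (hp : 3 ≤ p) {S : PlanarMap} (hS : S ∈ typeIII p) :
    ∃ (ι : Type) (_ : Fintype ι) (Ψ : (ι → typeII 2) → PlanarMap),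
      Fintype.card ι = S.numEdges ∧ (∀ f, (Ψ f).numEdges = ∑ q, (f q).1.numEdges) ∧
      (∀ f, (Ψ f).simpleCore = S) ∧ ∀ A : Set PlanarMap,
        ∑' M : {c // c ∈ typeII p ∧ c.simpleCore = S},
          (((2 / 27 : ℝ≥0) ^ numVertices M.1 : ℝ≥0) : ℝ≥0∞) * A.indicator 1 M.1 =
        (((8 / 9 : ℝ≥0) ^ (p + 3) * (27 / 256) ^ S.numVertices : ℝ≥0) : ℝ≥0∞) *
          Measure.pi (fun _ : ι => digonLaw) {f | Ψ f ∈ A} := by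
  classical
  obtain ⟨k, s, rfl⟩ := CombMap.exists_rep S
  have := Fintype.ofFinite s.comb.Edge
  obtain ⟨Φ, hΦ⟩ := exists_core_equiv hp hS
  have hcard : Fintype.card s.comb.Edge = (mk s).numEdges := Nat.card_eq_fintype_card.symm
  refine ⟨s.comb.Edge, this, fun f => (Φ f).1, hcard, fun f => (hΦ f).2, fun f => (Φ f).2.2,
    fun A => ?_⟩
  have hE := card_edges (typeIII_subset_typeII p hS)
  have hconst : (2 / 27 : ℝ≥0) ^ (mk s).numVertices * (9 / 8) ^ (mk s).numEdges =
      (8 / 9) ^ (p + 3) * (27 / 256) ^ (mk s).numVertices := by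
    rw [show (27 / 256 : ℝ≥0) = 2 / 27 * (9 / 8) ^ 3 by norm_num, mul_pow, ← pow_mul, ← hE,
      add_assoc, pow_add (9 / 8 : ℝ≥0) _ (p + 3)]
    have h1 : (8 / 9 : ℝ≥0) ^ (p + 3) * (9 / 8) ^ (p + 3) = 1 := by
      rw [← mul_pow]; norm_num
    calc _ = (2 / 27 : ℝ≥0) ^ (mk s).numVertices * (9 / 8) ^ (mk s).numEdges *
          ((8 / 9 : ℝ≥0) ^ (p + 3) * (9 / 8) ^ (p + 3)) := by rw [h1, mul_one]
      _ = _ := by ring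
  have hw : ∀ f, (((2 / 27 : ℝ≥0) ^ numVertices (Φ f).1 : ℝ≥0) : ℝ≥0∞) =
      (((8 / 9 : ℝ≥0) ^ (p + 3) * (27 / 256) ^ (mk s).numVertices : ℝ≥0) : ℝ≥0∞) *
        Measure.pi (fun _ => digonLaw) {f} := by
    intro f
    rw [Measure.pi_singleton, Finset.prod_congr rfl fun q _ => digonLaw_singleton (f q),
      ← ENNReal.ofNNReal_finsetProd, ← ENNReal.coe_mul, ENNReal.coe_inj, ← hconst,
      Finset.prod_mul_distrib, Finset.prod_const, Finset.card_univ, hcard,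
      Finset.prod_pow_eq_pow_sum]
    have h1 : (Φ f).1.numVertices = (mk s).numVertices +
        ∑ q, ((f q).1.numVertices - 2) := by
      have h2 := (hΦ f).1
      have h3 : ∑ q, (f q).1.numVertices = ∑ q, ((f q).1.numVertices - 2) +
          2 * (mk s).numEdges := by
        rw [← hcard, mul_comm, ← smul_eq_mul, ← Finset.card_univ, ← Finset.sum_const,
          ← Finset.sum_add_distrib]
        exact Finset.sum_congr rfl fun q _ => (Nat.sub_add_cancel (two_le_numVertices _)).symm
      omega
    have h4 : (9 / 8 : ℝ≥0) ^ (mk s).numEdges * (8 / 9) ^ (mk s).numEdges = 1 := by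
      rw [← mul_pow]; norm_num
    rw [h1, pow_add]
    calc _ = (2 / 27 : ℝ≥0) ^ (mk s).numVertices * (2 / 27) ^ (∑ q, ((f q).1.numVertices - 2)) *
          ((9 / 8 : ℝ≥0) ^ (mk s).numEdges * (8 / 9) ^ (mk s).numEdges) := by rw [h4, mul_one]
      _ = _ := by ring
  have hm : MeasurableSet {f | (Φ f).1 ∈ A} := (Set.to_countable _).measurableSet
  rw [← Φ.tsum_eq, ← Measure.tsum_indicator_apply_singleton _ _ hm, ← ENNReal.tsum_mul_left]
  refine tsum_congr fun f => ?_
  rw [hw]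
  by_cases hf : (Φ f).1 ∈ A
  · rw [Set.indicator_of_mem hf, Set.indicator_of_mem (show f ∈ {f | (Φ f).1 ∈ A} from hf),
      Pi.one_apply, mul_one]
  · rw [Set.indicator_of_notMem hf,
      Set.indicator_of_notMem (show f ∉ {f | (Φ f).1 ∈ A} from hf), mul_zero, mul_zero]

/-- The triangulations of the `p`-gon, sorted by their cores. -/
theorem mass_typeII {p : ℕ} (hp : 3 ≤ p) (A : Set PlanarMap) :
    mass (typeII p) (2 / 27) A = ∑' S : typeIII p,
      ∑' M : {c // c ∈ typeII p ∧ c.simpleCore = S},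
        (((2 / 27 : ℝ≥0) ^ numVertices M.1 : ℝ≥0) : ℝ≥0∞) * A.indicator 1 M.1 := by
  let F : (Σ S : typeIII p, {c // c ∈ typeII p ∧ c.simpleCore = S}) → typeII p :=
    fun t => ⟨t.2.1, t.2.2.1⟩
  have hF : Function.Bijective F := by
    constructor
    · rintro ⟨⟨S, hS⟩, c, hc, hcS⟩ ⟨⟨S', hS'⟩, c', hc', hcS'⟩ h
      obtain rfl : c = c' := Subtype.ext_iff.1 h
      obtain rfl : S = S' := hcS.symm.trans hcS'
      rfl
    · rintro ⟨c, hc⟩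
      exact ⟨⟨⟨c.simpleCore, ((simpleCore_eq_iff hp hc).1 rfl).mem_typeIII hc⟩, c, hc, rfl⟩, rfl⟩
  rw [mass, ← (Equiv.ofBijective F hF).tsum_eq, ENNReal.tsum_sigma']
  rfl

/-- On type III triangulations, the image of the weights of type II under the core is proportional
to the weights of type III. -/
theorem mass_typeII_preimage {p : ℕ} (hp : 3 ≤ p) (B : Set PlanarMap) :
    mass (typeII p) (2 / 27) (simpleCore ⁻¹' B) =
      ((8 / 9 : ℝ≥0) ^ (p + 3) : ℝ≥0) * mass (typeIII p) (27 / 256) B := by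
  rw [mass_typeII hp, mass, ← ENNReal.tsum_mul_left]
  refine tsum_congr fun S => ?_
  obtain ⟨ι, _, Ψ, -, -, h1, h2⟩ := exists_law hp S.2
  rw [h2, ENNReal.coe_mul, mul_assoc]
  congr 2
  by_cases hS : S.1 ∈ B
  · rw [Set.indicator_of_mem hS]
    have : {f | Ψ f ∈ simpleCore ⁻¹' B} = Set.univ := Set.eq_univ_of_forall fun f => by
      rw [Set.mem_ofPred_eq, Set.mem_preimage, h1]
      exact hS
    rw [this, measure_univ]
    rfl
  · rw [Set.indicator_of_notMem hS]
    have : {f | Ψ f ∈ simpleCore ⁻¹' B} = ∅ := Set.eq_empty_of_forall_notMem fun f hf => by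
      rw [Set.mem_ofPred_eq, Set.mem_preimage, h1] at hf
      exact hS hf
    rw [this, measure_empty]

theorem mass_typeII_univ_ne {p : ℕ} (hp : 3 ≤ p) :
    mass (typeII p) (2 / 27) Set.univ ≠ 0 ∧ mass (typeII p) (2 / 27) Set.univ ≠ ∞ := by
  have h : mass (typeII p) (2 / 27) Set.univ =
      ∑' c : typeII p, (2 / 27 : ℝ≥0∞) ^ c.1.numVertices := by
    refine tsum_congr fun c => ?_
    rw [Set.indicator_univ, Pi.one_apply, mul_one, ENNReal.coe_pow, ENNReal.coe_div (by norm_num)]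
    rfl
  rw [h]
  refine ⟨fun h0 => ?_, tsum_typeII_ne_top (by omega)⟩
  obtain ⟨c, hc⟩ := typeII_nonempty (p := p) (by omega)
  have := ENNReal.tsum_eq_zero.1 h0 ⟨c, hc⟩
  refine pow_ne_zero _ ?_ this
  exact (ENNReal.div_pos (by norm_num) (by norm_num)).ne'

theorem mass_typeIII_univ_ne {p : ℕ} (hp : 3 ≤ p) :
    mass (typeIII p) (27 / 256) Set.univ ≠ 0 ∧ mass (typeIII p) (27 / 256) Set.univ ≠ ∞ := by
  obtain ⟨h0, h1⟩ := mass_typeII_univ_ne hp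
  have h := mass_typeII_preimage hp Set.univ
  rw [Set.preimage_univ] at h
  rw [h] at h0 h1
  have hκ : (((8 / 9 : ℝ≥0) ^ (p + 3) : ℝ≥0) : ℝ≥0∞) ≠ 0 := by
    rw [ENNReal.coe_ne_zero]; positivity
  exact ⟨right_ne_zero_of_mul h0, fun h2 => h1 (by rw [h2, ENNReal.mul_top hκ])⟩

theorem isProbabilityMeasure_boltzmann {Δ : Set PlanarMap} {ρ : ℝ≥0}
    (h : mass Δ ρ Set.univ ≠ 0 ∧ mass Δ ρ Set.univ ≠ ∞) : IsProbabilityMeasure (boltzmann Δ ρ) :=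
  ⟨by rw [boltzmann_apply, ENNReal.inv_mul_cancel h.1 h.2]⟩

theorem map_simpleCore_bolII {p : ℕ} (hp : 3 ≤ p) : (bolII p).map simpleCore = bolIII p := by
  ext B hB
  have hκ : (((8 / 9 : ℝ≥0) ^ (p + 3) : ℝ≥0) : ℝ≥0∞) ≠ 0 := by
    rw [ENNReal.coe_ne_zero]; positivity
  have hu := mass_typeII_preimage hp Set.univ
  rw [Set.preimage_univ] at hu
  rw [Measure.map_apply (measurable_of_countable _) hB, bolII, bolIII, boltzmann_apply,
    boltzmann_apply, hu, mass_typeII_preimage hp, ENNReal.mul_inv (Or.inl hκ)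
      (Or.inl ENNReal.coe_ne_top)]
  calc _ = ((((8 / 9 : ℝ≥0) ^ (p + 3) : ℝ≥0) : ℝ≥0∞)⁻¹ * (((8 / 9 : ℝ≥0) ^ (p + 3) : ℝ≥0) : ℝ≥0∞)) *
        ((mass (typeIII p) (27 / 256) Set.univ)⁻¹ * mass (typeIII p) (27 / 256) B) := by ring
    _ = _ := by rw [ENNReal.inv_mul_cancel hκ ENNReal.coe_ne_top, one_mul]

/-- The number of edges of a Boltzmann triangulation with core `S` is a sum of `S.numEdges ≥ p`
independent variables of mean 2; the rate of the law of large numbers is uniform in `S`. -/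
theorem tendsto_bolII {ε : ℝ} (hε : 0 < ε) :
    Tendsto (fun p : ℕ => bolII p
      {M | ε ≤ |(M.numEdges : ℝ) / (M.simpleCore.numEdges : ℝ) - 2|}) atTop (𝓝 0) := by
  obtain ⟨δ, hδ, hδ'⟩ := exists_weak_law digonLaw (measurable_of_countable _) integrable_numEdges hε
  rw [integral_numEdges] at hδ'
  rw [ENNReal.tendsto_atTop_zero] at hδ ⊢
  intro η hη
  obtain ⟨N, hN⟩ := hδ η hη
  refine ⟨max N 3, fun p hp => ?_⟩
  have hp3 : 3 ≤ p := le_trans (le_max_right _ _) hp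
  set A : Set PlanarMap := {M | ε ≤ |(M.numEdges : ℝ) / (M.simpleCore.numEdges : ℝ) - 2|} with hA
  have hle : mass (typeII p) (2 / 27) A ≤ mass (typeII p) (2 / 27) Set.univ * η := by
    rw [mass_typeII hp3, mass_typeII hp3, ← ENNReal.tsum_mul_right]
    refine ENNReal.tsum_le_tsum fun S => ?_
    obtain ⟨ι, _, Ψ, h1, h2, h3, h4⟩ := exists_law hp3 S.2
    rw [h4, h4, mul_assoc]
    refine mul_le_mul_right ?_ _
    have hset : {f | Ψ f ∈ A} = {f : ι → typeII 2 |
        ε ≤ |(∑ q, ((f q).1.numEdges : ℝ)) / (Fintype.card ι : ℝ) - 2|} := by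
      ext f
      rw [Set.mem_ofPred_eq, hA, Set.mem_ofPred_eq, Set.mem_ofPred_eq, h2, h3, h1]
      push_cast
      rfl
    have huniv : {f | Ψ f ∈ Set.univ} = Set.univ := Set.eq_univ_of_forall fun f => Set.mem_univ _
    rw [hset, hδ' ι, huniv, measure_univ, one_mul, h1]
    refine hN _ ?_
    exact (le_max_left _ _).trans (hp.trans (le_numEdges hp3 (typeIII_subset_typeII p S.2)))
  obtain ⟨h0, h1⟩ := mass_typeII_univ_ne hp3
  calc bolII p A = (mass (typeII p) (2 / 27) Set.univ)⁻¹ * mass (typeII p) (2 / 27) A :=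
        boltzmann_apply _ _ _
    _ ≤ (mass (typeII p) (2 / 27) Set.univ)⁻¹ * (mass (typeII p) (2 / 27) Set.univ * η) := by gcongr
    _ = η := by rw [← mul_assoc, ENNReal.inv_mul_cancel h0 h1, one_mul]

end PlanarMap

theorem proposition7 :
    -- `Bol_II(p)` and `Bol_III(p)` are well defined
    (∀ p : ℕ, 3 ≤ p →
      IsProbabilityMeasure (PlanarMap.bolII p) ∧ IsProbabilityMeasure (PlanarMap.bolIII p)) ∧
    -- the simple core is well defined
    (∀ p : ℕ, 3 ≤ p → ∀ M ∈ PlanarMap.typeII p, ∃! S, PlanarMap.IsSimpleCore M S) ∧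
    -- ratio of the numbers of edges, in probability
    (∀ ε : ℝ, 0 < ε →
      Tendsto (fun p : ℕ => PlanarMap.bolII p
          {M | ε ≤ |(M.numEdges : ℝ) / (M.simpleCore.numEdges : ℝ) - 2|})
        atTop (𝓝 0)) ∧
    -- law of the simple core
    (∀ p : ℕ, 3 ≤ p →
      (PlanarMap.bolII p).map PlanarMap.simpleCore = PlanarMap.bolIII p) :=
  ⟨fun _ hp => ⟨PlanarMap.isProbabilityMeasure_boltzmann (PlanarMap.mass_typeII_univ_ne hp),
      PlanarMap.isProbabilityMeasure_boltzmann (PlanarMap.mass_typeIII_univ_ne hp)⟩,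
    fun _ hp _ hM => PlanarMap.existsUnique_isSimpleCore hp hM,
    fun _ hε => PlanarMap.tendsto_bolII hε,
    fun _ hp => PlanarMap.map_simpleCore_bolII hp⟩
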